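/- For every $n\in\mathbb N$ let $G_n=\bigl(G_n^{(1)}\times\cdots\times G_n^{(k_n)}\times T^{s_n}\bigr)/Z_n$ be a compact connected Lie group, where the $G_n^{(i)}$ are compact connected simple Lie groups, $T^{s_n}$ is a torus of dimension $s_n\ge 0$ and $Z_n$ is a finite normal subgroup. Let $\pi_n$ denote the projection of the product onto $G_n$. In parts (1) and (2), let the groups $G_n$ form an increasing sequence $G_0\subseteq G_1\subseteq\cdots$ by means of injective smooth homomorphisms $\iota_{mn}:G_m\to G_n$ ($m\le n$, $\iota_{mn}\iota_{lm}=\iota_{ln}$, $\iota_{nn}=\mathrm{id}$), and let $G_\infty$ be their inductive limit with the inductive limit topology. An action of $G_\infty$ on a compact Hausdorff space $K$ is called equicontinuous if it is continuous and the family of maps $x\mapsto gx$, $g\in G_\infty$, is uniformly equicontinuous; it has no fixed points if no $x\in K$ satisfies $gx=x$ for all $g\in G_\infty$. **(1) Common factor.** Suppose that a compact connected Lie group $H$ is a common factor of all the $G_n$: for every $n$ there are an index $i_n$ and an isomorphism of Lie groups $e_n:H\to G_n^{(i_n)}$ such that $\iota_{mn}$ carries the image of $e_m(x)$ in $G_m$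 to the image of $e_n(x)$ in $G_n$, for all $m\le n$ and $x\in H$. Let $\Gamma\subseteq H$ be the set of all $x$ such that, for some $n$, $e_n(x)$ is the $i_n$-th component of an element of $Z_n$. Then $\Gamma$ is a finite normal subgroup of $H$, and $G_\infty$ has an equicontinuous action without fixed points on the compact manifold $K=H/\Gamma$. (In particular $K=H$ if the projections of the $Z_n$ to the factor $H$ are trivial.) **(2) Tori.** Let $S_n=\pi_n\bigl(G_n^{(1)}\times\cdots\times G_n^{(k_n)}\times\{1\}\bigr)=[G_n,G_n]$. Suppose that there is $n_0$ such that $s_n\ne 0$ for all $n>n_0$, and such that $\iota_{mn}^{-1}(S_n)=S_m$ for all $n_0<m\le n$ (that is, the tori $G_n/S_n$ also form an increasing sequence). Then $G_\infty$ has an equicontinuous action without fixed points on $K=S^1$. **(3) Concentration locus.** (No connecting homomorphisms are needed here.) Suppose that finitely many, and at least one, of the factors run through classical sequences: for $a$ in a nonempty finite set and every $n$ there is an index $j_a(n)$, with $j_a(n)\neq j_b(n)$ for $a\ne b$, such that $G_n^{(j_a(n))}$ is, for all $n$, of one of the types $SU(r+1)$, $\mathrm{Spin}(2r+1)$, $USp(2r)$,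 $\mathrm{Spin}(2r)$, the type depending only on $a$, with $r=r_a(n)\to\infty$ as $n\to\infty$. Let each $G_n$ carry a bi-invariant Riemannian metric which on each factor $G_n^{(j_a(n))}$ is the standardly normalized one, $\langle X,X\rangle=-\frac12\operatorname{Tr}X^2$ in the defining (for Spin: vector) representation, and let $\mu_n$ be the normalized Haar measure of $G_n$. Let $\Sigma_{a,n}\subset G_n^{(j_a(n))}$ be the following subset, described by the matrix $M$ of an element in the defining (vector) representation, with indices starting at $0$: * $SU(r+1)$: $M_{00}=0$ (the preimage of the hyperplane at infinity $\{\zeta_0=0\}$ of $\mathbb{CP}^r=SU(r+1)/U(r)$); * $\mathrm{Spin}(m)$: $M_{00}=M_{01}=0$ (the preimage of the bi-equator, consisting of the orthonormal frames $(v,w)$ with $v_0=0$ and $w_0=0$, of the sphere bundle $\mathrm{Spin}(m)/\mathrm{Spin}(m-2)$ of orthonormal 2-frames in $\mathbb R^m$); * $USp(2r)$: $\operatorname{Re}M_{00}=0$ (the preimage of an equator of $S^{4r-1}=USp(2r)/USp(2r-2)$). Then the sets $$\mathcal S_n=\pi_n\bigl(\{x : x_{j_a(n)}\in\Sigma_{a,n}\text{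 for all }a\}\bigr)\subset G_n$$ form a concentration locus of $(G_n,\mu_n)$: each $\mathcal S_n$ is a proper closed subset of $G_n$ that is contained in a submanifold of strictly positive codimension, and there is a sequence $\varepsilon_n>0$ with $\varepsilon_n\to0$ such that $\mu_n(G_n\setminus U_n)\to0$, where $U_n$ is the tubular neighbourhood of $\mathcal S_n$ of radius $\varepsilon_n$. -/

import Mathlib

open Set Filter Topology MeasureTheory
open scoped Manifold ContDiff ENNReal Bundle

/-! ### Compact connected Lie groups -/

/-- A compact connected Lie group (real, finite dimensional, smooth, Hausdorff). -/
structure CompactConnectedLieGroup where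
  carrier : Type
  dim : ℕ
  [group : Group carrier]
  [topology : TopologicalSpace carrier]
  [charts : ChartedSpace (EuclideanSpace ℝ (Fin dim)) carrier]
  [lieGroup : LieGroup (𝓡 dim) ∞ carrier]
  [t2 : T2Space carrier]
  [compact : CompactSpace carrier]
  [connected : ConnectedSpace carrier]

namespace CompactConnectedLieGroup

instance : CoeSort CompactConnectedLieGroup Type := ⟨carrier⟩

attribute [instance] group topology charts lieGroup t2 compact connected

variable (G : CompactConnectedLieGroup)

instance : IsTopologicalGroup G := topologicalGroup_of_lieGroup (𝓡 G.dim) ∞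

instance : LieGroup (𝓡 G.dim) (minSmoothness ℝ 3) G :=
  LieGroup.of_le (n := ∞) (by
    rw [minSmoothness_of_isRCLikeNormedField]
    exact WithTop.coe_le_coe.2 (le_top : (3 : ℕ∞) ≤ ⊤))

instance : MeasurableSpace G := borel G

instance : BorelSpace G := ⟨rfl⟩

/-- A compact connected Lie group is simple when its Lie algebra is (in particular it is not
abelian). -/
def IsSimple : Prop := LieAlgebra.IsSimple ℝ (GroupLieAlgebra (𝓡 G.dim) G)

end CompactConnectedLieGroup

/-- A presentation `G = (G⁽¹⁾ × ⋯ × G⁽ᵏ⁾ × Tˢ) / Z` with `G⁽ⁱ⁾` compact connected simple Lie groups,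
`Tˢ` a torus and `Z` a finite normal subgroup (the kernel of `proj`). The quotient is presented by
the projection, a surjective homomorphism that is a local diffeomorphism. -/
structure Presentation (G : CompactConnectedLieGroup) where
  k : ℕ
  s : ℕ
  factor : Fin k → CompactConnectedLieGroup
  simple : ∀ i, (factor i).IsSimple
  proj : (∀ i, factor i) × (Fin s → Circle) →* G
  surjective : Function.Surjective proj
  finite_ker : Finite proj.ker
  isLocalDiffeomorph : IsLocalDiffeomorph
    ((ModelWithCorners.pi fun i => 𝓡 (factor i).dim).prod
      (ModelWithCorners.pi fun _ : Fin s => 𝓡 1)) (𝓡 G.dim) ∞ proj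

namespace Presentation

variable {G : CompactConnectedLieGroup} (D : Presentation G)

/-- The canonical homomorphism of the factor `G⁽ⁱ⁾` into `G`. -/
noncomputable def incl (i : Fin D.k) : D.factor i →* G :=
  D.proj.comp ((MonoidHom.inl _ _).comp (MonoidHom.mulSingle (fun i => (D.factor i : Type)) i))

/-- The image of `G⁽¹⁾ × ⋯ × G⁽ᵏ⁾` in `G`; this is the commutator subgroup of `G`. -/
noncomputable def semisimplePart : Subgroup G := Subgroup.map D.proj (Subgroup.prod ⊤ ⊥)

end Presentation

/-! ### Increasing sequences and their inductive limits -/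

/-- An increasing sequence `G 0 ⊆ G 1 ⊆ ⋯` of Lie groups: a directed system of injective smooth
homomorphisms. -/
structure LieGroupChain (G : ℕ → CompactConnectedLieGroup) where
  map : ∀ m n : ℕ, m ≤ n → (G m →* G n)
  map_self : ∀ n x, map n n le_rfl x = x
  map_map : ∀ l m n (h₁ : l ≤ m) (h₂ : m ≤ n) x, map m n h₂ (map l m h₁ x) = map l n (h₁.trans h₂) x
  injective : ∀ m n h, Function.Injective (map m n h)
  contMDiff : ∀ m n h, ContMDiff (𝓡 (G m).dim) (𝓡 (G n).dim) ∞ (map m n h)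

namespace LieGroupChain

variable {G : ℕ → CompactConnectedLieGroup} (C : LieGroupChain G)

instance : DirectedSystem (fun n => (G n : Type)) (C.map · · ·) where
  map_self _ := C.map_self _
  map_map _ _ _ h₁ h₂ := C.map_map _ _ _ h₁ h₂

/-- The inductive limit `G_∞`. -/
def Limit : Type := DirectLimit (fun n => (G n : Type)) C.map

noncomputable instance : Group C.Limit :=
  inferInstanceAs (Group (DirectLimit (fun n => (G n : Type)) C.map))

/-- The canonical map `G n → G_∞`. -/
def of (n : ℕ) (x : G n) : C.Limit :=
  (⟦⟨n, x⟩⟧ : DirectLimit (fun n => (G n : Type)) C.map)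

/-- The inductive limit topology: the finest one for which all `G n → G_∞` are continuous. -/
instance : TopologicalSpace C.Limit := ⨆ n, TopologicalSpace.coinduced (C.of n) inferInstance

end LieGroupChain

/-- The topological group `Γ` has a continuous action on the compact Hausdorff space `K` that is
equicontinuous (for the unique uniformity of `K`) and without a point fixed by all of `Γ`. -/
def HasEquicontinuousActionWithoutFixedPoint (Γ K : Type) [Group Γ] [TopologicalSpace Γ]
    [TopologicalSpace K] [CompactSpace K] [T2Space K] : Prop :=
  letI : UniformSpace K := uniformSpaceOfCompactR1
  ∃ _ : MulAction Γ K, ContinuousSMul Γ K ∧ UniformEquicontinuous (fun (γ : Γ) (x : K) => γ • x) ∧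
    ∀ x : K, ∃ γ : Γ, γ • x ≠ x

/-! ### Bi-invariant metrics and concentration loci -/

/-- Smooth Riemannian metrics on `G`. -/
abbrev CompactConnectedLieGroup.Metric (G : CompactConnectedLieGroup) : Type :=
  Bundle.ContMDiffRiemannianMetric (𝓡 G.dim) ∞ (EuclideanSpace ℝ (Fin G.dim))
    (fun x : G => TangentSpace (𝓡 G.dim) x)

namespace CompactConnectedLieGroup.Metric

variable {G : CompactConnectedLieGroup} (g : G.Metric)

/-- Left and right translations are isometries of the metric tensor. -/
def IsBiInvariant : Prop :=
  ∀ (a x : G) (v w : TangentSpace (𝓡 G.dim) x),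
    g.inner (a * x) (mfderiv (𝓡 G.dim) (𝓡 G.dim) (fun y : G => a * y) x v)
      (mfderiv (𝓡 G.dim) (𝓡 G.dim) (fun y : G => a * y) x w) = g.inner x v w ∧
    g.inner (x * a) (mfderiv (𝓡 G.dim) (𝓡 G.dim) (fun y : G => y * a) x v)
      (mfderiv (𝓡 G.dim) (𝓡 G.dim) (fun y : G => y * a) x w) = g.inner x v w

/-- The Riemannian distance of `g`. -/
noncomputable def edist (x y : G) : ℝ≥0∞ :=
  letI : Bundle.RiemannianBundle (fun x : G => TangentSpace (𝓡 G.dim) x) :=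
    ⟨g.toRiemannianMetric⟩
  Manifold.riemannianEDist (𝓡 G.dim) x y

/-- The tubular neighbourhood of `S` of radius `ε`. -/
def tube (S : Set G) (ε : ℝ) : Set G := {x | ∃ y ∈ S, g.edist x y < ENNReal.ofReal ε}

end CompactConnectedLieGroup.Metric

/-- `N` is an embedded submanifold of codimension `c`: near each of its points it is the zero set of
a smooth submersion to `ℝᶜ`. -/
def IsSubmanifoldOfCodim (G : CompactConnectedLieGroup) (c : ℕ) (N : Set G) : Prop :=
  ∀ x ∈ N, ∃ (U : Set G) (f : G → EuclideanSpace ℝ (Fin c)), IsOpen U ∧ x ∈ U ∧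
    ContMDiffOn (𝓡 G.dim) (𝓡 c) ∞ f U ∧
    (∀ y ∈ U, Function.Surjective (mfderiv (𝓡 G.dim) (𝓡 c) f y)) ∧ N ∩ U = {y ∈ U | f y = 0}

/-- The measures `μ n` concentrate on the sets `S n` at least at rate `ε n`. -/
structure ConcentratesAtRate (G : ℕ → CompactConnectedLieGroup) (g : ∀ n, (G n).Metric)
    (μ : ∀ n, Measure (G n)) (S : ∀ n, Set (G n)) (ε : ℕ → ℝ) : Prop where
  pos : ∀ n, 0 < ε n
  tendsto_zero : Tendsto ε atTop (𝓝 0)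
  tendsto_measure : Tendsto (fun n => μ n ((g n).tube (S n) (ε n))ᶜ) atTop (𝓝 0)

/-- `S n ⊆ G n` is a concentration locus: a sequence of proper closed subsets, each contained in a
submanifold of positive codimension, on which the measures concentrate. -/
structure IsConcentrationLocus (G : ℕ → CompactConnectedLieGroup) (g : ∀ n, (G n).Metric)
    (μ : ∀ n, Measure (G n)) (S : ∀ n, Set (G n)) : Prop where
  isClosed : ∀ n, IsClosed (S n)
  ne_univ : ∀ n, S n ≠ univ
  subset_submanifold : ∀ n, ∃ c : ℕ, 0 < c ∧ ∃ N, IsSubmanifoldOfCodim (G n) c N ∧ S n ⊆ N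
  concentrates : ∃ ε, ConcentratesAtRate G g μ S ε

/-! ### The classical series -/

/-- The series `A r = SU(r+1)`, `B r = Spin(2r+1)`, `C r = USp(2r)`, `D r = Spin(2r)`. -/
inductive ClassicalSeries
  | A | B | C | D

namespace ClassicalSeries

/-- Size of the matrices of the defining representation (the vector representation for `Spin`). -/
def size : ClassicalSeries → ℕ → ℕ
  | A, r => r + 1
  | B, r => 2 * r + 1
  | C, r => 2 * r
  | D, r => 2 * r

/-- The block matrix `((0, -1), (1, 0))` with blocks of size `r`, when `N = 2 r`. -/
def symplecticForm (r N : ℕ) : Matrix (Fin N) (Fin N) ℂ :=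
  Matrix.of fun i j =>
    if (i : ℕ) = j + r then 1 else if (j : ℕ) = i + r then -1 else 0

/-- The matrix groups `SU(r+1)`, `SO(2r+1)`, `USp(2r)`, `SO(2r)`. -/
def matrixGroup (t : ClassicalSeries) (r : ℕ) :
    Set (Matrix (Fin (t.size r)) (Fin (t.size r)) ℂ) :=
  {M | M ∈ Matrix.specialUnitaryGroup (Fin (t.size r)) ℂ ∧
    match t with
    | A => True
    | B | D => ∀ i j, (M i j).im = 0
    | C => M * symplecticForm r _ * M.transpose = symplecticForm r _}

/-- Their Lie algebras `su(r+1)`, `so(2r+1)`, `usp(2r)`, `so(2r)`. -/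
def matrixLieAlgebra (t : ClassicalSeries) (r : ℕ) :
    Set (Matrix (Fin (t.size r)) (Fin (t.size r)) ℂ) :=
  {X | X.conjTranspose = -X ∧ X.trace = 0 ∧
    match t with
    | A => True
    | B | D => ∀ i j, (X i j).im = 0
    | C => X * symplecticForm r _ + symplecticForm r _ * X.transpose = 0}

/-- Degree of the covering of the matrix group by the simply connected group. -/
def coveringDegree : ClassicalSeries → ℕ
  | A | C => 1
  | B | D => 2

/-- The matrices lying over the concentration locus.
* `SU(r+1)`: the first column, as a point of `ℂPʳ = SU(r+1)/U(r)`, lies on the hyperplane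
  `ζ₀ = 0`.
* `SO(m)`: the first two columns form an orthonormal frame `(v, w)`, a point of
  `Spin(m)/Spin(m-2)`; `v` lies on the equator `v₀ = 0` of the unit sphere of `ℝᵐ` and
  `w` on the equator `w₀ = 0` of the unit sphere of the orthogonal complement of `v`.
* `USp(2r)`: the first column, as a point of `S⁴ʳ⁻¹ = USp(2r)/USp(2r-2)`, lies on the equator
  `Re z₀ = 0`. -/
def matrixLocus (t : ClassicalSeries) (r : ℕ) :
    Set (Matrix (Fin (t.size r)) (Fin (t.size r)) ℂ) :=
  {M | match t with
    | A => ∀ i : Fin _, (i : ℕ) = 0 → M i i = 0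
    | B | D => ∀ i j : Fin _, (i : ℕ) = 0 → (j : ℕ) ≤ 1 → M i j = 0
    | C => ∀ i : Fin _, (i : ℕ) = 0 → (M i i).re = 0}

end ClassicalSeries

/-- An identification of `F` with the simply connected classical group of type `t` and rank `r`,
through its defining representation: a smooth homomorphism onto the matrix group, which is an
isomorphism on Lie algebras, and has trivial kernel for `SU` and `USp` and is a double covering for
`Spin` (the connected double covering of `SO(m)`, `m ≥ 3`, is `Spin(m)`). -/
structure ClassicalStructure (F : CompactConnectedLieGroup) (t : ClassicalSeries) (r : ℕ) where
  rep : F →* Matrix (Fin (t.size r)) (Fin (t.size r)) ℂ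
  contMDiff : ∀ i j, ContMDiff (𝓡 F.dim) 𝓘(ℝ, ℂ) ∞ (fun x => rep x i j)
  range_rep : Set.range rep = t.matrixGroup r
  card_ker : Nat.card rep.ker = t.coveringDegree
  bijOn_deriv : Set.BijOn
    (fun (v : TangentSpace (𝓡 F.dim) (1 : F)) => (Matrix.of fun i j =>
      (mfderiv (𝓡 F.dim) 𝓘(ℝ, ℂ) (fun x => rep x i j) 1 v : ℂ)))
    univ (t.matrixLieAlgebra r)

namespace ClassicalStructure

variable {F : CompactConnectedLieGroup} {t : ClassicalSeries} {r : ℕ}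
  (σ : ClassicalStructure F t r)

/-- The differential at the identity of the defining representation. -/
noncomputable def deriv (v : TangentSpace (𝓡 F.dim) (1 : F)) :
    Matrix (Fin (t.size r)) (Fin (t.size r)) ℂ :=
  Matrix.of fun i j => (mfderiv (𝓡 F.dim) 𝓘(ℝ, ℂ) (fun x => σ.rep x i j) 1 v : ℂ)

/-- The concentration locus of the classical group. -/
def locus : Set F := {x | σ.rep x ∈ t.matrixLocus r}

end ClassicalStructure

/-- The restriction of the metric `g` to the factor `i`, a classical group, is the standardly
normalized one, `⟨X, X⟩ = -½ Tr X²` in the defining representation. -/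
def Presentation.IsStandardOn {G : CompactConnectedLieGroup} (D : Presentation G) (g : G.Metric)
    (i : Fin D.k) {t : ClassicalSeries} {r : ℕ} (σ : ClassicalStructure (D.factor i) t r) : Prop :=
  ∀ v : TangentSpace (𝓡 (D.factor i).dim) (1 : D.factor i),
    g.inner (D.incl i 1) (mfderiv (𝓡 (D.factor i).dim) (𝓡 G.dim) (D.incl i) 1 v)
      (mfderiv (𝓡 (D.factor i).dim) (𝓡 G.dim) (D.incl i) 1 v) =
    -(1 / 2) * (Matrix.trace (σ.deriv v * σ.deriv v)).re

/-! ### Actions through homomorphisms into compact groups -/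

/-! Parts (1) and (2) both come down to a nontrivial continuous homomorphism from `C.Limit` to a
compact group `K`. Through it the limit acts on `K` by left translations; these are equicontinuous
because multiplication is uniformly continuous on a compact group, and an element acting
nontrivially moves every point. By `exists_limit_hom` it suffices to give compatible homomorphisms
on the groups `G n`.

Common factor. The centre of a compact simple group is finite: otherwise it would accumulate at the
identity, and a tangent direction of the centre would be central in the Lie algebra
(`exists_central_of_accPt`). Kernels of the presentations are finite and normal in connected groups,
hence central, so the subgroups `Γ n` lie in the finite centre of the common factor. The rest of `G
m` commutes with the common factor, so its image in `G n` has a central component there; modulo `Γ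
n` this component takes finitely many values on a connected group, hence is trivial. Thus the
projections to the factor are compatible along the chain, the `Γ n` increase, and the limit maps
onto the quotient by their union.

Tori. A power of a coordinate of the torus kills the finite kernel and gives a nontrivial character
of one `G n`, trivial on the semisimple part. It extends to the next group
(`exists_extension_character`) because a continuous character of a closed subgroup of a torus is the
restriction of a character of the torus (`exists_torusCharacter_eq`, by Stone–Weierstrass and
orthogonality of characters). Recursion gives a character of the limit.

Concentration. Row zero of the defining matrix of a Haar-random element is a unit vector. Quarter
turns in the group exchange each of its at most two polar entries with at least `r` entries,
counting itself, up to sign; so a polar entry has mean square at most `1 / r`, and Markov's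
inequality makes the polar part small off a set of small measure (`measure_sum_norm_sq_ge_le`). If
the polar part has norm `b < 1`, the rotation by `arcsin b` in the plane of the polar part and its
complement brings the matrix into the locus (`exists_rot_poles_eq_zero`). With the standard metric
such a rotation moves the points of `G n` by at most a constant times its angle
(`exists_rep_eq_rot`), so most of the mass lies in a thin tube. The locus lies in the zero set of
the first matrix entry or of its real part; this function is a submersion there, and its zero set is
preserved by central elements, so it descends to a submanifold of the quotient `G n`
(`isSubmanifoldOfCodim_height`). -/

theorem hasEquicontinuousActionWithoutFixedPoint_of_hom {Γ K : Type} [Group Γ]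
    [TopologicalSpace Γ] [Group K] [TopologicalSpace K] [IsTopologicalGroup K] [CompactSpace K]
    [T2Space K] (θ : Γ →* K) (hθ : Continuous θ) (hne : ∃ γ, θ γ ≠ 1) :
    HasEquicontinuousActionWithoutFixedPoint Γ K := by
  let : UniformSpace K := uniformSpaceOfCompactR1
  refine ⟨MulAction.compHom K θ, ?_, ?_, ?_⟩
  · let := MulAction.compHom K θ
    exact ⟨(hθ.comp continuous_fst).mul continuous_snd⟩
  -- Only the second argument of the product varies, so one entourage of `K` serves all `γ` at once.
  · have huc : UniformContinuous fun p : K × K => p.1 * p.2 :=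
      CompactSpace.uniformContinuous_of_continuous continuous_mul
    intro U hU
    obtain ⟨V, hV, W, hW, hVW⟩ := entourageProd_subset (huc hU)
    filter_upwards [hW] with xy hxy γ
    exact hVW (show ((θ γ, xy.1), (θ γ, xy.2)) ∈ entourageProd V W from
      ⟨refl_mem_uniformity hV, hxy⟩)
  · intro x
    obtain ⟨γ, hγ⟩ := hne
    exact ⟨γ, fun h => hγ (mul_eq_right.1 (show θ γ * x = x from h))⟩

namespace LieGroupChain

variable {G : ℕ → CompactConnectedLieGroup} (C : LieGroupChain G)

theorem limit_exists_rep (x : C.Limit) : ∃ n y, C.of n y = x := by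
  obtain ⟨⟨n, y⟩, rfl⟩ := Quotient.exists_rep x
  exact ⟨n, y, rfl⟩

theorem of_map {m n : ℕ} (h : m ≤ n) (x : G m) : C.of n (C.map m n h x) = C.of m x :=
  (DirectLimit.eq_of_le (f := (C.map · · ·)) (⟨m, x⟩ : Σ i, G i) n h).symm

/-- The homomorphism from the inductive limit given by a compatible family. -/
theorem exists_limit_hom {K : Type} [Group K] [TopologicalSpace K] (θ : ∀ n, G n →* K)
    (hθ : ∀ n, Continuous (θ n)) (hc : ∀ m n h x, θ n (C.map m n h x) = θ m x) :
    ∃ Θ : C.Limit →* K, Continuous Θ ∧ ∀ n x, Θ (C.of n x) = θ n x := by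
  let f : C.Limit → K := DirectLimit.lift C.map (fun n => θ n)
    (fun i j h x => (hc i j h x).symm)
  have hf : ∀ n x, f (C.of n x) = θ n x := fun n x => rfl
  refine ⟨MonoidHom.mk' f ?_, ?_, hf⟩
  · intro a b
    obtain ⟨m, x, rfl⟩ := C.limit_exists_rep a
    obtain ⟨n, y, rfl⟩ := C.limit_exists_rep b
    rw [← C.of_map (le_max_left m n), ← C.of_map (le_max_right m n)]
    have : C.of (max m n) (C.map m _ (le_max_left m n) x) *
      C.of (max m n) (C.map n _ (le_max_right m n) y) = C.of (max m n)
        (C.map m _ (le_max_left m n) x * C.map n _ (le_max_right m n) y) :=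
      DirectLimit.mul_def _ _ _
    rw [this, hf, hf, hf, map_mul]
  · change Continuous f
    refine continuous_iSup_dom.2 fun n => continuous_coinduced_dom.2 ?_
    exact hθ n

end LieGroupChain

/-! ### Extension of characters of closed subgroups of tori -/

/-- Translation by `b` multiplies the integral by `χ b`, which differs from 1. -/
theorem integral_eq_zero_of_hom_ne_one {B : Type*} [Group B] [TopologicalSpace B]
    [IsTopologicalGroup B] [MeasurableSpace B] [BorelSpace B] (μ : Measure B)
    [μ.IsMulLeftInvariant] (χ : B →* Circle) {b : B} (hb : χ b ≠ 1) :
    ∫ x, (χ x : ℂ) ∂μ = 0 := by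
  have h : ∫ x, (χ x : ℂ) ∂μ = χ b * ∫ x, (χ x : ℂ) ∂μ := by
    rw [← integral_const_mul, ← integral_mul_left_eq_self _ b]
    simp
  have h1 : (1 - (χ b : ℂ)) * ∫ x, (χ x : ℂ) ∂μ = 0 := by linear_combination h
  refine (mul_eq_zero.1 h1).resolve_left fun h2 => hb ?_
  exact Subtype.ext (sub_eq_zero.1 h2).symm

/-- A character of the torus with given exponents. -/
noncomputable def torusCharacter {s : ℕ} (a : Fin s → ℤ) : (Fin s → Circle) →* Circle where
  toFun t := ∏ i, t i ^ a i
  map_one' := by simp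
  map_mul' x y := by simp [mul_zpow, Finset.prod_mul_distrib]

theorem continuous_torusCharacter {s : ℕ} (a : Fin s → ℤ) : Continuous (torusCharacter a) :=
  continuous_finsetProd (f := fun i (t : Fin s → Circle) => t i ^ a i) Finset.univ
    fun i _ => (continuous_apply i).zpow (a i)

theorem torusCharacter_add {s : ℕ} (a b : Fin s → ℤ) (t : Fin s → Circle) :
    torusCharacter (a + b) t = torusCharacter a t * torusCharacter b t := by
  simp [torusCharacter, zpow_add, Finset.prod_mul_distrib]

theorem torusCharacter_neg {s : ℕ} (a : Fin s → ℤ) (t : Fin s → Circle) :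
    torusCharacter (-a) t = (torusCharacter a t)⁻¹ := by
  simp [torusCharacter]

theorem torusCharacter_zero {s : ℕ} (t : Fin s → Circle) :
    torusCharacter 0 t = 1 := by
  simp [torusCharacter]

theorem torusCharacter_single {s : ℕ} (i : Fin s) (k : ℤ) (t : Fin s → Circle) :
    torusCharacter (Pi.single i k) t = t i ^ k := by
  change ∏ j, t j ^ (Pi.single i k : Fin s → ℤ) j = _
  rw [Finset.prod_eq_single i (fun j _ hj => by simp [Pi.single_eq_of_ne hj]) (by simp)]
  simp

theorem continuous_circle_coe : Continuous ((↑) : Circle → ℂ) := continuous_subtype_val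

/-- The restriction of a character of the torus to a subgroup, as a continuous function. -/
noncomputable def torusCharacterOn {s : ℕ} (B : Subgroup (Fin s → Circle)) (a : Fin s → ℤ) :
    C(B, ℂ) :=
  ⟨fun t => (torusCharacter a t : ℂ),
    continuous_circle_coe.comp ((continuous_torusCharacter a).comp continuous_subtype_val)⟩

/-- The algebra of trigonometric polynomials on a subgroup of a torus. -/
noncomputable def trigPolynomials {s : ℕ} (B : Subgroup (Fin s → Circle)) :
    StarSubalgebra ℂ C(B, ℂ) where
  carrier := Submodule.span ℂ (range (torusCharacterOn B))
  add_mem' := Submodule.add_mem _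
  algebraMap_mem' r := by
    rw [Algebra.algebraMap_eq_smul_one]
    refine Submodule.smul_mem _ _ (Submodule.subset_span ⟨0, ?_⟩)
    ext t
    simp [torusCharacterOn, torusCharacter_zero]
  mul_mem' {f g} hf hg := by
    refine Submodule.span_induction₂ (p := fun f g _ _ => f * g ∈
      Submodule.span ℂ (range (torusCharacterOn B))) ?_ ?_ ?_ ?_ ?_ ?_ ?_ hf hg
    · rintro _ _ ⟨a, rfl⟩ ⟨b, rfl⟩
      refine Submodule.subset_span ⟨a + b, ?_⟩
      ext t
      simp [torusCharacterOn, torusCharacter_add]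
    · simp
    · simp
    · intro x y z _ _ _ h1 h2
      rw [add_mul]; exact Submodule.add_mem _ h1 h2
    · intro x y z _ _ _ h1 h2
      rw [mul_add]; exact Submodule.add_mem _ h1 h2
    · intro r x y _ _ h
      rw [smul_mul_assoc]; exact Submodule.smul_mem _ _ h
    · intro r x y _ _ h
      rw [mul_smul_comm]; exact Submodule.smul_mem _ _ h
  star_mem' {f} hf := by
    refine Submodule.span_induction (p := fun f _ => star f ∈
      Submodule.span ℂ (range (torusCharacterOn B))) ?_ ?_ ?_ ?_ hf
    · rintro _ ⟨a, rfl⟩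
      refine Submodule.subset_span ⟨-a, ?_⟩
      ext t
      simp only [torusCharacterOn, torusCharacter_neg, ContinuousMap.coe_mk,
        ContinuousMap.star_apply]
      rw [Circle.coe_inv_eq_conj]; rfl
    · simp
    · intro x y _ _ h1 h2
      rw [star_add]; exact Submodule.add_mem _ h1 h2
    · intro r x _ h
      rw [star_smul]; exact Submodule.smul_mem _ _ h

/-- Restricted torus characters span a dense algebra by Stone–Weierstrass. If `β` were none of them,
it would be orthogonal to all of them; but for a trigonometric polynomial `P` at distance less than
1 from `β`, the integral of `star β * (β - P)` would then be 1 and of modulus less than 1. -/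
theorem exists_torusCharacter_eq {s : ℕ} (B : Subgroup (Fin s → Circle))
    (hB : IsClosed (B : Set (Fin s → Circle))) (β : B →* Circle) (hβ : Continuous β) :
    ∃ a : Fin s → ℤ, ∀ t : B, torusCharacter a t = β t := by
  have : CompactSpace B := isCompact_iff_compactSpace.1 hB.isCompact
  let : MeasurableSpace B := borel B
  have : BorelSpace B := ⟨rfl⟩
  by_contra! hne
  let μ : Measure B := Measure.haarMeasure ⊤
  have : IsProbabilityMeasure μ := ⟨Measure.haarMeasure_self⟩
  let b : C(B, ℂ) := ⟨fun t => (β t : ℂ), continuous_circle_coe.comp hβ⟩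
  have hsep : (trigPolynomials B).SeparatesPoints := by
    intro x y hxy
    obtain ⟨i, hi⟩ : ∃ i, (x : Fin s → Circle) i ≠ (y : Fin s → Circle) i := by
      by_contra! h
      exact hxy (Subtype.ext (funext h))
    refine ⟨_, ⟨torusCharacterOn B (Pi.single i 1), Submodule.subset_span ⟨_, rfl⟩, rfl⟩, ?_⟩
    intro h
    have h : ((torusCharacter (Pi.single i 1) (x : Fin s → Circle) : Circle) : ℂ) =
      (torusCharacter (Pi.single i 1) (y : Fin s → Circle) : Circle) := h
    rw [torusCharacter_single, torusCharacter_single, zpow_one, zpow_one] at h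
    exact hi (Subtype.ext h)
  have hdense := ContinuousMap.starSubalgebra_topologicalClosure_eq_top_of_separatesPoints
    (trigPolynomials B) hsep
  have hb : b ∈ closure (trigPolynomials B : Set C(B, ℂ)) := by
    rw [← StarSubalgebra.topologicalClosure_coe, hdense]; trivial
  obtain ⟨P, hP, hdist⟩ := Metric.mem_closure_iff.1 hb 1 one_pos
  have hint : ∀ f : C(B, ℂ), Integrable f μ := fun f =>
    f.continuous.integrable_of_hasCompactSupport (HasCompactSupport.of_compactSpace f)
  have horth : ∫ x, (star b * P : C(B, ℂ)) x ∂μ = 0 := by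
    refine Submodule.span_induction (p := fun f _ => ∫ x, (star b * f : C(B, ℂ)) x ∂μ = 0)
      ?_ ?_ ?_ ?_ hP
    · rintro _ ⟨a, rfl⟩
      obtain ⟨t, ht⟩ := hne a
      have := integral_eq_zero_of_hom_ne_one μ
        (β⁻¹ * (torusCharacter a).comp B.subtype) (b := t) (fun h => ht (by
          have h : (β t)⁻¹ * torusCharacter a t = 1 := h
          exact (inv_mul_eq_one.1 h).symm))
      rw [← this]
      refine integral_congr_ae (Eventually.of_forall fun x => ?_)
      change star (β x : ℂ) * _ = (((β x)⁻¹ * torusCharacter a x : Circle) : ℂ)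
      rw [Circle.coe_mul, Circle.coe_inv_eq_conj]; rfl
    · simp
    · intro x y _ _ h1 h2
      rw [mul_add]
      simp only [ContinuousMap.add_apply]
      rw [integral_add (hint _) (hint _), h1, h2, add_zero]
    · intro r x _ h
      rw [mul_smul_comm]
      simp only [ContinuousMap.smul_apply]
      rw [integral_smul, h, smul_zero]
  have hbb : star b * b = 1 := by
    ext t
    change star (β t : ℂ) * (β t : ℂ) = 1
    have := Circle.coe_inv_eq_conj (β t)
    rw [← starRingEnd_apply, ← this, ← Circle.coe_mul, inv_mul_cancel, Circle.coe_one]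
  have h1 : ∫ x, (star b * (b - P) : C(B, ℂ)) x ∂μ = 1 := by
    rw [mul_sub, hbb]
    simp only [ContinuousMap.sub_apply]
    rw [integral_sub (hint _) (hint _), horth]
    simp
  have h2 : ‖∫ x, (star b * (b - P) : C(B, ℂ)) x ∂μ‖ ≤ dist b P := by
    have := norm_integral_le_of_norm_le_const (μ := μ)
      (f := fun x => (star b * (b - P) : C(B, ℂ)) x) (C := dist b P)
      (Eventually.of_forall fun x => ?_)
    · simpa using this
    · change ‖star (β x : ℂ) * (b - P) x‖ ≤ _
      rw [norm_mul, norm_star, Circle.norm_coe, one_mul, dist_eq_norm]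
      exact ContinuousMap.norm_coe_le_norm _ x
  rw [h1, norm_one] at h2
  linarith

/-! ### Descent to quotients and the torus case -/

/-- A continuous surjection from a compact space onto a Hausdorff space is a quotient map, so the
algebraic factorization is automatically continuous. -/
theorem exists_hom_of_ker_le {P B K : Type*} [Group P] [TopologicalSpace P] [CompactSpace P]
    [Group B] [TopologicalSpace B] [T2Space B] [Group K] [TopologicalSpace K]
    (q : P →* B) (hq : Continuous q) (hs : Function.Surjective q) (f : P →* K)
    (hf : Continuous f) (hk : ∀ x, q x = 1 → f x = 1) :
    ∃ β : B →* K, Continuous β ∧ ∀ x, β (q x) = f x := by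
  let β : B →* K := q.liftOfSurjective hs ⟨f, fun x hx => hk x hx⟩
  have hβ : ∀ x, β (q x) = f x := fun x => q.liftOfRightInverse_comp_apply _ _ ⟨f, _⟩ x
  refine ⟨β, ?_, hβ⟩
  rw [(hq.isClosedMap.isQuotientMap hq hs).continuous_iff]
  convert hf
  exact funext hβ

namespace Presentation

variable {G : CompactConnectedLieGroup} (D : Presentation G)

/-- The product of the factors and of the torus. -/
abbrev Cover : Type := (∀ i, D.factor i) × (Fin D.s → Circle)

theorem continuous_proj : Continuous D.proj := D.isLocalDiffeomorph.contMDiff.continuous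

theorem mem_semisimplePart {x : G} :
    x ∈ D.semisimplePart ↔ ∃ y : D.Cover, y.2 = 1 ∧ D.proj y = x := by
  simp [semisimplePart, Subgroup.mem_map, Subgroup.mem_prod]

theorem exists_character_of_torusCharacter (a : Fin D.s → ℤ)
    (ha : ∀ z : D.Cover, D.proj z = 1 → torusCharacter a z.2 = 1) :
    ∃ χ : G →* Circle, Continuous χ ∧ ∀ y, χ (D.proj y) = torusCharacter a y.2 :=
  exists_hom_of_ker_le D.proj D.continuous_proj D.surjective
    ((torusCharacter a).comp (MonoidHom.snd _ _))
    ((continuous_torusCharacter a).comp continuous_snd) ha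

/-- The order `N` of the kernel of the presentation annihilates that kernel, so the `N`-th power of
a torus coordinate descends to `G`. -/
theorem exists_nontrivial_character (hs : D.s ≠ 0) :
    ∃ χ : G →* Circle, Continuous χ ∧ (∀ x ∈ D.semisimplePart, χ x = 1) ∧ ∃ x, χ x ≠ 1 := by
  have := D.finite_ker
  let i : Fin D.s := ⟨0, Nat.pos_of_ne_zero hs⟩
  let N := Nat.card D.proj.ker
  have hN : N ≠ 0 := Nat.card_pos.ne'
  obtain ⟨χ, hχ, hχ'⟩ := D.exists_character_of_torusCharacter (Pi.single i N) (fun z hz => by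
    have h : (⟨z, hz⟩ : D.proj.ker) ^ N = 1 := pow_card_eq_one'
    have h : z ^ N = 1 := congrArg Subtype.val h
    rw [torusCharacter_single, zpow_natCast]
    exact congrFun (congrArg Prod.snd h) i)
  refine ⟨χ, hχ, ?_, ?_⟩
  · intro x hx
    obtain ⟨y, hy, rfl⟩ := D.mem_semisimplePart.1 hx
    rw [hχ', hy, map_one]
  -- At this point the descended character takes the value `exp (π i) = -1`.
  · refine ⟨D.proj (1, fun _ => Circle.exp (Real.pi / N)), ?_⟩
    rw [hχ', torusCharacter_single, zpow_natCast, ← Circle.exp_nsmul, nsmul_eq_mul,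
      mul_div_cancel₀ _ (Nat.cast_ne_zero.2 hN)]
    intro h
    have := congrArg ((↑) : Circle → ℂ) h
    rw [Circle.coe_exp, Complex.exp_pi_mul_I] at this
    norm_num at this

/-- Transport `χ` to the torus of `D'`. On the fibre product of the cover of `G'` with `G`, its
value depends only on the torus component: if that component is trivial, `ι g` is in the semisimple
part, hence so is `g`. This defines a character on a closed subgroup `B` of the torus, which extends
to the whole torus. -/
theorem exists_extension_character {G' : CompactConnectedLieGroup} (D' : Presentation G')
    (ι : G →* G') (hι : Continuous ι)
    (hS : D'.semisimplePart.comap ι = D.semisimplePart) (χ : G →* Circle) (hχ : Continuous χ)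
    (hχS : ∀ x ∈ D.semisimplePart, χ x = 1) :
    ∃ χ' : G' →* Circle, Continuous χ' ∧ (∀ x ∈ D'.semisimplePart, χ' x = 1) ∧
      ∀ x, χ' (ι x) = χ x := by
  let P : Subgroup (D'.Cover × G) :=
    MonoidHom.eqLocus (D'.proj.comp (MonoidHom.fst _ _)) (ι.comp (MonoidHom.snd _ _))
  have hP : IsClosed (P : Set (D'.Cover × G)) :=
    isClosed_eq (D'.continuous_proj.comp continuous_fst) (hι.comp continuous_snd)
  have : CompactSpace P := isCompact_iff_compactSpace.1 hP.isCompact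
  let τ : D'.Cover × G →* (Fin D'.s → Circle) := (MonoidHom.snd _ _).comp (MonoidHom.fst _ _)
  have hτ : Continuous τ := continuous_snd.comp continuous_fst
  let B : Subgroup (Fin D'.s → Circle) := P.map τ
  have hB : IsClosed (B : Set (Fin D'.s → Circle)) := (hP.isCompact.image hτ).isClosed
  obtain ⟨β, hβ, hβ'⟩ := exists_hom_of_ker_le (τ.subgroupMap P)
    ((hτ.comp continuous_subtype_val).subtype_mk _) (τ.subgroupMap_surjective P)
    ((χ.comp (MonoidHom.snd _ _)).comp P.subtype)
    ((hχ.comp continuous_snd).comp continuous_subtype_val) (by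
      rintro ⟨⟨w, g⟩, hw⟩ h
      have h : w.2 = 1 := congrArg Subtype.val h
      have hw : D'.proj w = ι g := hw
      refine hχS g ?_
      rw [← hS, Subgroup.mem_comap, ← hw]
      exact D'.mem_semisimplePart.2 ⟨w, h, rfl⟩)
  obtain ⟨a, ha⟩ := exists_torusCharacter_eq B hB β hβ
  have key : ∀ w g, D'.proj w = ι g → torusCharacter a w.2 = χ g := fun w g h =>
    (ha ((τ.subgroupMap P) ⟨(w, g), h⟩)).trans (hβ' ⟨(w, g), h⟩)
  -- Elements of the kernel lie over `g = 1`, so the extended torus character is trivial on them and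
  -- descends to `G'`.
  obtain ⟨χ', hc, hχ'⟩ := D'.exists_character_of_torusCharacter a (fun z hz => by
    rw [key z 1 (by rw [hz, map_one]), map_one])
  refine ⟨χ', hc, ?_, ?_⟩
  · intro x hx
    obtain ⟨y, hy, rfl⟩ := D'.mem_semisimplePart.1 hx
    rw [hχ', hy, map_one]
  · intro x
    obtain ⟨w, hw⟩ := D'.surjective (ι x)
    rw [← hw, hχ', key w x hw]

end Presentation

theorem hasAction_circle_of_tori {G : ℕ → CompactConnectedLieGroup}
    (D : ∀ n, Presentation (G n)) (C : LieGroupChain G) (n₀ : ℕ) (hs : ∀ n > n₀, (D n).s ≠ 0)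
    (hS : ∀ m n (h : m ≤ n), n₀ < m →
        (D n).semisimplePart.comap (C.map m n h) = (D m).semisimplePart) :
    HasEquicontinuousActionWithoutFixedPoint C.Limit Circle := by
  have hcont : ∀ m n h, Continuous (C.map m n h) := fun m n h => (C.contMDiff m n h).continuous
  obtain ⟨χ₀, hχ₀, hχ₀S, x₀, hx₀⟩ := (D (n₀ + 1)).exists_nontrivial_character (hs _ (by omega))
  -- The recursion carries triviality on the semisimple part along, since each extension step needs
  -- it. It starts at `n₀ + 1`, the first index covered by both hypotheses.
  let T : ℕ → Type := fun k => {χ : G (n₀ + 1 + k) →* Circle //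
    Continuous χ ∧ ∀ x ∈ (D (n₀ + 1 + k)).semisimplePart, χ x = 1}
  have hstep : ∀ k (χ : T k), ∃ χ' : T (k + 1),
      ∀ x, χ'.1 (C.map (n₀ + 1 + k) (n₀ + 1 + (k + 1)) (by omega) x) = χ.1 x := by
    intro k χ
    obtain ⟨χ', h1, h2, h3⟩ := (D (n₀ + 1 + k)).exists_extension_character
      (D (n₀ + 1 + (k + 1))) (C.map _ _ (by omega)) (hcont _ _ _) (hS _ _ _ (by omega))
      χ.1 χ.2.1 χ.2.2
    exact ⟨⟨χ', h1, h2⟩, h3⟩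
  choose ext hext using hstep
  let seq : ∀ k, T k := fun k => Nat.rec (motive := T) ⟨χ₀, hχ₀, hχ₀S⟩ (fun k χ => ext k χ) k
  have hseq : ∀ k x, (seq (k + 1)).1
      (C.map (n₀ + 1 + k) (n₀ + 1 + (k + 1)) (by omega) x) = (seq k).1 x :=
    fun k x => hext k (seq k) x
  have hseq' : ∀ k l (h : k ≤ l) x, (seq l).1
      (C.map (n₀ + 1 + k) (n₀ + 1 + l) (by omega) x) = (seq k).1 x := by
    intro k l h
    induction l, h using Nat.le_induction with
    | base => intro x; rw [C.map_self]
    | succ l h ih =>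
      intro x
      rw [← ih x, ← hseq l, C.map_map]
  -- Pushing `G n` forward to level `n₀ + 1 + n` defines the character for all `n`, those up to `n₀`
  -- included, without a case distinction.
  obtain ⟨Θ, hΘ, hΘ'⟩ := C.exists_limit_hom
    (fun n => (seq n).1.comp (C.map n (n₀ + 1 + n) (by omega)))
    (fun n => (seq n).2.1.comp (hcont _ _ _)) (by
      intro m n h x
      change (seq n).1 (C.map n _ _ (C.map m n h x)) = (seq m).1 (C.map m _ _ x)
      rw [← hseq' m n h, C.map_map, C.map_map])
  refine hasEquicontinuousActionWithoutFixedPoint_of_hom Θ hΘ ⟨C.of _ x₀, ?_⟩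
  rw [hΘ']
  change (seq (n₀ + 1)).1 (C.map (n₀ + 1 + 0) _ _ x₀) ≠ 1
  rw [hseq' 0 (n₀ + 1) (by omega)]
  exact hx₀

/-! ### The centre of a compact simple group is finite -/

section LocalGroup

variable {E : Type*} [NormedAddCommGroup E] [NormedSpace ℝ E] {m : E × E → E} {e : E}

theorem fderiv_apply_inr_of_eventually_eq (hm : ContDiffAt ℝ 2 m (e, e))
    (h1 : ∀ᶠ ξ in 𝓝 e, m (e, ξ) = ξ) (u : E) : fderiv ℝ m (e, e) (0, u) = u := by
  have h : HasFDerivAt (fun ξ => m (e, ξ))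
      ((fderiv ℝ m (e, e)).comp (ContinuousLinearMap.inr ℝ E E)) e :=
    HasFDerivAt.comp (f := fun ξ => (e, ξ)) e (hm.differentiableAt two_ne_zero).hasFDerivAt
      (hasFDerivAt_prodMk_right e e)
  have h' : HasFDerivAt (fun ξ => m (e, ξ)) (ContinuousLinearMap.id ℝ E) e :=
    (hasFDerivAt_id e).congr_of_eventuallyEq h1
  simpa using congrArg (fun L : E →L[ℝ] E => L u) (h.unique h')

/-- Here `m` is a multiplication in coordinates. The derivative of the left-invariant field of `v`
along `u` is the mixed second derivative of `m`. By `hu` the left-invariant field of `u` is also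
right-invariant, so its derivative along `v` is the same mixed derivative with the arguments
exchanged, and the two cancel by symmetry. -/
theorem lieBracket_eq_zero_of_invariant (hm : ContDiffAt ℝ 2 m (e, e))
    (h2 : ∀ᶠ ξ in 𝓝 e, m (e, ξ) = ξ) {u : E}
    (hu : ∀ᶠ ξ in 𝓝 e, fderiv ℝ m (ξ, e) (0, u) = fderiv ℝ m (e, ξ) (u, 0)) (v : E) :
    VectorField.lieBracket ℝ (fun ξ => fderiv ℝ m (ξ, e) (0, u))
      (fun ξ => fderiv ℝ m (ξ, e) (0, v)) e = 0 := by
  have hF : HasFDerivAt (fderiv ℝ m) (fderiv ℝ (fderiv ℝ m) (e, e)) (e, e) :=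
    ((hm.fderiv_right (m := 1) (by norm_num)).differentiableAt one_ne_zero).hasFDerivAt
  have hV : HasFDerivAt (fun ξ => fderiv ℝ m (ξ, e) (0, v))
      (((fderiv ℝ (fderiv ℝ m) (e, e)).comp (ContinuousLinearMap.inl ℝ E E)).flip (0, v)) e := by
    have := (HasFDerivAt.comp (f := fun ξ => (ξ, e)) e hF (hasFDerivAt_prodMk_left e e)).clm_apply
      (hasFDerivAt_const ((0, v) : E × E) e)
    exact this.congr_fderiv (by ext w; simp)
  have hU : HasFDerivAt (fun ξ => fderiv ℝ m (e, ξ) (u, 0))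
      (((fderiv ℝ (fderiv ℝ m) (e, e)).comp (ContinuousLinearMap.inr ℝ E E)).flip (u, 0)) e := by
    have := (HasFDerivAt.comp (f := fun ξ => (e, ξ)) e hF (hasFDerivAt_prodMk_right e e)).clm_apply
      (hasFDerivAt_const ((u, 0) : E × E) e)
    exact this.congr_fderiv (by ext w; simp)
  have hsymm : IsSymmSndFDerivAt ℝ m (e, e) := hm.isSymmSndFDerivAt (by simp)
  have hU' := hU.congr_of_eventuallyEq hu
  rw [VectorField.lieBracket, hV.fderiv, hU'.fderiv, fderiv_apply_inr_of_eventually_eq hm h2,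
    fderiv_apply_inr_of_eventually_eq hm h2]
  simp [hsymm.eq (u, 0) (0, v)]

end LocalGroup

namespace CompactConnectedLieGroup

variable (G : CompactConnectedLieGroup)

/-- The multiplication in the chart at the identity. -/
noncomputable def chartMul (p : EuclideanSpace ℝ (Fin G.dim) × EuclideanSpace ℝ (Fin G.dim)) :
    EuclideanSpace ℝ (Fin G.dim) :=
  extChartAt (𝓡 G.dim) (1 : G)
    ((extChartAt (𝓡 G.dim) (1 : G)).symm p.1 * (extChartAt (𝓡 G.dim) (1 : G)).symm p.2)

/-- The coordinates of the identity. -/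
noncomputable def chartOne : EuclideanSpace ℝ (Fin G.dim) := extChartAt (𝓡 G.dim) (1 : G) 1

theorem chart_symm_one : (extChartAt (𝓡 G.dim) (1 : G)).symm G.chartOne = 1 :=
  (extChartAt (𝓡 G.dim) (1 : G)).left_inv (mem_extChartAt_source 1)

theorem contDiffAt_chartMul :
    ContDiffAt ℝ 2 G.chartMul (G.chartOne, G.chartOne) := by
  rw [← contMDiffAt_iff_contDiffAt]
  have hψ : ContMDiffAt (𝓡 G.dim) (𝓡 G.dim) ∞ (extChartAt (𝓡 G.dim) (1 : G)).symm G.chartOne :=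
    (contMDiffOn_extChartAt_symm (1 : G)).contMDiffAt (extChartAt_target_mem_nhds (1 : G))
  have hφ : ContMDiffAt (𝓡 G.dim) (𝓡 G.dim) ∞ (extChartAt (𝓡 G.dim) (1 : G)) 1 :=
    contMDiffAt_extChartAt
  have h1 := ContMDiffAt.comp
    (x := ((G.chartOne, G.chartOne) : EuclideanSpace ℝ (Fin G.dim) × EuclideanSpace ℝ (Fin G.dim)))
    (I := 𝓘(ℝ, EuclideanSpace ℝ (Fin G.dim) × EuclideanSpace ℝ (Fin G.dim))) (f := Prod.fst) hψ
    (contMDiffAt_iff_contDiffAt.2 contDiffAt_fst)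
  have h2 := ContMDiffAt.comp
    (x := ((G.chartOne, G.chartOne) : EuclideanSpace ℝ (Fin G.dim) × EuclideanSpace ℝ (Fin G.dim)))
    (I := 𝓘(ℝ, EuclideanSpace ℝ (Fin G.dim) × EuclideanSpace ℝ (Fin G.dim))) (f := Prod.snd) hψ
    (contMDiffAt_iff_contDiffAt.2 contDiffAt_snd)
  have h3 := h1.mul h2
  have h4 := ContMDiffAt.comp_of_eq hφ h3 (by
    simp only [Pi.mul_apply, Function.comp, chart_symm_one, mul_one])
  exact h4.of_le (by norm_cast)

theorem eventually_chart_symm_mem_source : ∀ᶠ ξ in 𝓝 G.chartOne,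
    ξ ∈ (extChartAt (𝓡 G.dim) (1 : G)).target :=
  extChartAt_target_mem_nhds (1 : G)

theorem eventually_one_chartMul : ∀ᶠ ξ in 𝓝 G.chartOne, G.chartMul (G.chartOne, ξ) = ξ := by
  filter_upwards [G.eventually_chart_symm_mem_source] with ξ hξ
  simp only [chartMul, chart_symm_one, one_mul]
  exact (extChartAt (𝓡 G.dim) (1 : G)).right_inv hξ

theorem eventually_contDiffAt_chartMul_left :
    ∀ᶠ ξ in 𝓝 G.chartOne, DifferentiableAt ℝ G.chartMul (ξ, G.chartOne) := by
  have h := (G.contDiffAt_chartMul.eventually (by simp))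
  have hc : ContinuousAt (fun ξ => (ξ, G.chartOne)) G.chartOne := by fun_prop
  filter_upwards [hc.eventually h] with ξ hξ using hξ.differentiableAt two_ne_zero

theorem eventually_contDiffAt_chartMul_right :
    ∀ᶠ ξ in 𝓝 G.chartOne, DifferentiableAt ℝ G.chartMul (G.chartOne, ξ) := by
  have h := (G.contDiffAt_chartMul.eventually (by simp))
  have hc : ContinuousAt (fun ξ => (G.chartOne, ξ)) G.chartOne := by fun_prop
  filter_upwards [hc.eventually h] with ξ hξ using hξ.differentiableAt two_ne_zero

/-- This puts left-invariant fields in the form required by `lieBracket_eq_zero_of_invariant`. Both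
sides are the derivative at 1, in the direction `v`, of `y ↦ φ (x * y)`, where `φ` is the chart and
`x` the point with coordinates `ξ`. -/
theorem mpullbackWithin_mulInvariantVectorField (v : GroupLieAlgebra (𝓡 G.dim) G) :
    VectorField.mpullbackWithin (𝓡 G.dim) (𝓡 G.dim) (extChartAt (𝓡 G.dim) (1 : G)).symm
      (mulInvariantVectorField v) (range (𝓡 G.dim)) =ᶠ[𝓝 G.chartOne]
    fun ξ => fderiv ℝ G.chartMul (ξ, G.chartOne) (0, v) := by
  filter_upwards [G.eventually_chart_symm_mem_source, G.eventually_contDiffAt_chartMul_left]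
    with ξ hξ hd
  rw [VectorField.mpullbackWithin_apply]
  set x := (extChartAt (𝓡 G.dim) (1 : G)).symm ξ with hx
  have hxs : x ∈ (extChartAt (𝓡 G.dim) (1 : G)).source :=
    (extChartAt (𝓡 G.dim) (1 : G)).map_target hξ
  have hinv := isInvertible_mfderivWithin_extChartAt_symm (I := 𝓡 G.dim) hξ
  have hcomp := mfderivWithin_extChartAt_symm_comp_mfderiv_extChartAt (I := 𝓡 G.dim) hξ
  -- derivative of `y ↦ φ (x * y)` in two ways
  have hφ1 : HasMFDerivAt (𝓡 G.dim) (𝓡 G.dim) (extChartAt (𝓡 G.dim) (1 : G)) (1 : G)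
      (ContinuousLinearMap.id ℝ (EuclideanSpace ℝ (Fin G.dim))) := by
    have := (mdifferentiableAt_extChartAt (I := 𝓡 G.dim)
      (mem_chart_source (EuclideanSpace ℝ (Fin G.dim)) (1 : G))).hasMFDerivAt
    rwa [mfderiv_extChartAt_self] at this
  have hA : HasMFDerivAt (𝓡 G.dim) (𝓡 G.dim)
      (fun y : G => G.chartMul (ξ, extChartAt (𝓡 G.dim) (1 : G) y)) 1
      (((fderiv ℝ G.chartMul (ξ, G.chartOne)).comp (ContinuousLinearMap.inr ℝ _ _)).comp
        (ContinuousLinearMap.id ℝ (EuclideanSpace ℝ (Fin G.dim)))) := by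
    refine HasMFDerivAt.comp (g := fun η => G.chartMul (ξ, η)) (1 : G) ?_ hφ1
    refine HasFDerivAt.hasMFDerivAt ?_
    exact HasFDerivAt.comp (f := fun η => (ξ, η)) G.chartOne hd.hasFDerivAt
      (hasFDerivAt_prodMk_right ξ G.chartOne)
  have hL : HasMFDerivAt (𝓡 G.dim) (𝓡 G.dim) (fun y : G => x * y) 1
      (mfderiv (𝓡 G.dim) (𝓡 G.dim) (fun y : G => x * y) 1) :=
    ((contMDiff_mul_left (I := 𝓡 G.dim) (n := ∞) (a := x)).mdifferentiable (by simp) 1).hasMFDerivAt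
  have hφx : HasMFDerivAt (𝓡 G.dim) (𝓡 G.dim) (extChartAt (𝓡 G.dim) (1 : G)) (x * 1)
      (mfderiv (𝓡 G.dim) (𝓡 G.dim) (extChartAt (𝓡 G.dim) (1 : G)) (x * 1)) := by
    refine (mdifferentiableAt_extChartAt (I := 𝓡 G.dim) ?_).hasMFDerivAt
    rw [mul_one]; simpa using hxs
  have hB := HasMFDerivAt.comp (1 : G) hφx hL
  have hAB : (fun y : G => G.chartMul (ξ, extChartAt (𝓡 G.dim) (1 : G) y)) =ᶠ[𝓝 1]
      (extChartAt (𝓡 G.dim) (1 : G)) ∘ fun y => x * y := by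
    filter_upwards [extChartAt_source_mem_nhds (I := 𝓡 G.dim) (1 : G)] with y hy
    simp only [chartMul, Function.comp]
    rw [(extChartAt (𝓡 G.dim) (1 : G)).left_inv hy]
  have hEq := hasMFDerivAt_unique hA (hB.congr_of_eventuallyEq hAB)
  have hmain : ∀ z : G, z = x → ∀ w : EuclideanSpace ℝ (Fin G.dim),
      (mfderivWithin (𝓡 G.dim) (𝓡 G.dim) (extChartAt (𝓡 G.dim) (1 : G)).symm
        (range (𝓡 G.dim)) ξ).inverse w =
      (mfderiv (𝓡 G.dim) (𝓡 G.dim) (extChartAt (𝓡 G.dim) (1 : G)) z :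
        EuclideanSpace ℝ (Fin G.dim) →L[ℝ] EuclideanSpace ℝ (Fin G.dim)) w := by
    rintro z rfl w
    have h1 : (mfderivWithin (𝓡 G.dim) (𝓡 G.dim) (extChartAt (𝓡 G.dim) (1 : G)).symm
        (range (𝓡 G.dim)) ξ)
        (mfderiv (𝓡 G.dim) (𝓡 G.dim) (extChartAt (𝓡 G.dim) (1 : G)) x w) = w :=
      congrArg (fun L : EuclideanSpace ℝ (Fin G.dim) →L[ℝ] EuclideanSpace ℝ (Fin G.dim) => L w) hcomp
    conv_lhs => rw [← h1]
    exact hinv.inverse_apply_self _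
  refine (hmain (x * 1) (mul_one x) _).trans ?_
  have := congrArg (fun L : EuclideanSpace ℝ (Fin G.dim) →L[ℝ] EuclideanSpace ℝ (Fin G.dim) => L v)
    hEq
  exact this.symm

theorem bracket_eq_lieBracket (u v : GroupLieAlgebra (𝓡 G.dim) G) :
    ⁅u, v⁆ = VectorField.lieBracket ℝ (fun ξ => fderiv ℝ G.chartMul (ξ, G.chartOne) (0, u))
      (fun ξ => fderiv ℝ G.chartMul (ξ, G.chartOne) (0, v)) G.chartOne := by
  have hu := G.mpullbackWithin_mulInvariantVectorField u
  have hv := G.mpullbackWithin_mulInvariantVectorField v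
  have hr : range (𝓡 G.dim) = univ := ModelWithCorners.range_eq_univ _
  rw [GroupLieAlgebra.bracket_def, VectorField.mlieBracket, VectorField.mlieBracketWithin_apply]
  have hb : VectorField.lieBracketWithin ℝ
      (VectorField.mpullbackWithin (𝓡 G.dim) (𝓡 G.dim) (extChartAt (𝓡 G.dim) (1 : G)).symm
        (mulInvariantVectorField u) (range (𝓡 G.dim)))
      (VectorField.mpullbackWithin (𝓡 G.dim) (𝓡 G.dim) (extChartAt (𝓡 G.dim) (1 : G)).symm
        (mulInvariantVectorField v) (range (𝓡 G.dim)))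
      ((extChartAt (𝓡 G.dim) (1 : G)).symm ⁻¹' univ ∩ range (𝓡 G.dim)) G.chartOne = 
      VectorField.lieBracket ℝ (fun ξ => fderiv ℝ G.chartMul (ξ, G.chartOne) (0, u))
      (fun ξ => fderiv ℝ G.chartMul (ξ, G.chartOne) (0, v)) G.chartOne := by
    rw [← hu.lieBracket_vectorField_eq hv, preimage_univ, univ_inter]
    simp only [hr]
    exact congrFun VectorField.lieBracketWithin_univ _
  have hid : mfderiv (𝓡 G.dim) (𝓡 G.dim) (extChartAt (𝓡 G.dim) (1 : G)) (1 : G) =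
      ContinuousLinearMap.id ℝ (EuclideanSpace ℝ (Fin G.dim)) := mfderiv_extChartAt_self
  have hinv : ∀ w : EuclideanSpace ℝ (Fin G.dim),
      (mfderiv (𝓡 G.dim) (𝓡 G.dim) (extChartAt (𝓡 G.dim) (1 : G)) (1 : G)).inverse w = w := by
    intro w
    have := congrArg (fun L : EuclideanSpace ℝ (Fin G.dim) →L[ℝ] EuclideanSpace ℝ (Fin G.dim) =>
      L.inverse w) hid
    simp only [ContinuousLinearMap.inverse_id] at this
    exact this
  exact (hinv _).trans hb

/-- A Lie group whose centre accumulates at the identity has a nonzero central element in its Lie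
algebra. -/
theorem exists_central_of_accPt (h : AccPt (1 : G) (𝓟 (Subgroup.center G : Set G))) :
    ∃ u : GroupLieAlgebra (𝓡 G.dim) G, u ≠ 0 ∧ ∀ v : GroupLieAlgebra (𝓡 G.dim) G, ⁅u, v⁆ = 0 := by
  set φ := extChartAt (𝓡 G.dim) (1 : G) with hφ
  let s : Set (EuclideanSpace ℝ (Fin G.dim)) := {ξ | φ.symm ξ ∈ Subgroup.center G}
  have hs : AccPt G.chartOne (𝓟 s) := by
    rw [accPt_iff_frequently] at h ⊢
    have hc : Tendsto φ (𝓝 1) (𝓝 G.chartOne) := continuousAt_extChartAt (I := 𝓡 G.dim) (1 : G)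
    refine hc.frequently ?_
    refine (h.and_eventually (extChartAt_source_mem_nhds (I := 𝓡 G.dim) (1 : G))).mono ?_
    rintro x ⟨⟨hx1, hx⟩, hxs⟩
    refine ⟨fun h0 => hx1 (φ.injOn hxs (mem_extChartAt_source 1) h0), ?_⟩
    change φ.symm (φ x) ∈ Subgroup.center G
    rwa [φ.left_inv hxs]
  -- No submanifold structure of the centre is needed: an accumulation point already has a nonzero
  -- vector in its tangent cone.
  obtain ⟨u, hu, hu0⟩ := tangentConeAt_nonempty_of_properSpace (𝕜 := ℝ) hs
  refine ⟨u, hu0, fun v => ?_⟩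
  refine (G.bracket_eq_lieBracket u v).trans ?_
  refine lieBracket_eq_zero_of_invariant G.contDiffAt_chartMul
    G.eventually_one_chartMul ?_ v
  filter_upwards [G.eventually_contDiffAt_chartMul_left, G.eventually_contDiffAt_chartMul_right]
    with ξ h1 h2
  have hA : HasFDerivAt (fun η => G.chartMul (ξ, η)) ((fderiv ℝ G.chartMul (ξ, G.chartOne)).comp
      (ContinuousLinearMap.inr ℝ _ _)) G.chartOne :=
    HasFDerivAt.comp (f := fun η => (ξ, η)) G.chartOne h1.hasFDerivAt
      (hasFDerivAt_prodMk_right ξ G.chartOne)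
  have hB : HasFDerivAt (fun η => G.chartMul (η, ξ)) ((fderiv ℝ G.chartMul (G.chartOne, ξ)).comp
      (ContinuousLinearMap.inl ℝ _ _)) G.chartOne :=
    HasFDerivAt.comp (f := fun η => (η, ξ)) G.chartOne h2.hasFDerivAt
      (hasFDerivAt_prodMk_left G.chartOne ξ)
  -- Left and right multiplication by `η` agree for central `η`. Two maps that agree on `s` have
  -- derivatives that agree on its tangent cone, in particular at `u`.
  have hcongr : ∀ η ∈ s, G.chartMul (η, ξ) = G.chartMul (ξ, η) := fun η hη => by
    simp only [chartMul]
    rw [(Subgroup.mem_center_iff.1 hη _)]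
  have h1s : φ.symm G.chartOne ∈ Subgroup.center G := by
    rw [hφ, chart_symm_one]; exact Subgroup.one_mem _
  have := HasFDerivWithinAt.unique_on (hB.hasFDerivWithinAt (s := s))
    (hA.hasFDerivWithinAt.congr hcongr (hcongr _ h1s)) hu
  simpa using this.symm

/-- The centre is compact, so if infinite it is not discrete and accumulates at 1. The resulting
central vector makes the centre of the Lie algebra nonzero, hence everything by simplicity,
contradicting non-commutativity. -/
theorem finite_center_of_isSimple (hG : G.IsSimple) : Finite (Subgroup.center G) := by
  by_contra hfin
  have hclosed : IsClosed (Subgroup.center G : Set G) := by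
    have : (Subgroup.center G : Set G) = ⋂ g : G, {z | g * z = z * g} := by
      ext z; simp [Subgroup.mem_center_iff]
    rw [this]
    exact isClosed_iInter fun g => isClosed_eq (by fun_prop) (by fun_prop)
  have : CompactSpace (Subgroup.center G) := isCompact_iff_compactSpace.1 hclosed.isCompact
  have hacc : AccPt (1 : G) (𝓟 (Subgroup.center G : Set G)) := by
    by_contra hacc
    refine hfin ?_
    have : DiscreteTopology (Subgroup.center G) := by
      refine discreteTopology_of_isOpen_singleton_one ?_
      rw [accPt_iff_frequently, not_frequently] at hacc
      refine isOpen_singleton_iff_nhds_eq_pure _ |>.2 (le_antisymm ?_ (pure_le_nhds _))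
      rw [nhds_subtype_eq_comap, le_pure_iff]
      refine ⟨_, hacc, ?_⟩
      rintro ⟨y, hy⟩ h
      by_contra hne
      exact h ⟨fun h0 => hne (Subtype.ext h0), hy⟩
    exact finite_of_compact_of_discrete
  obtain ⟨u, hu0, hu⟩ := G.exists_central_of_accPt hacc
  have hcen : u ∈ LieAlgebra.center ℝ (GroupLieAlgebra (𝓡 G.dim) G) := by
    rw [LieModule.mem_maxTrivSubmodule]
    intro v
    rw [← lie_skew, hu, neg_zero]
  rcases hG.eq_bot_or_eq_top (LieAlgebra.center ℝ (GroupLieAlgebra (𝓡 G.dim) G)) with h | h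
  · rw [h] at hcen
    exact hu0 ((LieSubmodule.mem_bot u).1 hcen)
  · exact hG.non_abelian (LieAlgebra.isLieAbelian_iff_center_eq_top ℝ _ |>.2 h)

end CompactConnectedLieGroup

/-! ### Quotients by finite normal subgroups -/

namespace CompactConnectedLieGroup

section Quotient

variable (G : CompactConnectedLieGroup) (Γ : Subgroup G) [Finite Γ]

theorem isLocalHomeomorph_quotientMk : IsLocalHomeomorph (QuotientGroup.mk : G → G ⧸ Γ) :=
  (Γ.isQuotientCoveringMap (Set.toFinite (Γ : Set G)).isDiscrete).isCoveringMap.isLocalHomeomorph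

noncomputable instance : ChartedSpace (EuclideanSpace ℝ (Fin G.dim)) (G ⧸ Γ) :=
  (G.isLocalHomeomorph_quotientMk Γ).chartedSpace QuotientGroup.mk_surjective

/-- A local section of the projection through `y`. -/
noncomputable def localSection (y : G) : OpenPartialHomeomorph (G ⧸ Γ) G :=
  (G.isLocalHomeomorph_quotientMk Γ).localInverseAt y

theorem localSection_symm (y : G) : ((G.localSection Γ y).symm : G → G ⧸ Γ) = QuotientGroup.mk :=
  (G.isLocalHomeomorph_quotientMk Γ).localInverseAt_symm y

theorem mk_mem_localSection_source (y : G) : (y : G ⧸ Γ) ∈ (G.localSection Γ y).source :=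
  (G.isLocalHomeomorph_quotientMk Γ).apply_self_mem_localInverseAt_source

theorem mk_localSection {y : G} {k : G ⧸ Γ} (hk : k ∈ (G.localSection Γ y).source) :
    (G.localSection Γ y k : G ⧸ Γ) = k :=
  (G.isLocalHomeomorph_quotientMk Γ).apply_localInverseAt_of_mem hk

theorem localSection_mk {x y : G} (hx : x ∈ (G.localSection Γ y).target) :
    G.localSection Γ y (x : G ⧸ Γ) = x := by
  conv_lhs => rw [← G.localSection_symm Γ y]
  exact (G.localSection Γ y).right_inv hx

theorem localSection_mk_self (y : G) : G.localSection Γ y (y : G ⧸ Γ) = y :=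
  (G.isLocalHomeomorph_quotientMk Γ).localInverseAt_apply_self

theorem exists_chart_eq {e : OpenPartialHomeomorph (G ⧸ Γ) (EuclideanSpace ℝ (Fin G.dim))}
    (he : e ∈ atlas (EuclideanSpace ℝ (Fin G.dim)) (G ⧸ Γ)) :
    ∃ y : G, e = (G.localSection Γ y).trans (chartAt (EuclideanSpace ℝ (Fin G.dim)) y) := by
  obtain ⟨k, rfl⟩ := he
  exact ⟨_, rfl⟩

theorem exists_chartAt_eq (k : G ⧸ Γ) : ∃ y : G, (y : G ⧸ Γ) = k ∧
    chartAt (EuclideanSpace ℝ (Fin G.dim)) k =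
      (G.localSection Γ y).trans (chartAt (EuclideanSpace ℝ (Fin G.dim)) y) :=
  ⟨_, (QuotientGroup.mk_surjective (s := Γ)).hasRightInverse.choose_spec k, rfl⟩

/-- Near `x`, going down to the quotient and back by a local section is right multiplication by the
fixed element `c` of `Γ`, hence smooth. The smooth structure of the quotient rests on this. -/
theorem contMDiffAt_localSection_comp_mk [Γ.Normal] {x y : G}
    (hx : (x : G ⧸ Γ) ∈ (G.localSection Γ y).source) :
    ContMDiffAt (𝓡 G.dim) (𝓡 G.dim) ∞ (fun z : G => G.localSection Γ y (z : G ⧸ Γ)) x := by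
  set c := x⁻¹ * G.localSection Γ y (x : G ⧸ Γ) with hc
  have hcΓ : (c : G ⧸ Γ) = 1 := by
    rw [hc, QuotientGroup.mk_mul, QuotientGroup.mk_inv, G.mk_localSection Γ hx, inv_mul_cancel]
  refine (contMDiff_mul_right (I := 𝓡 G.dim) (n := ∞) (a := c) x).congr_of_eventuallyEq ?_
  have hW : ∀ᶠ z in 𝓝 x, z * c ∈ (G.localSection Γ y).target := by
    refine (continuous_mul_const c).continuousAt.eventually
      ((G.localSection Γ y).open_target.mem_nhds ?_)
    change x * c ∈ _
    rw [hc, mul_inv_cancel_left]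
    exact (G.localSection Γ y).map_source hx
  filter_upwards [hW] with z hz
  have h := G.localSection_mk Γ hz
  rw [QuotientGroup.mk_mul, hcΓ, mul_one] at h
  exact h

instance [Γ.Normal] : IsManifold (𝓡 G.dim) ∞ (G ⧸ Γ) := by
  refine isManifold_of_contDiffOn _ _ _ fun e e' he he' => ?_
  obtain ⟨y, rfl⟩ := G.exists_chart_eq Γ he
  obtain ⟨y', rfl⟩ := G.exists_chart_eq Γ he'
  rw [← contMDiffOn_iff_contDiffOn]
  intro ξ hξ
  refine ContMDiffAt.contMDiffWithinAt ?_
  simp only [OpenPartialHomeomorph.trans_source, modelWithCornersSelf_coe_symm, preimage_id,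
    modelWithCornersSelf_coe, range_id, inter_univ, OpenPartialHomeomorph.symm_source,
    OpenPartialHomeomorph.trans_target, mem_inter_iff, mem_preimage] at hξ
  obtain ⟨⟨h1, h2⟩, h3, h4⟩ := hξ
  simp only [OpenPartialHomeomorph.coe_trans_symm,
    Function.comp_apply, G.localSection_symm] at h3 h4
  have ha : ContMDiffAt (𝓡 G.dim) (𝓡 G.dim) ∞
      (chartAt (EuclideanSpace ℝ (Fin G.dim)) y).symm ξ :=
    (contMDiffOn_chart_symm (x := y)).contMDiffAt
      ((chartAt (EuclideanSpace ℝ (Fin G.dim)) y).open_target.mem_nhds h1)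
  have hb := G.contMDiffAt_localSection_comp_mk Γ h3
  have hc : ContMDiffAt (𝓡 G.dim) (𝓡 G.dim) ∞ (chartAt (EuclideanSpace ℝ (Fin G.dim)) y')
      (G.localSection Γ y' (((chartAt (EuclideanSpace ℝ (Fin G.dim)) y).symm ξ : G) : G ⧸ Γ)) :=
    (contMDiffOn_chart (x := y')).contMDiffAt
      ((chartAt (EuclideanSpace ℝ (Fin G.dim)) y').open_source.mem_nhds h4)
  have := ContMDiffAt.comp ξ (ContMDiffAt.comp _ hc hb) ha
  refine this.congr_of_eventuallyEq (Eventually.of_forall fun z => ?_)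
  simp [G.localSection_symm, OpenPartialHomeomorph.coe_trans_symm]

theorem contMDiff_quotientMk [Γ.Normal] :
    ContMDiff (𝓡 G.dim) (𝓡 G.dim) ∞ (QuotientGroup.mk : G → G ⧸ Γ) := by
  intro x
  rw [contMDiffAt_iff_target]
  refine ⟨QuotientGroup.continuous_mk.continuousAt, ?_⟩
  obtain ⟨y, hy, hch⟩ := G.exists_chartAt_eq Γ (x : G ⧸ Γ)
  have hs : (x : G ⧸ Γ) ∈ (G.localSection Γ y).source := hy ▸ G.mk_mem_localSection_source Γ y
  have hc : ContMDiffAt (𝓡 G.dim) (𝓡 G.dim) ∞ (chartAt (EuclideanSpace ℝ (Fin G.dim)) y)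
      (G.localSection Γ y (x : G ⧸ Γ)) := by
    rw [← hy, G.localSection_mk_self]
    exact contMDiffOn_chart.contMDiffAt
      ((chartAt (EuclideanSpace ℝ (Fin G.dim)) y).open_source.mem_nhds (mem_chart_source _ y))
  refine (ContMDiffAt.comp x hc
    (G.contMDiffAt_localSection_comp_mk Γ hs)).congr_of_eventuallyEq
    (Eventually.of_forall fun z => ?_)
  simp [hch]

theorem contMDiffAt_localSection [Γ.Normal] {y : G} {k : G ⧸ Γ}
    (hk : k ∈ (G.localSection Γ y).source) :
    ContMDiffAt (𝓡 G.dim) (𝓡 G.dim) ∞ (G.localSection Γ y) k := by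
  rw [contMDiffAt_iff_source]
  refine ContMDiffAt.contMDiffWithinAt ?_
  obtain ⟨x, hx, hch⟩ := G.exists_chartAt_eq Γ k
  have hξ : extChartAt (𝓡 G.dim) k k = chartAt (EuclideanSpace ℝ (Fin G.dim)) x x := by
    simp only [extChartAt, hch, OpenPartialHomeomorph.extend, mfld_simps]
    rw [← hx, G.localSection_mk_self]
  rw [hξ]
  have hx' : (chartAt (EuclideanSpace ℝ (Fin G.dim)) x).symm
      (chartAt (EuclideanSpace ℝ (Fin G.dim)) x x) = x :=
    (chartAt (EuclideanSpace ℝ (Fin G.dim)) x).left_inv (mem_chart_source _ x)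
  have ha : ContMDiffAt (𝓡 G.dim) (𝓡 G.dim) ∞
      (chartAt (EuclideanSpace ℝ (Fin G.dim)) x).symm
      (chartAt (EuclideanSpace ℝ (Fin G.dim)) x x) :=
    (contMDiffOn_chart_symm (x := x)).contMDiffAt
      ((chartAt (EuclideanSpace ℝ (Fin G.dim)) x).open_target.mem_nhds (mem_chart_target _ x))
  have hb : ContMDiffAt (𝓡 G.dim) (𝓡 G.dim) ∞ (fun z : G => G.localSection Γ y (z : G ⧸ Γ))
      ((chartAt (EuclideanSpace ℝ (Fin G.dim)) x).symm
        (chartAt (EuclideanSpace ℝ (Fin G.dim)) x x)) := by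
    rw [hx']
    exact G.contMDiffAt_localSection_comp_mk Γ (hx ▸ hk)
  refine (ContMDiffAt.comp _ hb ha).congr_of_eventuallyEq (Eventually.of_forall fun z => ?_)
  simp [extChartAt, hch, G.localSection_symm]

theorem isLocalDiffeomorph_quotientMk [Γ.Normal] :
    IsLocalDiffeomorph (𝓡 G.dim) (𝓡 G.dim) ∞ (QuotientGroup.mk : G → G ⧸ Γ) := by
  intro y
  let Φ : PartialDiffeomorph (𝓡 G.dim) (𝓡 G.dim) G (G ⧸ Γ) ∞ :=
    { toPartialEquiv := (G.localSection Γ y).symm.toPartialEquiv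
      open_source := (G.localSection Γ y).open_target
      open_target := (G.localSection Γ y).open_source
      contMDiffOn_toFun := fun x _ => by
        have := (G.contMDiff_quotientMk Γ x).contMDiffWithinAt
          (s := (G.localSection Γ y).target)
        rw [← G.localSection_symm Γ y] at this
        exact this
      contMDiffOn_invFun := fun k hk => (G.contMDiffAt_localSection Γ hk).contMDiffWithinAt }
  refine ⟨Φ, ?_, fun x _ => ?_⟩
  · have := (G.localSection Γ y).map_source (G.mk_mem_localSection_source Γ y)
    rwa [G.localSection_mk_self] at this
  · exact (congrFun (G.localSection_symm Γ y) x).symm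

instance [Γ.Normal] : LieGroup (𝓡 G.dim) ∞ (G ⧸ Γ) where
  contMDiff_mul := by
    rintro ⟨k, l⟩
    obtain ⟨x, rfl⟩ := QuotientGroup.mk_surjective k
    obtain ⟨y, rfl⟩ := QuotientGroup.mk_surjective l
    have hx := G.contMDiffAt_localSection Γ (G.mk_mem_localSection_source Γ x)
    have hy := G.contMDiffAt_localSection Γ (G.mk_mem_localSection_source Γ y)
    have hm : ContMDiffAt ((𝓡 G.dim).prod (𝓡 G.dim)) (𝓡 G.dim) ∞
        (fun p : (G ⧸ Γ) × (G ⧸ Γ) => G.localSection Γ x p.1 * G.localSection Γ y p.2)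
        ((x : G ⧸ Γ), (y : G ⧸ Γ)) :=
      (ContMDiffAt.comp (f := Prod.fst) ((x : G ⧸ Γ), (y : G ⧸ Γ)) hx contMDiffAt_fst).mul
        (ContMDiffAt.comp (f := Prod.snd) ((x : G ⧸ Γ), (y : G ⧸ Γ)) hy contMDiffAt_snd)
    refine (ContMDiffAt.comp _ (G.contMDiff_quotientMk Γ _) hm).congr_of_eventuallyEq ?_
    have hs : ((G.localSection Γ x).source ×ˢ (G.localSection Γ y).source) ∈
        𝓝 ((x : G ⧸ Γ), (y : G ⧸ Γ)) :=
      prod_mem_nhds ((G.localSection Γ x).open_source.mem_nhds (G.mk_mem_localSection_source Γ x))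
        ((G.localSection Γ y).open_source.mem_nhds (G.mk_mem_localSection_source Γ y))
    filter_upwards [hs] with p hp
    rw [Function.comp_apply, QuotientGroup.mk_mul, G.mk_localSection Γ hp.1,
      G.mk_localSection Γ hp.2]
  contMDiff_inv := by
    intro k
    obtain ⟨x, rfl⟩ := QuotientGroup.mk_surjective k
    have hx := G.contMDiffAt_localSection Γ (G.mk_mem_localSection_source Γ x)
    refine (ContMDiffAt.comp _ (G.contMDiff_quotientMk Γ _) hx.inv).congr_of_eventuallyEq ?_
    filter_upwards [(G.localSection Γ x).open_source.mem_nhds (G.mk_mem_localSection_source Γ x)]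
      with p hp
    rw [Function.comp_apply, QuotientGroup.mk_inv, G.mk_localSection Γ hp]

/-- The quotient of a compact connected Lie group by a finite normal subgroup. -/
noncomputable def quotient [Γ.Normal] : CompactConnectedLieGroup :=
  have : IsClosed (Γ : Set G) := (Set.toFinite (Γ : Set G)).isClosed
  { carrier := G ⧸ Γ
    dim := G.dim
    t2 := inferInstance
    compact := inferInstance
    connected := (QuotientGroup.mk_surjective (s := Γ)).connectedSpace QuotientGroup.continuous_mk }

end Quotient

end CompactConnectedLieGroup

/-! ### Common simple factors -/

theorem eq_of_continuous_of_finite_range {X Y : Type*} [TopologicalSpace X] [PreconnectedSpace X]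
    [TopologicalSpace Y] [T1Space Y] {f : X → Y} (hf : Continuous f) (hfin : (range f).Finite)
    (x y : X) : f x = f y := by
  by_contra h
  exact (isPreconnected_range hf).infinite_of_nontrivial
    ⟨f x, mem_range_self x, f y, mem_range_self y, h⟩ hfin

namespace Presentation

variable {G : CompactConnectedLieGroup} (D : Presentation G)

theorem finite_ker_set : {z : D.Cover | D.proj z = 1}.Finite := D.finite_ker

/-- The conjugates of `z` form a connected subset of the finite kernel, so `z` is central. -/
theorem commute_of_proj_eq_one {z : D.Cover} (hz : D.proj z = 1) (y : D.Cover) : Commute y z := by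
  have h := eq_of_continuous_of_finite_range (f := fun y : D.Cover => y * z * y⁻¹)
    (by fun_prop) (D.finite_ker_set.subset (by
      rintro _ ⟨y, rfl⟩
      simp [hz])) y 1
  simp only [one_mul, inv_one, mul_one] at h
  exact mul_inv_eq_iff_eq_mul.1 h

/-- The inclusion of a factor into the cover. -/
noncomputable def single (i : Fin D.k) : D.factor i →* D.Cover :=
  (MonoidHom.inl _ _).comp (MonoidHom.mulSingle (fun i => (D.factor i : Type)) i)

theorem incl_apply (i : Fin D.k) (x : D.factor i) : D.incl i x = D.proj (D.single i x) := rfl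

theorem single_fst_self (i : Fin D.k) (x : D.factor i) : (D.single i x).1 i = x := by
  simp [single]

theorem single_fst_of_ne {i j : Fin D.k} (h : j ≠ i) (x : D.factor i) :
    (D.single i x).1 j = 1 := by
  simp [single, h]

theorem single_snd (i : Fin D.k) (x : D.factor i) : (D.single i x).2 = 1 := by
  simp [single]

theorem continuous_single (i : Fin D.k) : Continuous (D.single i) :=
  (continuous_mulSingle (A := fun i => (D.factor i : Type)) i).prodMk
    (continuous_const (y := (1 : Fin D.s → Circle)))

theorem fst_mem_center_of_proj_eq_one {z : D.Cover} (hz : D.proj z = 1) (i : Fin D.k) :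
    z.1 i ∈ Subgroup.center (D.factor i) := by
  refine Subgroup.mem_center_iff.2 fun g => ?_
  have := congrFun (congrArg Prod.fst (D.commute_of_proj_eq_one hz (D.single i g)).eq) i
  simpa [single_fst_self] using this

/-- Commutation holds only after projection to `G`, so the commutators of `w` with the factor lie in
the finite kernel. They depend continuously on a connected parameter and equal 1 at the identity, so
they are all trivial. -/
theorem fst_mem_center_of_commute {i : Fin D.k} {w : D.Cover}
    (hw : ∀ h, Commute (D.proj w) (D.incl i h)) : w.1 i ∈ Subgroup.center (D.factor i) := by
  refine Subgroup.mem_center_iff.2 fun g => ?_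
  have h := eq_of_continuous_of_finite_range
    (f := fun h : D.factor i => w * D.single i h * w⁻¹ * (D.single i h)⁻¹)
    (by have := D.continuous_single i; fun_prop) (D.finite_ker_set.subset (by
      rintro _ ⟨h, rfl⟩
      have := (hw h).eq
      rw [incl_apply] at this
      simp [this])) g 1
  simp only [map_one, mul_one, inv_one, mul_inv_cancel] at h
  have h := congrFun (congrArg Prod.fst h) i
  simp only [Prod.fst_mul, Prod.fst_inv, Pi.mul_apply, Pi.inv_apply, single_fst_self,
    Prod.fst_one, Pi.one_apply] at h
  rw [mul_inv_eq_one, mul_inv_eq_iff_eq_mul] at h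
  exact h.symm

/-- Replace the component `i` by the identity. -/
def erase (i : Fin D.k) (y : D.Cover) : D.Cover := (Function.update y.1 i 1, y.2)

theorem continuous_erase (i : Fin D.k) : Continuous (D.erase i) :=
  (continuous_fst.update i continuous_const).prodMk continuous_snd

theorem single_mul_erase (i : Fin D.k) (y : D.Cover) : D.single i (y.1 i) * D.erase i y = y := by
  refine Prod.ext (funext fun j => ?_) ?_
  · by_cases h : j = i
    · subst h; simp [erase, single_fst_self]
    · simp [erase, single_fst_of_ne, h]
  · simp [erase, single_snd]

theorem commute_single_erase (i : Fin D.k) (x : D.factor i) (y : D.Cover) :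
    Commute (D.single i x) (D.erase i y) := by
  refine Prod.ext (funext fun j => ?_) ?_
  · by_cases h : j = i
    · subst h; simp [erase, single_fst_self]
    · simp [erase, single_fst_of_ne, h]
  · simp [erase, single_snd]

theorem erase_one (i : Fin D.k) : D.erase i 1 = 1 := by
  refine Prod.ext (funext fun j => ?_) rfl
  by_cases h : j = i
  · subst h; simp [erase]
  · simp [erase]

end Presentation

/-- A finite Hausdorff group is discrete, and a chart would then isolate a point of a nonzero real
vector space; dimension zero is excluded because a simple Lie algebra is not abelian. This supplies
an element outside the finite subgroup, so that the action is nontrivial. -/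
theorem CompactConnectedLieGroup.IsSimple.infinite {F : CompactConnectedLieGroup}
    (hF : F.IsSimple) : Infinite F := by
  by_contra hfin
  rw [not_infinite_iff_finite] at hfin
  rcases subsingleton_or_nontrivial (GroupLieAlgebra (𝓡 F.dim) F) with h | h
  · exact hF.non_abelian ⟨fun x y => Subsingleton.elim _ _⟩
  · have : Nontrivial (EuclideanSpace ℝ (Fin F.dim)) := h
    have hmap := (chartAt (EuclideanSpace ℝ (Fin F.dim)) (1 : F)).map_nhds_eq
      (mem_chart_source _ (1 : F))
    rw [nhds_discrete, Filter.map_pure] at hmap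
    have hne : (𝓝[≠] (chartAt (EuclideanSpace ℝ (Fin F.dim)) (1 : F) 1)).NeBot :=
      Module.punctured_nhds_neBot ℝ _ _
    rw [nhdsWithin, ← hmap] at hne
    exact hne.ne (disjoint_iff.1 (disjoint_principal_right.2 (by simp)))

theorem exists_quotient_action_of_common_factor {G : ℕ → CompactConnectedLieGroup}
    (D : ∀ n, Presentation (G n)) (C : LieGroupChain G) (G₀ : CompactConnectedLieGroup)
    (i₀ : ∀ n, Fin (D n).k) (e : ∀ n, G₀ ≃* (D n).factor (i₀ n))
    (he' : ∀ n, Continuous (e n).symm)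
    (hC : ∀ m n (h : m ≤ n) (x : G₀),
        C.map m n h ((D m).incl (i₀ m) (e m x)) = (D n).incl (i₀ n) (e n x)) :
    ∃ (K : CompactConnectedLieGroup) (q : G₀ →* K), Function.Surjective q ∧
        IsLocalDiffeomorph (𝓡 G₀.dim) (𝓡 K.dim) ∞ q ∧ Finite q.ker ∧
        (∀ x, q x = 1 ↔ ∃ n, ∃ z ∈ (D n).proj.ker, z.1 (i₀ n) = e n x) ∧
        HasEquicontinuousActionWithoutFixedPoint C.Limit K := by
  have hcenter : ∀ n (x : (D n).factor (i₀ n)), x ∈ Subgroup.center ((D n).factor (i₀ n)) →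
      (e n).symm x ∈ Subgroup.center G₀ := by
    intro n x hx
    refine Subgroup.mem_center_iff.2 fun g => (e n).injective ?_
    simpa using Subgroup.mem_center_iff.1 hx (e n g)
  have hZ : Finite (Subgroup.center G₀) := by
    have := ((D 0).factor (i₀ 0)).finite_center_of_isSimple ((D 0).simple (i₀ 0))
    refine Finite.of_injective (fun z : Subgroup.center G₀ =>
      (⟨e 0 z, Subgroup.mem_center_iff.2 fun g => (e 0).symm.injective ?_⟩ :
        Subgroup.center ((D 0).factor (i₀ 0)))) fun z w h => ?_
    · simpa using Subgroup.mem_center_iff.1 z.2 ((e 0).symm g)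
    · exact Subtype.ext ((e 0).injective (congrArg Subtype.val h))
  let ρ : ∀ n, (D n).Cover →* G₀ := fun n => (e n).symm.toMonoidHom.comp
    ((Pi.evalMonoidHom (fun i => ((D n).factor i : Type)) (i₀ n)).comp (MonoidHom.fst _ _))
  have hρ : ∀ n y, ρ n y = (e n).symm (y.1 (i₀ n)) := fun n y => rfl
  have hρc : ∀ n, Continuous (ρ n) := fun n =>
    (he' n).comp ((continuous_apply _).comp continuous_fst)
  let Γ : ℕ → Subgroup G₀ := fun n => (D n).proj.ker.map (ρ n)
  have hΓ : ∀ n x, x ∈ Γ n ↔ ∃ z ∈ (D n).proj.ker, z.1 (i₀ n) = e n x := by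
    intro n x
    refine Subgroup.mem_map.trans (exists_congr fun z => and_congr_right fun _ => ?_)
    rw [hρ, MulEquiv.symm_apply_eq]
  have hΓcenter : ∀ n, Γ n ≤ Subgroup.center G₀ := by
    rintro n _ ⟨z, hz, rfl⟩
    exact hcenter n _ ((D n).fst_mem_center_of_proj_eq_one hz _)
  have hfinle : ∀ Δ : Subgroup G₀, Δ ≤ Subgroup.center G₀ → Finite Δ := fun Δ h =>
    Finite.of_injective _ (Subgroup.inclusion_injective h)
  have hnormal : ∀ Δ : Subgroup G₀, Δ ≤ Subgroup.center G₀ → Δ.Normal := fun Δ h =>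
    ⟨fun x hx g => by
      rw [Subgroup.mem_center_iff.1 (h hx) g, mul_inv_cancel_right]; exact hx⟩
  -- the projection of the factor modulo `Γ n` is compatible with the maps of the chain
  have key : ∀ m n (h : m ≤ n) (y : (D m).Cover) (w : (D n).Cover),
      (D n).proj w = C.map m n h ((D m).proj y) → (ρ m y)⁻¹ * ρ n w ∈ Γ n := by
    intro m n h
    have hn := hnormal _ (hΓcenter n)
    have hf := hfinle _ (hΓcenter n)
    have hcl : IsClosed (Γ n : Set G₀) := (Set.toFinite (Γ n : Set G₀)).isClosed
    obtain ⟨ϑ, hϑ, hϑ'⟩ := exists_hom_of_ker_le (D n).proj (D n).continuous_proj (D n).surjective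
      ((QuotientGroup.mk' (Γ n)).comp (ρ n)) (QuotientGroup.continuous_mk.comp (hρc n))
      (fun z hz => (QuotientGroup.eq_one_iff _).2 ⟨z, hz, rfl⟩)
    have hϑi : ∀ x, ϑ ((D n).incl (i₀ n) (e n x)) = (x : G₀ ⧸ Γ n) := by
      intro x
      rw [Presentation.incl_apply, hϑ']
      simp [hρ, Presentation.single_fst_self]
    have hmapc : Continuous (C.map m n h) := (C.contMDiff m n h).continuous
    -- The element with its common component erased commutes with the common factor of `G m`, hence
    -- its image commutes with that of `G n` and has a central component there. Modulo `Γ n` this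
    -- component ranges continuously over a finite set as `y` varies in the connected cover, so it
    -- keeps its value at `y = 1`.
    have herase : ∀ y, ϑ (C.map m n h ((D m).proj ((D m).erase (i₀ m) y))) = 1 := by
      intro y
      have hc : Continuous fun y => ϑ (C.map m n h ((D m).proj ((D m).erase (i₀ m) y))) :=
        hϑ.comp (hmapc.comp ((D m).continuous_proj.comp ((D m).continuous_erase _)))
      refine (eq_of_continuous_of_finite_range hc ?_ y 1).trans ?_
      · refine ((Set.toFinite (Subgroup.center G₀ : Set G₀)).image
          (QuotientGroup.mk : G₀ → G₀ ⧸ Γ n)).subset ?_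
        rintro _ ⟨y, rfl⟩
        obtain ⟨w, hw⟩ := (D n).surjective (C.map m n h ((D m).proj ((D m).erase (i₀ m) y)))
        refine ⟨ρ n w, hcenter n _ ((D n).fst_mem_center_of_commute fun g => ?_), ?_⟩
        · obtain ⟨x, rfl⟩ := (e n).surjective g
          rw [hw, ← hC m n h, Presentation.incl_apply]
          exact (((D m).commute_single_erase _ _ y).symm.map (D m).proj).map (C.map m n h)
        · simp only [← hw]
          rw [hϑ']; rfl
      · rw [(D m).erase_one, map_one, map_one, map_one]
    intro y w hw
    have h1 : ϑ ((D n).proj w) = (ρ n w : G₀ ⧸ Γ n) := hϑ' w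
    have h2 : ϑ ((D n).proj w) = (ρ m y : G₀ ⧸ Γ n) := by
      rw [hw]
      conv_lhs => rw [← (D m).single_mul_erase (i₀ m) y]
      rw [map_mul, map_mul, map_mul, herase, mul_one, ← Presentation.incl_apply, ← hϑi (ρ m y),
        ← hC m n h, hρ, MulEquiv.apply_symm_apply]
    exact QuotientGroup.eq.1 (h2.symm.trans h1)
  -- Apply `key` to an element of the kernel over `G m` and the lift `w = 1` of its trivial image.
  -- Monotonicity turns the supremum into the union that appears in the conclusion.
  have hmono : Monotone Γ := by
    rintro m n h _ ⟨z, hz, rfl⟩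
    have := key m n h z 1 (by rw [show (D m).proj z = 1 from hz, map_one, map_one])
    rw [map_one, mul_one] at this
    exact (Γ n).inv_mem_iff.1 this
  have hΓ' : ∀ x, x ∈ (⨆ n, Γ n) ↔ ∃ n, x ∈ Γ n := fun x =>
    Subgroup.mem_iSup_of_directed hmono.directed_le
  have hle : (⨆ n, Γ n) ≤ Subgroup.center G₀ := iSup_le hΓcenter
  have hn := hnormal _ hle
  have hf := hfinle _ hle
  have hθ : ∀ n, ∃ θ : G n →* G₀ ⧸ (⨆ n, Γ n), Continuous θ ∧ ∀ y, θ ((D n).proj y) = ρ n y :=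
    fun n => exists_hom_of_ker_le (D n).proj (D n).continuous_proj (D n).surjective
      ((QuotientGroup.mk' (⨆ n, Γ n)).comp (ρ n)) (QuotientGroup.continuous_mk.comp (hρc n))
      (fun z hz => (QuotientGroup.eq_one_iff _).2 ((hΓ' _).2 ⟨n, z, hz, rfl⟩))
  choose θ hθc hθ using hθ
  obtain ⟨Θ, hΘ, hΘ'⟩ := C.exists_limit_hom θ hθc (by
    intro m n h x
    obtain ⟨y, rfl⟩ := (D m).surjective x
    obtain ⟨w, hw⟩ := (D n).surjective (C.map m n h ((D m).proj y))
    rw [← hw, hθ, hθ]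
    exact (QuotientGroup.eq.2 ((hΓ' _).2 ⟨n, key m n h y w hw⟩)).symm)
  refine ⟨G₀.quotient (⨆ n, Γ n), QuotientGroup.mk' _, QuotientGroup.mk'_surjective _,
    G₀.isLocalDiffeomorph_quotientMk _, ?_, ?_, ?_⟩
  · have : Finite (QuotientGroup.mk' (⨆ n, Γ n)).ker := by
      rw [QuotientGroup.ker_mk']; exact hf
    exact this
  · intro x
    refine (QuotientGroup.eq_one_iff x).trans ((hΓ' x).trans (exists_congr fun n => hΓ n x))
  · refine hasEquicontinuousActionWithoutFixedPoint_of_hom (K := G₀.quotient (⨆ n, Γ n)) Θ hΘ ?_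
    have hinf := ((D 0).simple (i₀ 0)).infinite
    obtain ⟨x, hx⟩ : ∃ x, x ∉ ⨆ n, Γ n := by
      by_contra! h
      have : Finite G₀ := Finite.of_injective (fun x => (⟨x, h x⟩ : (⨆ n, Γ n : Subgroup G₀)))
        fun x y h => congrArg Subtype.val h
      exact not_finite_iff_infinite.2 hinf (Finite.of_equiv G₀ (e 0).toEquiv)
    refine ⟨C.of 0 ((D 0).incl (i₀ 0) (e 0 x)), fun h => hx ?_⟩
    have h := (hΘ' _ _).symm.trans h
    rw [Presentation.incl_apply, hθ, hρ, Presentation.single_fst_self,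
      MulEquiv.symm_apply_apply] at h
    exact (QuotientGroup.eq_one_iff _).1 h

/-! ### Smooth maps to and from finite products -/

section PiManifold

variable {ι : Type*} [Fintype ι] {E : ι → Type*} [∀ i, NormedAddCommGroup (E i)]
  [∀ i, NormedSpace ℝ (E i)] {H : ι → Type*} [∀ i, TopologicalSpace (H i)]
  (I : ∀ i, ModelWithCorners ℝ (E i) (H i)) {M : ι → Type*} [∀ i, TopologicalSpace (M i)]
  [∀ i, ChartedSpace (H i) (M i)]

theorem contMDiff_pi_apply {n : WithTop ℕ∞} (j : ι) :
    ContMDiff (ModelWithCorners.pi I) (I j) n (fun y : ∀ i, M i => y j) := by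
  intro y
  rw [contMDiffAt_iff]
  refine ⟨(continuous_apply j).continuousAt, ?_⟩
  have h : ContDiffWithinAt ℝ n (fun ξ : ∀ i, E i => ξ j) (range (ModelWithCorners.pi I))
      (extChartAt (ModelWithCorners.pi I) y y) :=
    (ContinuousLinearMap.proj (R := ℝ) (φ := E) j).contDiff.contDiffWithinAt
  refine h.congr_of_eventuallyEq ?_ ?_
  · filter_upwards [extChartAt_target_mem_nhdsWithin (I := ModelWithCorners.pi I) y] with ξ hξ
    have := congrFun ((extChartAt (ModelWithCorners.pi I) y).right_inv hξ) j
    exact this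
  · change extChartAt (I j) (y j) ((extChartAt (I j) (y j)).symm (extChartAt (I j) (y j) (y j))) = _
    rw [extChartAt_to_inv]
    rfl

theorem contMDiff_pi {n : WithTop ℕ∞} {F : Type*} [NormedAddCommGroup F] [NormedSpace ℝ F]
    {H' : Type*} [TopologicalSpace H'] {J : ModelWithCorners ℝ F H'} {N : Type*}
    [TopologicalSpace N] [ChartedSpace H' N] {f : N → ∀ i, M i} [∀ i, IsManifold (I i) n (M i)]
    (hf : ∀ i, ContMDiff J (I i) n fun x => f x i) : ContMDiff J (ModelWithCorners.pi I) n f := by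
  intro x
  rw [contMDiffAt_iff_target]
  refine ⟨continuousAt_pi.2 fun i => (hf i x).continuousAt, ?_⟩
  refine contMDiffAt_pi_space.2 fun i => ?_
  exact ContMDiffAt.comp (g := extChartAt (I i) (f x i)) (f := fun y => f y i) x
    (contMDiffAt_extChartAt (I := I i) (x := f x i)) (hf i x)

end PiManifold

namespace Presentation

variable {G : CompactConnectedLieGroup} (D : Presentation G)

/-- The model with corners of the cover. -/
noncomputable abbrev coverModel :=
  (ModelWithCorners.pi fun i => 𝓡 (D.factor i).dim).prod (ModelWithCorners.pi fun _ : Fin D.s => 𝓡 1)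

theorem contMDiff_component (i : Fin D.k) :
    ContMDiff D.coverModel (𝓡 (D.factor i).dim) ∞ (fun y : D.Cover => y.1 i) :=
  (contMDiff_pi_apply (fun i => 𝓡 (D.factor i).dim) i).comp contMDiff_fst

theorem contMDiff_single (i : Fin D.k) :
    ContMDiff (𝓡 (D.factor i).dim) D.coverModel ∞ (D.single i) := by
  have h1 : ContMDiff (𝓡 (D.factor i).dim) (ModelWithCorners.pi fun j => 𝓡 (D.factor j).dim) ∞
      (fun x : D.factor i => (Pi.mulSingle i x : ∀ j, D.factor j)) := by
    refine contMDiff_pi _ fun j => ?_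
    by_cases h : j = i
    · subst h
      simp only [Pi.mulSingle_eq_same]
      exact contMDiff_id
    · simp only [Pi.mulSingle_eq_of_ne h]
      exact contMDiff_const
  have h2 : ContMDiff (𝓡 (D.factor i).dim) (ModelWithCorners.pi fun _ : Fin D.s => 𝓡 1) ∞
      (fun _ : D.factor i => (1 : Fin D.s → Circle)) := contMDiff_const
  exact h1.prodMk h2

theorem contMDiff_incl (i : Fin D.k) :
    ContMDiff (𝓡 (D.factor i).dim) (𝓡 G.dim) ∞ (D.incl i) :=
  D.isLocalDiffeomorph.contMDiff.comp (D.contMDiff_single i)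

end Presentation

/-! ### One-parameter subgroups and the Riemannian distance -/

namespace CompactConnectedLieGroup

variable (F : CompactConnectedLieGroup)

instance : IsManifold (𝓡 F.dim) 1 F := IsManifold.of_le (n := ∞) (by norm_cast)

/-- Short times suffice, since longer rotations are powers of short ones. The curve must be shown to
be of class C¹ because path length is only defined through such curves; this holds because its
velocity is a continuous field evaluated along the curve. -/
theorem exists_integralCurve (v : GroupLieAlgebra (𝓡 F.dim) F) :
    ∃ γ : ℝ → F, γ 0 = 1 ∧ ∀ᶠ t in 𝓝 (0 : ℝ), ContMDiffAt 𝓘(ℝ, ℝ) (𝓡 F.dim) 1 γ t ∧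
      HasMFDerivAt 𝓘(ℝ, ℝ) (𝓡 F.dim) γ t
        ((1 : ℝ →L[ℝ] ℝ).smulRight (mulInvariantVectorField v (γ t))) := by
  have hsec (x : F) : ContMDiffAt (𝓡 F.dim) (𝓡 F.dim).tangent 1
      (fun g : F => (mulInvariantVectorField v g : TangentBundle (𝓡 F.dim) F)) x :=
    (contMDiffAt_mulInvariantVectorField v (g := x)).of_le (le_trans (by norm_num) le_minSmoothness)
  obtain ⟨γ, hγ0, hγ⟩ := exists_isMIntegralCurveAt_of_contMDiffAt_boundaryless 0 (hsec 1)
  refine ⟨γ, hγ0, ?_⟩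
  have hγc : ContinuousAt γ 0 := hγ.continuousAt
  set φ := extChartAt (𝓡 F.dim) (1 : F) with hφ
  have hd := hγ.eventually_hasDerivAt
  rw [hγ0] at hd
  -- the derivative is continuous
  have hcont : ∀ᶠ t in 𝓝 (0 : ℝ), ContinuousAt (fun t => tangentCoordChange (𝓡 F.dim) (γ t) 1 (γ t)
      (mulInvariantVectorField v (γ t))) t := by
    have hsrc : ∀ᶠ x in 𝓝 (1 : F), x ∈ φ.source := extChartAt_source_mem_nhds _
    rw [← hγ0] at hsrc
    filter_upwards [hγc.eventually hsrc, hγ] with t h2 h3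
    have h1 := hsec (γ t)
    have h4 : ContinuousAt (fun g : F => (trivializationAt (EuclideanSpace ℝ (Fin F.dim))
        (TangentSpace (𝓡 F.dim)) (1 : F)
        (mulInvariantVectorField v g : TangentBundle (𝓡 F.dim) F)).2) (γ t) := by
      refine ContinuousAt.snd (ContinuousAt.comp ?_ h1.continuousAt)
      refine (trivializationAt (EuclideanSpace ℝ (Fin F.dim))
        (TangentSpace (𝓡 F.dim)) (1 : F)).continuousOn.continuousAt
        ((trivializationAt (EuclideanSpace ℝ (Fin F.dim))
        (TangentSpace (𝓡 F.dim)) (1 : F)).open_source.mem_nhds ?_)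
      rw [Bundle.Trivialization.mem_source]
      simpa [hφ] using h2
    exact ContinuousAt.comp (g := fun g : F => (trivializationAt (EuclideanSpace ℝ (Fin F.dim))
        (TangentSpace (𝓡 F.dim)) (1 : F)
        (mulInvariantVectorField v g : TangentBundle (𝓡 F.dim) F)).2) h4 h3.continuousAt
  have hu : ContDiffAt ℝ 1 (φ ∘ γ) 0 := by
    rw [contDiffAt_one_iff]
    obtain ⟨u, hu, h⟩ := (hd.and hcont).exists_mem
    refine ⟨fun t => (1 : ℝ →L[ℝ] ℝ).smulRight (tangentCoordChange (𝓡 F.dim) (γ t) 1 (γ t)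
      (mulInvariantVectorField v (γ t))), u, hu, fun t ht => ?_, fun t ht => ?_⟩
    · refine ContinuousAt.continuousWithinAt ?_
      exact ContinuousAt.comp
        (g := fun w : EuclideanSpace ℝ (Fin F.dim) => (1 : ℝ →L[ℝ] ℝ).smulRight w)
        (ContinuousLinearMap.smulRightL ℝ ℝ _ 1).continuous.continuousAt (h t ht).2
    · exact (h t ht).1.hasFDerivAt
  have hγ1 : ContMDiffAt 𝓘(ℝ, ℝ) (𝓡 F.dim) 1 γ 0 := by
    rw [contMDiffAt_iff_target]
    refine ⟨hγc, ?_⟩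
    rw [hγ0]
    exact contMDiffAt_iff_contDiffAt.2 hu
  exact ((contMDiffAt_iff_contMDiffAt_nhds (by simp)).1 hγ1).and hγ

theorem mfderiv_mulInvariantVectorField_eq {E H : Type*} [NormedAddCommGroup E]
    [NormedSpace ℝ E] [TopologicalSpace H] {J : ModelWithCorners ℝ E H} {N : Type*}
    [TopologicalSpace N] [ChartedSpace H N] {f : F → N} {x : F}
    (hf : MDifferentiableAt (𝓡 F.dim) J f x) (v : GroupLieAlgebra (𝓡 F.dim) F) :
    (mfderiv (𝓡 F.dim) J f x (mulInvariantVectorField v x) : E) =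
      (mfderiv (𝓡 F.dim) J (fun y => f (x * y)) 1 v : E) := by
  have hL : HasMFDerivAt (𝓡 F.dim) (𝓡 F.dim) (fun y : F => x * y) 1
      (mfderiv (𝓡 F.dim) (𝓡 F.dim) (fun y : F => x * y) 1) :=
    ((contMDiff_mul_left (I := 𝓡 F.dim) (n := ∞) (a := x)).mdifferentiable (by simp) 1).hasMFDerivAt
  -- The points `x * 1` and `x` are only propositionally equal, so the derivatives at them are
  -- compared on the common model space.
  have key : ∀ z : F, z = x → ∀ w : EuclideanSpace ℝ (Fin F.dim),
      (mfderiv (𝓡 F.dim) J f x : EuclideanSpace ℝ (Fin F.dim) →L[ℝ] E) w =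
        (mfderiv (𝓡 F.dim) J f z : EuclideanSpace ℝ (Fin F.dim) →L[ℝ] E) w := by
    rintro z rfl w; rfl
  have hfx : HasMFDerivAt (𝓡 F.dim) J f (x * 1) (mfderiv (𝓡 F.dim) J f (x * 1)) :=
    MDifferentiableAt.hasMFDerivAt (by rwa [mul_one])
  have h := (HasMFDerivAt.comp (1 : F) hfx hL).mfderiv
  refine (key (x * 1) (mul_one x) _).trans ?_
  exact (congrArg (fun L : EuclideanSpace ℝ (Fin F.dim) →L[ℝ] E => L v) h).symm

end CompactConnectedLieGroup

namespace CompactConnectedLieGroup.Metric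

variable {G : CompactConnectedLieGroup} (g : G.Metric)

theorem edist_self (x : G) : g.edist x x = 0 := by
  let : Bundle.RiemannianBundle (fun x : G => TangentSpace (𝓡 G.dim) x) := ⟨g.toRiemannianMetric⟩
  exact Manifold.riemannianEDist_self

theorem edist_triangle (x y z : G) : g.edist x z ≤ g.edist x y + g.edist y z := by
  let : Bundle.RiemannianBundle (fun x : G => TangentSpace (𝓡 G.dim) x) := ⟨g.toRiemannianMetric⟩
  exact Manifold.riemannianEDist_triangle

theorem edist_le_of_norm_le {γ : ℝ → G} {T L : ℝ} (hT : 0 ≤ T)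
    (hγ : ∀ t ∈ Icc 0 T, ContMDiffAt 𝓘(ℝ, ℝ) (𝓡 G.dim) 1 γ t)
    (hL : ∀ t ∈ Icc 0 T, g.inner (γ t) (mfderiv 𝓘(ℝ, ℝ) (𝓡 G.dim) γ t (1 : ℝ))
      (mfderiv 𝓘(ℝ, ℝ) (𝓡 G.dim) γ t (1 : ℝ)) = L) :
    g.edist (γ 0) (γ T) ≤ ENNReal.ofReal (T * √L) := by
  let : Bundle.RiemannianBundle (fun x : G => TangentSpace (𝓡 G.dim) x) := ⟨g.toRiemannianMetric⟩
  refine (Manifold.riemannianEDist_le_pathELength (I := 𝓡 G.dim) (γ := γ) (a := 0) (b := T)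
    (fun t ht => (hγ t ht).contMDiffWithinAt) rfl rfl hT).trans ?_
  rw [Manifold.pathELength_eq_lintegral_mfderiv_Icc]
  have h : ∀ t ∈ Icc 0 T, ‖mfderiv 𝓘(ℝ, ℝ) (𝓡 G.dim) γ t (1 : ℝ)‖ₑ = ENNReal.ofReal √L := by
    intro t ht
    rw [← ofReal_norm, norm_eq_sqrt_real_inner, ← hL t ht]
    rfl
  refine (setLIntegral_congr_fun measurableSet_Icc h).trans_le ?_
  simp [ENNReal.ofReal_mul hT, mul_comm]

end CompactConnectedLieGroup.Metric

/-! ### Rotations generated by matrices with `Y³ = -Y` -/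

namespace Matrix

variable {n : Type*} [Fintype n] [DecidableEq n] {Y : Matrix n n ℂ}

/-- The exponential of `θ Y` for a matrix with `Y³ = -Y`. -/
noncomputable def rot (Y : Matrix n n ℂ) (θ : ℝ) : Matrix n n ℂ :=
  1 + Real.sin θ • Y + (1 - Real.cos θ) • (Y * Y)

theorem rot_zero : rot Y 0 = 1 := by simp [rot]

theorem rot_add (hY : Y * Y * Y = -Y) (a b : ℝ) : rot Y (a + b) = rot Y a * rot Y b := by
  have h3 : Y * (Y * Y) = -Y := by rw [← Matrix.mul_assoc, hY]
  simp only [rot, Matrix.add_mul, Matrix.mul_add, Matrix.smul_mul, Matrix.mul_smul, Matrix.one_mul,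
    Matrix.mul_one, Matrix.mul_assoc, h3, Matrix.mul_neg, Real.sin_add, Real.cos_add]
  module

theorem rot_nsmul (hY : Y * Y * Y = -Y) (a : ℝ) (N : ℕ) : rot Y (N * a) = rot Y a ^ N := by
  induction N with
  | zero => simp [rot_zero]
  | succ N ih =>
    rw [pow_succ, ← ih, ← rot_add hY]
    congr 1; push_cast; ring

theorem hasDerivAt_rot_neg (hY : Y * Y * Y = -Y) (t : ℝ) (i j : n) :
    HasDerivAt (fun t => rot Y (-t) i j) (-(Y * rot Y (-t)) i j) t := by
  have h3 : Y * (Y * Y) = -Y := by rw [← Matrix.mul_assoc, hY]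
  have h1 : HasDerivAt (fun t => rot Y (-t) i j)
      (-(Real.cos t • Y i j) + Real.sin t • (Y * Y) i j) t := by
    have hs := ((Real.hasDerivAt_sin t).smul_const (Y i j)).neg
    have hc := ((Real.hasDerivAt_cos t).const_sub 1).smul_const ((Y * Y) i j)
    have := (hs.add hc).const_add ((1 : Matrix n n ℂ) i j)
    refine (this.congr_deriv (by simp)).congr_of_eventuallyEq (Eventually.of_forall fun t => ?_)
    simp [rot, add_assoc]
  refine h1.congr_deriv ?_
  simp only [rot, Matrix.mul_add, Matrix.mul_smul, h3, Real.sin_neg, Real.cos_neg, Matrix.mul_one,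
    Matrix.add_apply, Matrix.smul_apply, Matrix.neg_apply]
  module

end Matrix

/-! ### The defining representation along one-parameter subgroups -/

namespace ClassicalStructure

variable {F : CompactConnectedLieGroup} {t : ClassicalSeries} {r : ℕ} (σ : ClassicalStructure F t r)

theorem hasMFDerivAt_sum_mul {κ : Type*} [Fintype κ] (c : κ → ℂ) (f : κ → F → ℂ) (x : F)
    (f' : κ → EuclideanSpace ℝ (Fin F.dim) →L[ℝ] ℂ)
    (h : ∀ k, HasMFDerivAt (𝓡 F.dim) 𝓘(ℝ, ℂ) (f k) x (f' k)) :
    HasMFDerivAt (𝓡 F.dim) 𝓘(ℝ, ℂ) (fun y => ∑ k, c k * f k y) x (∑ k, c k • f' k) := by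
  refine ⟨tendsto_finsetSum _ fun k _ => (h k).1.const_mul (c k), ?_⟩
  have h2 (k) : HasFDerivWithinAt (𝕜 := ℝ) (f k ∘ (extChartAt (𝓡 F.dim) x).symm) (f' k)
      (range (𝓡 F.dim)) (extChartAt (𝓡 F.dim) x x) := (h k).2
  exact HasFDerivWithinAt.fun_sum (u := Finset.univ) fun k _ => (h2 k).const_mul (c k)

theorem mfderiv_sum_rep {κ : Type*} [Fintype κ] (c : κ → ℂ) (p q : κ → Fin (t.size r))
    (v : GroupLieAlgebra (𝓡 F.dim) F) :
    (mfderiv (𝓡 F.dim) 𝓘(ℝ, ℂ) (fun y => ∑ k, c k * σ.rep y (p k) (q k)) 1 v : ℂ) =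
      ∑ k, c k * σ.deriv v (p k) (q k) := by
  have h1 (k) := ((σ.contMDiff (p k) (q k)).mdifferentiable (by simp) (1 : F)).hasMFDerivAt
  have h2 := hasMFDerivAt_sum_mul c (fun k y => σ.rep y (p k) (q k)) (1 : F)
    (fun k => mfderiv (𝓡 F.dim) 𝓘(ℝ, ℂ) (fun x => σ.rep x (p k) (q k)) 1) h1
  refine (congrArg (fun L : EuclideanSpace ℝ (Fin F.dim) →L[ℝ] ℂ => L v) h2.mfderiv).trans ?_
  exact sum_apply (F := EuclideanSpace ℝ (Fin F.dim) →L[ℝ] ℂ) _ _ v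

theorem mfderiv_rep_mul_left (v : GroupLieAlgebra (𝓡 F.dim) F) (x : F) (i j) :
    (mfderiv (𝓡 F.dim) 𝓘(ℝ, ℂ) (fun y => σ.rep (x * y) i j) 1 v : ℂ) =
      (σ.rep x * σ.deriv v) i j := by
  have h : (fun y => σ.rep (x * y) i j) = fun y => ∑ k, σ.rep x i k * σ.rep y k j := by
    ext y; rw [map_mul, Matrix.mul_apply]
  refine (congrArg (fun f : F → ℂ =>
    (mfderiv (𝓡 F.dim) 𝓘(ℝ, ℂ) f 1 : EuclideanSpace ℝ (Fin F.dim) →L[ℝ] ℂ) v) h).trans ?_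
  exact σ.mfderiv_sum_rep (σ.rep x i) (fun k => k) (fun _ => j) v

theorem mfderiv_rep_mul_right (v : GroupLieAlgebra (𝓡 F.dim) F) (x : F) (i j) :
    (mfderiv (𝓡 F.dim) 𝓘(ℝ, ℂ) (fun y => σ.rep (y * x) i j) 1 v : ℂ) =
      (σ.deriv v * σ.rep x) i j := by
  have h : (fun y => σ.rep (y * x) i j) = fun y => ∑ k, σ.rep x k j * σ.rep y i k := by
    ext y; rw [map_mul, Matrix.mul_apply]; simp only [mul_comm]
  refine (congrArg (fun f : F → ℂ =>
    (mfderiv (𝓡 F.dim) 𝓘(ℝ, ℂ) f 1 : EuclideanSpace ℝ (Fin F.dim) →L[ℝ] ℂ) v) h).trans ?_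
  rw [Matrix.mul_apply]
  simp only [mul_comm (σ.deriv v _ _)]
  exact σ.mfderiv_sum_rep (fun k => σ.rep x k j) (fun _ => i) (fun k => k) v

theorem mfderiv_rep_mulInvariantVectorField (v : GroupLieAlgebra (𝓡 F.dim) F) (x : F) (i j) :
    (mfderiv (𝓡 F.dim) 𝓘(ℝ, ℂ) (fun x => σ.rep x i j) x (mulInvariantVectorField v x) : ℂ) =
      (σ.rep x * σ.deriv v) i j :=
  (F.mfderiv_mulInvariantVectorField_eq
    ((σ.contMDiff i j).mdifferentiable (by simp) x) v).trans (σ.mfderiv_rep_mul_left v x i j)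

/-- The product of `σ.rep (γ s)` and `rot (-s)` has zero derivative, since the two factors solve
opposite linear equations; its value at 0 is 1. -/
theorem rep_eq_rot {v : GroupLieAlgebra (𝓡 F.dim) F}
    (hY : σ.deriv v * σ.deriv v * σ.deriv v = -σ.deriv v) {γ : ℝ → F} (h0 : γ 0 = 1) {T : ℝ}
    (hγ : ∀ s ∈ Icc 0 T, HasMFDerivAt 𝓘(ℝ, ℝ) (𝓡 F.dim) γ s
        ((1 : ℝ →L[ℝ] ℝ).smulRight (mulInvariantVectorField v (γ s)))) {s : ℝ} (hs : s ∈ Icc 0 T) :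
    σ.rep (γ s) = (σ.deriv v).rot s := by
  set Y := σ.deriv v with hYd
  have hA (s) (hs : s ∈ Icc 0 T) (i j) :
      HasDerivAt (fun s => σ.rep (γ s) i j) ((σ.rep (γ s) * Y) i j) s := by
    have h1 := ((σ.contMDiff i j).mdifferentiable (by simp) (γ s)).hasMFDerivAt
    have h2 : HasFDerivAt (𝕜 := ℝ) (E := ℝ) (F := ℂ) (fun s => σ.rep (γ s) i j) _ s :=
      (HasMFDerivAt.comp s h1 (hγ s hs)).hasFDerivAt
    refine (h2.hasDerivAt).congr_deriv ?_
    rw [← σ.mfderiv_rep_mulInvariantVectorField]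
    exact congrArg (mfderiv (𝓡 F.dim) 𝓘(ℝ, ℂ) (fun x => σ.rep x i j) (γ s)) (one_smul ℝ _)
  have hB (s) (hs : s ∈ Icc 0 T) (i j) :
      HasDerivAt (fun s => (σ.rep (γ s) * Y.rot (-s)) i j) 0 s := by
    simp only [Matrix.mul_apply]
    have := HasDerivAt.fun_sum (u := Finset.univ) fun k _ =>
      (hA s hs i k).mul (Matrix.hasDerivAt_rot_neg hY s k j)
    refine this.congr_deriv ?_
    rw [Finset.sum_add_distrib, ← Matrix.mul_apply]
    simp only [mul_neg, Finset.sum_neg_distrib]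
    rw [← Matrix.mul_apply, Matrix.mul_assoc, add_neg_cancel]
  have hC : σ.rep (γ s) * Y.rot (-s) = 1 := by
    ext i j
    have := constant_of_has_deriv_right_zero (f := fun s => (σ.rep (γ s) * Y.rot (-s)) i j)
      (a := 0) (b := T) (fun s hs => (hB s hs i j).continuousAt.continuousWithinAt)
      (fun s hs => (hB s (Ico_subset_Icc_self hs) i j).hasDerivWithinAt) s hs
    simpa [h0, Matrix.rot_zero] using this
  have hD : Y.rot (-s) * Y.rot s = 1 := by
    rw [← Matrix.rot_add hY, neg_add_cancel, Matrix.rot_zero]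
  calc σ.rep (γ s) = σ.rep (γ s) * (Y.rot (-s) * Y.rot s) := by rw [hD, mul_one]
    _ = Y.rot s := by rw [← mul_assoc, hC, one_mul]

end ClassicalStructure

/-! ### Displacement in `G` caused by rotations of a factor -/

namespace Presentation

variable {G : CompactConnectedLieGroup} (D : Presentation G) {g : G.Metric}

/-- Left invariance moves the computation to the identity, where the normalization of the metric
applies. Translates of a one-parameter subgroup therefore have constant, explicitly known speed. -/
theorem inner_mfderiv_mul_incl (hg : g.IsBiInvariant) {i : Fin D.k} {t : ClassicalSeries} {r : ℕ}
    {σ : ClassicalStructure (D.factor i) t r} (hσ : D.IsStandardOn g i σ)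
    (v : GroupLieAlgebra (𝓡 (D.factor i).dim) (D.factor i)) (x : G) (y : D.factor i) :
    g.inner (x * D.incl i y)
      (mfderiv (𝓡 (D.factor i).dim) (𝓡 G.dim) (fun y => x * D.incl i y) y
        (mulInvariantVectorField v y))
      (mfderiv (𝓡 (D.factor i).dim) (𝓡 G.dim) (fun y => x * D.incl i y) y
        (mulInvariantVectorField v y)) =
    -(1 / 2) * (Matrix.trace (σ.deriv v * σ.deriv v)).re := by
  have hf : ContMDiff (𝓡 (D.factor i).dim) (𝓡 G.dim) ∞ (fun y => x * D.incl i y) :=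
    contMDiff_const.mul (D.contMDiff_incl i)
  have h := (D.factor i).mfderiv_mulInvariantVectorField_eq
    (hf.mdifferentiable (by simp) y) v
  have h1 : HasMFDerivAt (𝓡 (D.factor i).dim) (𝓡 G.dim) (D.incl i) 1 _ :=
    ((D.contMDiff_incl i).mdifferentiable (by simp) 1).hasMFDerivAt
  have h2 : HasMFDerivAt (𝓡 G.dim) (𝓡 G.dim) (fun z : G => x * D.incl i y * z) (D.incl i 1) _ :=
    ((contMDiff_mul_left (I := 𝓡 G.dim) (n := ∞) (a := x * D.incl i y)).mdifferentiable
      (by simp) _).hasMFDerivAt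
  have h3 : (fun z => x * D.incl i (y * z)) =
      (fun z : G => x * D.incl i y * z) ∘ D.incl i := by
    ext z; simp [mul_assoc]
  have h4 := (HasMFDerivAt.comp 1 h2 h1).mfderiv
  have key : ∀ z : G, z = x * D.incl i y → ∀ w : EuclideanSpace ℝ (Fin G.dim),
      g.inner (x * D.incl i y) w w = g.inner z w w := by
    rintro z rfl w; rfl
  refine (key (x * D.incl i y * D.incl i 1) (by simp) _).trans ?_
  refine Eq.trans ?_ (((hg (x * D.incl i y) (D.incl i 1)
    (mfderiv (𝓡 (D.factor i).dim) (𝓡 G.dim) (D.incl i) 1 v)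
    (mfderiv (𝓡 (D.factor i).dim) (𝓡 G.dim) (D.incl i) 1 v)).1).trans (hσ v))
  have h5 := h.trans ((congrArg (fun f : D.factor i → G => (mfderiv (𝓡 (D.factor i).dim) (𝓡 G.dim) f 1
    : EuclideanSpace ℝ (Fin (D.factor i).dim) →L[ℝ] EuclideanSpace ℝ (Fin G.dim)) v) h3).trans
    (congrArg (fun L : EuclideanSpace ℝ (Fin (D.factor i).dim) →L[ℝ] EuclideanSpace ℝ (Fin G.dim) =>
      L v) h4))
  exact congrArg (fun w : EuclideanSpace ℝ (Fin G.dim) =>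
    g.inner (x * D.incl i y * D.incl i 1) w w) h5

theorem exists_rep_eq_rot_of_deriv (hg : g.IsBiInvariant) {i : Fin D.k} {t : ClassicalSeries}
    {r : ℕ} {σ : ClassicalStructure (D.factor i) t r} (hσ : D.IsStandardOn g i σ)
    {v : GroupLieAlgebra (𝓡 (D.factor i).dim) (D.factor i)}
    (hY : σ.deriv v * σ.deriv v * σ.deriv v = -σ.deriv v) :
    ∃ T > 0, ∀ s ∈ Icc (0 : ℝ) T, ∃ h : D.factor i, σ.rep h = (σ.deriv v).rot s ∧
      ∀ x : G, g.edist x (x * D.incl i h) ≤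
        ENNReal.ofReal (s * √(-(1 / 2) * (Matrix.trace (σ.deriv v * σ.deriv v)).re)) := by
  obtain ⟨γ, h0, hγ⟩ := (D.factor i).exists_integralCurve v
  obtain ⟨T, hT, h⟩ := Metric.eventually_nhds_iff.1 hγ
  refine ⟨T / 2, by positivity, fun s hs => ⟨γ s, ?_, fun x => ?_⟩⟩
  · refine σ.rep_eq_rot hY h0 (T := T / 2) (fun u hu => (h ?_).2) hs
    rw [Real.dist_0_eq_abs, abs_of_nonneg hu.1]; linarith [hu.2]
  · have h' : ∀ u ∈ Icc 0 s, dist u 0 < T := fun u hu => by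
      rw [Real.dist_0_eq_abs, abs_of_nonneg hu.1]; linarith [hu.2, hs.2]
    have hf : ContMDiff (𝓡 (D.factor i).dim) (𝓡 G.dim) ∞ (fun y => x * D.incl i y) :=
      contMDiff_const.mul (D.contMDiff_incl i)
    have := g.edist_le_of_norm_le (γ := fun u => x * D.incl i (γ u)) (T := s)
      (L := -(1 / 2) * (Matrix.trace (σ.deriv v * σ.deriv v)).re) hs.1 (fun u hu => ?_)
      (fun u hu => ?_)
    · simpa [h0] using this
    · exact ContMDiffAt.comp (g := fun y => x * D.incl i y) u ((hf.of_le (by norm_cast)) (γ u))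
        (h (h' u hu)).1
    · rw [← D.inner_mfderiv_mul_incl hg hσ v x (γ u)]
      have h1 := (HasMFDerivAt.comp u (hf.mdifferentiable (by simp) (γ u)).hasMFDerivAt
        (h (h' u hu)).2).mfderiv
      have h2 := congrArg (fun L : ℝ →L[ℝ] EuclideanSpace ℝ (Fin G.dim) => L 1) h1
      have h3 : (mfderiv 𝓘(ℝ, ℝ) (𝓡 G.dim) (fun u => x * D.incl i (γ u)) u (1 : ℝ) :
          EuclideanSpace ℝ (Fin G.dim)) = mfderiv (𝓡 (D.factor i).dim) (𝓡 G.dim)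
            (fun y => x * D.incl i y) (γ u) (mulInvariantVectorField v (γ u)) := by
        refine h2.trans ?_
        exact congrArg (mfderiv (𝓡 (D.factor i).dim) (𝓡 G.dim) (fun y => x * D.incl i y) (γ u))
          (one_smul ℝ _)
      exact congrArg (fun w : EuclideanSpace ℝ (Fin G.dim) => g.inner (x * D.incl i (γ u)) w w) h3

/-- A rotation of a classical factor moves the points of `G` by at most its angle. -/
theorem exists_rep_eq_rot (hg : g.IsBiInvariant) {i : Fin D.k} {t : ClassicalSeries}
    {r : ℕ} {σ : ClassicalStructure (D.factor i) t r} (hσ : D.IsStandardOn g i σ)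
    {Y : Matrix (Fin (t.size r)) (Fin (t.size r)) ℂ} (hYm : Y ∈ t.matrixLieAlgebra r)
    (hY : Y * Y * Y = -Y) {θ : ℝ} (hθ : 0 ≤ θ) :
    ∃ h : D.factor i, σ.rep h = Y.rot θ ∧ ∀ x : G, g.edist x (x * D.incl i h) ≤
        ENNReal.ofReal (θ * √(-(1 / 2) * (Matrix.trace (Y * Y)).re)) := by
  obtain ⟨v, -, rfl⟩ := σ.bijOn_deriv.surjOn hYm
  change σ.deriv v * σ.deriv v * σ.deriv v = -σ.deriv v at hY
  change ∃ h : D.factor i, σ.rep h = (σ.deriv v).rot θ ∧ ∀ x : G, g.edist x (x * D.incl i h) ≤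
        ENNReal.ofReal (θ * √(-(1 / 2) * (Matrix.trace (σ.deriv v * σ.deriv v)).re))
  obtain ⟨T, hT, H⟩ := D.exists_rep_eq_rot_of_deriv hg hσ hY
  -- Divide the angle into `N` parts short enough for the local curve. The `N`-th power of the short
  -- rotation has the full angle, and by the triangle inequality the displacements add.
  obtain ⟨N, hN⟩ := exists_nat_gt (θ / T)
  have hN0 : (0 : ℝ) < N := lt_of_le_of_lt (by positivity) hN
  obtain ⟨h, h1, h2⟩ := H (θ / N) ⟨by positivity, by
    rw [div_le_iff₀ hN0]; rw [div_lt_iff₀ hT] at hN; linarith⟩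
  refine ⟨h ^ N, ?_, fun x => ?_⟩
  · rw [map_pow, h1, ← Matrix.rot_nsmul hY]
    congr 1; field_simp
  · set c := √(-(1 / 2) * (Matrix.trace (σ.deriv v * σ.deriv v)).re)
    have : ∀ M : ℕ, g.edist x (x * D.incl i (h ^ M)) ≤ M * ENNReal.ofReal (θ / N * c) := by
      intro M
      induction M with
      | zero => simp [g.edist_self]
      | succ M ih =>
        refine (g.edist_triangle _ (x * D.incl i (h ^ M)) _).trans ?_
        rw [pow_succ, map_mul, ← mul_assoc]
        push_cast
        rw [add_mul, one_mul]
        exact add_le_add ih (h2 _)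
    refine (this N).trans (le_of_eq ?_)
    rw [← ENNReal.ofReal_natCast, ← ENNReal.ofReal_mul hN0.le]
    congr 1; field_simp

end Presentation

/-! ### Infinitesimal rotations of a plane -/

namespace Matrix

variable {m : Type*} [Fintype m]

theorem vecMulVec_mul_vecMulVec_eq_smul (a b c d : m → ℂ) :
    vecMulVec a b * vecMulVec c d = (b ⬝ᵥ c) • vecMulVec a d := by
  rw [vecMulVec_mul_vecMulVec]
  ext i j
  simp [vecMulVec_apply, mul_comm, mul_left_comm]

/-- The infinitesimal rotation of the plane spanned by the row vectors `n` and `s`. -/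
def planeRot (n s : m → ℂ) : Matrix m m ℂ := vecMulVec (star n) s - vecMulVec (star s) n

variable {n s : m → ℂ}

theorem planeRot_conjTranspose {m : Type*} (n s : m → ℂ) : (planeRot n s)ᴴ = -planeRot n s := by
  ext i j
  simp [planeRot, vecMulVec_apply]
  ring

theorem vecMul_planeRot (u n s : m → ℂ) :
    u ᵥ* planeRot n s = (u ⬝ᵥ star n) • s - (u ⬝ᵥ star s) • n := by
  simp [planeRot, vecMul_sub, vecMul_vecMulVec]

theorem trace_planeRot (n s : m → ℂ) :
    (planeRot n s).trace = s ⬝ᵥ star n - n ⬝ᵥ star s := by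
  simp [planeRot, trace_sub, trace_vecMulVec, dotProduct_comm]

theorem planeRot_mul_planeRot (n s n' s' : m → ℂ) : planeRot n s * planeRot n' s' =
    (s ⬝ᵥ star n') • vecMulVec (star n) s' - (s ⬝ᵥ star s') • vecMulVec (star n) n'
      - ((n ⬝ᵥ star n') • vecMulVec (star s) s' - (n ⬝ᵥ star s') • vecMulVec (star s) n') := by
  simp only [planeRot, Matrix.sub_mul, Matrix.mul_sub, vecMulVec_mul_vecMulVec_eq_smul]
  abel

/-- A pair of orthonormal vectors. -/
structure Orthonormal₂ (n s : m → ℂ) : Prop where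
  left : n ⬝ᵥ star n = 1
  right : s ⬝ᵥ star s = 1
  ortho : n ⬝ᵥ star s = 0

theorem Orthonormal₂.ortho' (h : Orthonormal₂ n s) : s ⬝ᵥ star n = 0 := by
  rw [← star_star s, star_dotProduct_star, h.ortho, star_zero]

theorem Orthonormal₂.vecMul_left (h : Orthonormal₂ n s) : n ᵥ* planeRot n s = s := by
  rw [vecMul_planeRot, h.left, h.ortho, one_smul, zero_smul, sub_zero]

theorem Orthonormal₂.vecMul_right (h : Orthonormal₂ n s) : s ᵥ* planeRot n s = -n := by
  rw [vecMul_planeRot, h.right, h.ortho', one_smul, zero_smul, zero_sub]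

theorem Orthonormal₂.planeRot_sq (h : Orthonormal₂ n s) : planeRot n s * planeRot n s =
    -(vecMulVec (star n) n + vecMulVec (star s) s) := by
  rw [planeRot_mul_planeRot, h.left, h.right, h.ortho, h.ortho']
  module

theorem Orthonormal₂.planeRot_cube (h : Orthonormal₂ n s) :
    planeRot n s * planeRot n s * planeRot n s = -planeRot n s := by
  rw [h.planeRot_sq]
  simp only [planeRot, Matrix.neg_mul, Matrix.add_mul, Matrix.mul_sub,
    vecMulVec_mul_vecMulVec_eq_smul, h.left, h.right, h.ortho, h.ortho']
  module

theorem Orthonormal₂.trace_planeRot_sq (h : Orthonormal₂ n s) :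
    (planeRot n s * planeRot n s).trace = -2 := by
  rw [h.planeRot_sq]
  simp only [trace_neg, trace_add, trace_vecMulVec, dotProduct_comm (star n),
    dotProduct_comm (star s), h.left, h.right]
  norm_num

end Matrix

namespace ClassicalSeries

open Matrix

/-! ### The quaternionic structure and rotations in the symplectic group -/

section symplectic

variable (r : ℕ)

/-- The index paired with `i` by the symplectic form. -/
def partner (i : Fin (2 * r)) : Fin (2 * r) :=
  if h : (i : ℕ) < r then ⟨i + r, by omega⟩ else ⟨i - r, by omega⟩

theorem symplecticForm_apply (i j : Fin (2 * r)) : symplecticForm r (2 * r) i j =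
    if j = partner r i then (if (i : ℕ) < r then -1 else 1) else 0 := by
  have := i.2
  have := j.2
  by_cases h : (i : ℕ) < r
  · simp only [symplecticForm, of_apply, partner, h, dif_pos, if_pos, Fin.ext_iff]
    rw [if_neg (by omega)]
  · simp only [symplecticForm, of_apply, partner, h, dif_neg, not_false_eq_true, if_false,
      Fin.ext_iff]
    rw [if_neg (show ¬ (j : ℕ) = i + r by omega)]
    refine if_congr (by omega) rfl rfl

theorem partner_partner (i : Fin (2 * r)) : partner r (partner r i) = i := by
  have := i.2
  ext
  by_cases h : (i : ℕ) < r
  · simp [partner, h]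
  · simp only [partner, h, dif_neg, not_false_eq_true]
    rw [dif_pos (by omega)]
    simp; omega

theorem partner_lt_iff (i : Fin (2 * r)) : (partner r i : ℕ) < r ↔ ¬ (i : ℕ) < r := by
  have := i.2
  by_cases h : (i : ℕ) < r
  · simp [partner, h]
  · simp only [partner, h, dif_neg, not_false_eq_true, iff_true]
    omega

theorem symplecticForm_sq : symplecticForm r (2 * r) * symplecticForm r (2 * r) = -1 := by
  ext i j
  have := i.2
  rw [mul_apply, Finset.sum_eq_single (partner r i)]
  · rw [symplecticForm_apply, symplecticForm_apply, partner_partner]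
    by_cases h : j = i
    · subst h
      simp only [partner_lt_iff]
      split_ifs <;> simp
    · simp [h, Matrix.one_apply_ne (Ne.symm h)]
  · intro k _ hk
    rw [symplecticForm_apply, if_neg hk, zero_mul]
  · simp

theorem symplecticForm_transpose :
    (symplecticForm r (2 * r))ᵀ = -symplecticForm r (2 * r) := by
  ext i j
  have := i.2
  simp only [symplecticForm, transpose_apply, of_apply, Matrix.neg_apply]
  split_ifs <;> first | omega | simp

theorem symplecticForm_conjTranspose :
    (symplecticForm r (2 * r))ᴴ = -symplecticForm r (2 * r) := by
  rw [← symplecticForm_transpose]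
  ext i j
  simp only [symplecticForm, transpose_apply, of_apply, conjTranspose_apply]
  split_ifs <;> simp

/-- The part of an anti-Hermitian matrix in the symplectic Lie algebra (twice the projection). -/
noncomputable def symplecticPart (P : Matrix (Fin (2 * r)) (Fin (2 * r)) ℂ) :
    Matrix (Fin (2 * r)) (Fin (2 * r)) ℂ :=
  P + symplecticForm r (2 * r) * Pᵀ * symplecticForm r (2 * r)

variable {r}

theorem symplecticPart_mem {P : Matrix (Fin (2 * r)) (Fin (2 * r)) ℂ} (hP : Pᴴ = -P) :
    symplecticPart r P ∈ matrixLieAlgebra C r := by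
  have hJ := symplecticForm_sq r
  have hJt := symplecticForm_transpose r
  have hJc := symplecticForm_conjTranspose r
  refine ⟨?_, ?_, ?_⟩
  · change (symplecticPart r P)ᴴ = -symplecticPart r P
    have h : Pᵀᴴ = -Pᵀ := by rw [← transpose_neg, ← hP]; rfl
    rw [symplecticPart, conjTranspose_add, conjTranspose_mul, conjTranspose_mul, hP, h, hJc]
    noncomm_ring
  · change (symplecticPart r P).trace = 0
    rw [symplecticPart, trace_add, trace_mul_comm, ← Matrix.mul_assoc, hJ, Matrix.neg_mul,
      Matrix.one_mul, trace_neg, trace_transpose, add_neg_cancel]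
  · change symplecticPart r P * symplecticForm r (2 * r) +
      symplecticForm r (2 * r) * (symplecticPart r P)ᵀ = 0
    rw [symplecticPart, transpose_add, transpose_mul, transpose_mul, transpose_transpose, hJt]
    generalize symplecticForm r (2 * r) = J at *
    have h1 : J * Pᵀ * J * J = -(J * Pᵀ) := by
      rw [Matrix.mul_assoc _ J J, hJ, Matrix.mul_neg, Matrix.mul_one]
    have h2 : J * (-J * (P * -J)) = -(P * J) := by
      simp only [Matrix.neg_mul, Matrix.mul_neg, neg_neg]
      rw [← Matrix.mul_assoc, hJ, Matrix.neg_mul, Matrix.one_mul]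
    rw [Matrix.add_mul, Matrix.mul_add, h1, h2]
    abel

/-- The map `v ↦ star v ᵥ* J` is the quaternionic structure; the symplectic correction of a plane
rotation is the same rotation in the conjugate plane. -/
theorem symplecticPart_planeRot (n s : Fin (2 * r) → ℂ) : symplecticPart r (planeRot n s) =
    planeRot n s + planeRot (star n ᵥ* symplecticForm r (2 * r))
      (star s ᵥ* symplecticForm r (2 * r)) := by
  have hJt := symplecticForm_transpose r
  have hJc := symplecticForm_conjTranspose r
  have h (v : Fin (2 * r) → ℂ) : star (star v ᵥ* symplecticForm r (2 * r)) =
      -(symplecticForm r (2 * r) *ᵥ v) := by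
    rw [star_vecMul, star_star, hJc, neg_mulVec]
  rw [symplecticPart, planeRot, planeRot, h, h, transpose_sub, transpose_vecMulVec,
    transpose_vecMulVec, Matrix.mul_sub, Matrix.sub_mul, mul_vecMulVec, mul_vecMulVec,
    vecMulVec_mul, vecMulVec_mul]
  simp only [neg_vecMulVec]
  abel

/-- Under `hC` the plane of `n`, `s` is orthogonal to its quaternionic conjugate: the remaining
products vanish by antisymmetry of the form. The two rotations annihilate each other, so the cubic
identity survives, the traces of squares add up to `-4`, and the action on `n`, `s` is unchanged. -/
theorem symplecticPart_planeRot_of_orthonormal {n s : Fin (2 * r) → ℂ} (h : Orthonormal₂ n s)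
    (hC : n ⬝ᵥ (symplecticForm r (2 * r) *ᵥ s) = 0) :
    symplecticPart r (planeRot n s) * symplecticPart r (planeRot n s) *
        symplecticPart r (planeRot n s) = -symplecticPart r (planeRot n s) ∧
      -(1 / 2) * (symplecticPart r (planeRot n s) * symplecticPart r (planeRot n s)).trace.re ≤ 2 ∧
      n ᵥ* symplecticPart r (planeRot n s) = s ∧ s ᵥ* symplecticPart r (planeRot n s) = -n := by
  rw [symplecticPart_planeRot]
  have hJ := symplecticForm_sq r
  have hJt := symplecticForm_transpose r
  have hJc := symplecticForm_conjTranspose r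
  set J := symplecticForm r (2 * r)
  -- the two planes are orthogonal
  have e1 (v w : Fin (2 * r) → ℂ) : v ⬝ᵥ star (star w ᵥ* J) = -(v ⬝ᵥ (J *ᵥ w)) := by
    rw [star_vecMul, star_star, hJc, neg_mulVec, dotProduct_neg]
  have e2 (v w : Fin (2 * r) → ℂ) : v ⬝ᵥ (J *ᵥ w) = -(w ⬝ᵥ (J *ᵥ v)) := by
    rw [dotProduct_mulVec, dotProduct_comm, ← mulVec_transpose, hJt, neg_mulVec, dotProduct_neg]
  have e3 (v : Fin (2 * r) → ℂ) : v ⬝ᵥ (J *ᵥ v) = 0 := self_eq_neg.1 (e2 v v)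
  have e4 (v w : Fin (2 * r) → ℂ) : (star v ᵥ* J) ⬝ᵥ star w = star (w ⬝ᵥ star (star v ᵥ* J)) := by
    rw [← star_dotProduct_star, star_star, dotProduct_comm]
  have e5 (v w : Fin (2 * r) → ℂ) : (star v ᵥ* J) ⬝ᵥ star (star w ᵥ* J) = star (v ⬝ᵥ star w) := by
    rw [e1, ← dotProduct_mulVec, mulVec_mulVec, hJ, neg_mulVec, one_mulVec, dotProduct_neg, neg_neg,
      ← star_dotProduct_star, star_star, dotProduct_comm]
  have h' : Orthonormal₂ (star n ᵥ* J) (star s ᵥ* J) :=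
    ⟨by rw [e5, h.left, star_one], by rw [e5, h.right, star_one], by rw [e5, h.ortho, star_zero]⟩
  have hz : ∀ v w : Fin (2 * r) → ℂ, (v = n ∨ v = s) → (w = n ∨ w = s) →
      v ⬝ᵥ star (star w ᵥ* J) = 0 := by
    rintro v w (rfl | rfl) (rfl | rfl)
    · rw [e1, e3, neg_zero]
    · rw [e1, hC, neg_zero]
    · rw [e1, e2, hC, neg_zero, neg_zero]
    · rw [e1, e3, neg_zero]
  have hz' : ∀ v w : Fin (2 * r) → ℂ, (v = n ∨ v = s) → (w = n ∨ w = s) →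
      (star v ᵥ* J) ⬝ᵥ star w = 0 := fun v w hv hw => by rw [e4, hz w v hw hv, star_zero]
  have hPQ : planeRot n s * planeRot (star n ᵥ* J) (star s ᵥ* J) = 0 := by
    rw [planeRot_mul_planeRot, hz, hz, hz, hz] <;> simp
  have hQP : planeRot (star n ᵥ* J) (star s ᵥ* J) * planeRot n s = 0 := by
    rw [planeRot_mul_planeRot, hz', hz', hz', hz'] <;> simp
  have hsq : (planeRot n s + planeRot (star n ᵥ* J) (star s ᵥ* J)) *
      (planeRot n s + planeRot (star n ᵥ* J) (star s ᵥ* J)) = planeRot n s * planeRot n s +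
      planeRot (star n ᵥ* J) (star s ᵥ* J) * planeRot (star n ᵥ* J) (star s ᵥ* J) := by
    rw [Matrix.add_mul, Matrix.mul_add, Matrix.mul_add, hPQ, hQP]; abel
  refine ⟨?_, ?_, ?_, ?_⟩
  · rw [hsq, Matrix.add_mul, Matrix.mul_add, Matrix.mul_add, h.planeRot_cube, h'.planeRot_cube,
      Matrix.mul_assoc, hPQ, Matrix.mul_assoc _ _ (planeRot n s), hQP]
    simp only [Matrix.mul_zero]
    abel
  · rw [hsq, trace_add, h.trace_planeRot_sq, h'.trace_planeRot_sq]
    norm_num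
  · rw [vecMul_add, h.vecMul_left, vecMul_planeRot, hz, hz] <;> simp
  · rw [vecMul_add, h.vecMul_right, vecMul_planeRot, hz, hz] <;> simp

end symplectic

/-- The rotations of the plane of two orthonormal row vectors that extend to the classical group. -/
theorem exists_generator {t : ClassicalSeries} {r : ℕ} {n s : Fin (t.size r) → ℂ}
    (h : Orthonormal₂ n s) (hreal : t = B ∨ t = D → ∀ i, (n i).im = 0 ∧ (s i).im = 0)
    (hC : t = C → n ⬝ᵥ (symplecticForm r _ *ᵥ s) = 0) :
    ∃ Y ∈ t.matrixLieAlgebra r, Y * Y * Y = -Y ∧ -(1 / 2) * (Y * Y).trace.re ≤ 2 ∧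
      n ᵥ* Y = s ∧ s ᵥ* Y = -n := by
  have h1 := h.vecMul_left
  have h2 := h.vecMul_right
  have ht : (planeRot n s).trace = 0 := by rw [trace_planeRot, h.ortho, h.ortho', sub_zero]
  -- The squared norm is 1 here; the common bound 2 is the value in the symplectic case, where two
  -- planes rotate.
  have h3 : -(1 / 2) * (planeRot n s * planeRot n s).trace.re ≤ 2 := by
    rw [h.trace_planeRot_sq]; norm_num
  have hBD (ht : t = B ∨ t = D) (i j) : (planeRot n s i j).im = 0 := by
    simp [planeRot, vecMulVec_apply, hreal ht i, hreal ht j]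
  cases t with
  | A => exact ⟨_, ⟨planeRot_conjTranspose n s, ht, trivial⟩, h.planeRot_cube, h3, h1, h2⟩
  | B => exact ⟨_, ⟨planeRot_conjTranspose n s, ht, hBD (.inl rfl)⟩, h.planeRot_cube, h3, h1, h2⟩
  | D => exact ⟨_, ⟨planeRot_conjTranspose n s, ht, hBD (.inr rfl)⟩, h.planeRot_cube, h3, h1, h2⟩
  | C =>
    exact ⟨_, symplecticPart_mem (planeRot_conjTranspose n s),
      symplecticPart_planeRot_of_orthonormal h (hC rfl)⟩

end ClassicalSeries

namespace ClassicalSeries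

open Matrix

/-! ### Rotating a matrix into the concentration locus -/

/-- The entries of the first row that are rotated to zero. -/
def poles : ∀ (t : ClassicalSeries) (r : ℕ), Finset (Fin (t.size r))
  | A, _ => {i | (i : ℕ) = 0}
  | B, _ => {i | (i : ℕ) ≤ 1}
  | C, r => {i | (i : ℕ) = 0 ∨ (i : ℕ) = r}
  | D, _ => {i | (i : ℕ) ≤ 1}

variable {t : ClassicalSeries} {r : ℕ} {M : Matrix (Fin (t.size r)) (Fin (t.size r)) ℂ}

theorem row_dotProduct_star (hM : M ∈ t.matrixGroup r) (z) : M z ⬝ᵥ star (M z) = 1 := by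
  have h : M * Mᴴ = 1 :=
    (Matrix.mem_unitaryGroup_iff).1 (Matrix.mem_specialUnitaryGroup_iff.1 hM.1).1
  have := congrFun (congrFun h z) z
  simpa [Matrix.mul_apply, dotProduct] using this

theorem sum_norm_sq_row (hM : M ∈ t.matrixGroup r) (z) : ∑ i, ‖M z i‖ ^ 2 = 1 := by
  have := row_dotProduct_star hM z
  simp only [dotProduct, Pi.star_apply, RCLike.star_def, Complex.mul_conj'] at this
  exact_mod_cast this

theorem partner_mem_poles {i : Fin (2 * r)} (hi : i ∈ poles C r) : partner r i ∈ poles C r := by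
  have h2 := i.2
  have h : (i : ℕ) = 0 ∨ (i : ℕ) = r := (Finset.mem_filter.1 hi).2
  refine Finset.mem_filter.2 ⟨Finset.mem_univ _, ?_⟩
  change ((partner r i : Fin (2 * r)) : ℕ) = 0 ∨ ((partner r i : Fin (2 * r)) : ℕ) = r
  simp only [partner]
  split_ifs <;> simp <;> omega

theorem im_eq_zero_of_mem (ht : t = B ∨ t = D) (hM : M ∈ t.matrixGroup r) (i j) :
    (M i j).im = 0 := by
  rcases ht with rfl | rfl
  · exact hM.2 i j
  · exact hM.2 i j

theorem exists_rot_poles_eq_zero (hM : M ∈ t.matrixGroup r) (z)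
    (hβ : ∑ i ∈ t.poles r, ‖M z i‖ ^ 2 < 1) :
    ∃ Y ∈ t.matrixLieAlgebra r, Y * Y * Y = -Y ∧ -(1 / 2) * (Y * Y).trace.re ≤ 2 ∧
      ∃ θ, 0 ≤ θ ∧ θ ≤ Real.pi / 2 * √(∑ i ∈ t.poles r, ‖M z i‖ ^ 2) ∧
        ∀ i ∈ t.poles r, (M * Y.rot θ) z i = 0 := by
  set b := √(∑ i ∈ t.poles r, ‖M z i‖ ^ 2) with hb
  have hs0 : 0 ≤ ∑ i ∈ t.poles r, ‖M z i‖ ^ 2 := Finset.sum_nonneg fun _ _ => by positivity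
  have hb2 : b ^ 2 = ∑ i ∈ t.poles r, ‖M z i‖ ^ 2 := Real.sq_sqrt hs0
  have hb0 : 0 ≤ b := Real.sqrt_nonneg _
  clear_value b
  rcases hb0.eq_or_lt with h0 | h0
  -- If the polar part vanishes there is no plane to rotate and nothing to do.
  · refine ⟨0, ?_, by simp, by simp, 0, le_rfl, by positivity, fun i hi => ?_⟩
    · cases t <;> simp [matrixLieAlgebra]
    · rw [rot_zero, Matrix.mul_one]
      have h1 : ∑ i ∈ t.poles r, ‖M z i‖ ^ 2 = 0 := by rw [← hb2, ← h0, zero_pow two_ne_zero]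
      rw [Finset.sum_eq_zero_iff_of_nonneg fun _ _ => by positivity] at h1
      simpa using h1 i hi
  set c := √(1 - b ^ 2) with hc
  have hc0 : 0 < c := Real.sqrt_pos.2 (by linarith)
  have hc2 : c ^ 2 = 1 - b ^ 2 := Real.sq_sqrt (by linarith)
  -- The row is `b n + c s`, with `n` the normalized polar part and `s` the normalized rest; `c > 0`
  -- by `hβ`.
  set n : Fin (t.size r) → ℂ := fun i => if i ∈ t.poles r then M z i / b else 0 with hn
  set s : Fin (t.size r) → ℂ := fun i => if i ∈ t.poles r then 0 else M z i / c with hs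
  have hbC : (b : ℂ) ≠ 0 := by exact_mod_cast h0.ne'
  have hcC : (c : ℂ) ≠ 0 := by exact_mod_cast hc0.ne'
  have hrow : M z = (b : ℂ) • n + (c : ℂ) • s := by
    ext i
    by_cases h : i ∈ t.poles r
    · simp [hn, hs, h]; field_simp
    · simp [hn, hs, h]; field_simp
  have hsum : ∑ i ∈ t.poles r, ‖M z i‖ ^ 2 + ∑ i ∈ (t.poles r)ᶜ, ‖M z i‖ ^ 2 = 1 := by
    rw [Finset.sum_add_sum_compl, sum_norm_sq_row hM]
  have hon : Orthonormal₂ n s := by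
    refine ⟨?_, ?_, ?_⟩
    · have : n ⬝ᵥ star n = ((∑ i ∈ t.poles r, ‖M z i‖ ^ 2 : ℝ) : ℂ) / b ^ 2 := by
        rw [dotProduct, ← Finset.sum_filter_add_sum_filter_not _ (· ∈ t.poles r)]
        rw [Finset.sum_eq_zero (s := Finset.filter (¬ · ∈ t.poles r) _)]
        · push_cast
          rw [Finset.sum_div, add_zero]
          refine Finset.sum_congr (by simp) fun i hi => ?_
          have hi : i ∈ t.poles r := by simpa using hi
          simp [hn, hi, div_mul_div_comm, Complex.mul_conj', sq]
        · intro i hi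
          have hi : i ∉ t.poles r := by simpa using hi
          simp [hn, hi]
      rw [this, ← hb2]; push_cast; field_simp
    · have : s ⬝ᵥ star s = ((∑ i ∈ (t.poles r)ᶜ, ‖M z i‖ ^ 2 : ℝ) : ℂ) / c ^ 2 := by
        rw [dotProduct, ← Finset.sum_filter_add_sum_filter_not _ (· ∈ t.poles r)]
        rw [Finset.sum_eq_zero (s := Finset.filter (· ∈ t.poles r) _)]
        · push_cast
          rw [Finset.sum_div, zero_add]
          refine Finset.sum_congr (by ext; simp) fun i hi => ?_
          have hi : i ∉ t.poles r := by simpa using hi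
          simp [hs, hi, div_mul_div_comm, Complex.mul_conj', sq]
        · intro i hi
          have hi : i ∈ t.poles r := by simpa using hi
          simp [hs, hi]
      rw [this, show ∑ i ∈ (t.poles r)ᶜ, ‖M z i‖ ^ 2 = c ^ 2 by linarith]; push_cast; field_simp
    · refine Finset.sum_eq_zero fun i _ => ?_
      by_cases h : i ∈ t.poles r <;> simp [hn, hs, h]
  have hreal : t = B ∨ t = D → ∀ i, (n i).im = 0 ∧ (s i).im = 0 := by
    intro ht i
    have := im_eq_zero_of_mem ht hM z i
    simp only [hn, hs]
    split_ifs <;> simp [this]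
  -- In the symplectic case the set of poles is closed under the pairing of indices, so the form
  -- cannot pair `n`, supported on the poles, with `s`, supported off them. This is why index `r` is
  -- a pole besides 0.
  have hC : t = C → n ⬝ᵥ (symplecticForm r (t.size r) *ᵥ s) = 0 := by
    intro ht
    clear hM
    subst ht
    refine Finset.sum_eq_zero fun i _ => ?_
    by_cases h : i ∈ poles C r
    · rw [mulVec, dotProduct, Finset.sum_eq_zero, mul_zero]
      intro j _
      change Fin (2 * r) at i j
      by_cases hj : j = partner r i
      · subst hj
        have : s (partner r i) = 0 := if_pos (partner_mem_poles h)
        rw [this, mul_zero]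
      · have := symplecticForm_apply r i j
        rw [if_neg hj] at this
        exact mul_eq_zero_of_left this _
    · simp [hn, h]
  obtain ⟨Y, hY, hY3, hYt, h1, h2⟩ := exists_generator hon hreal hC
  -- With sine `b` and cosine `c` the rotation sends `b n + c s` to `(b² + c²) s = s`, which has no
  -- polar part. Jordan's inequality bounds the angle by `π b / 2`.
  refine ⟨Y, hY, hY3, hYt, Real.arcsin b, Real.arcsin_nonneg.2 h0.le, ?_, fun i hi => ?_⟩
  · have h := Real.mul_le_sin (Real.arcsin_nonneg.2 h0.le) (Real.arcsin_le_pi_div_two b)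
    rw [Real.sin_arcsin (by linarith) (by nlinarith)] at h
    have hpi := Real.pi_pos
    calc Real.arcsin b = Real.pi / 2 * (2 / Real.pi * Real.arcsin b) := by field_simp
      _ ≤ _ := by gcongr
  · have hsin : Real.sin (Real.arcsin b) = b := Real.sin_arcsin (by linarith) (by nlinarith)
    have hcos : Real.cos (Real.arcsin b) = c := Real.cos_arcsin b
    have : M z ᵥ* Y.rot (Real.arcsin b) = s := by
      have h3 : n ᵥ* (Y * Y) = -n := by rw [← vecMul_vecMul, h1, h2]
      have h4 : s ᵥ* (Y * Y) = -s := by rw [← vecMul_vecMul, h2, neg_vecMul, h1]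
      rw [hrow, rot, hsin, hcos]
      simp only [vecMul_add, vecMul_one, add_vecMul, smul_vecMul, vecMul_smul, h1, h2, h3, h4]
      have hbc : (c : ℂ) ^ 2 = 1 - b ^ 2 := by exact_mod_cast hc2
      ext j
      simp
      linear_combination (s j) * hbc
    rw [mul_apply_eq_vecMul, this]
    simp [hs, hi]

/-- Every entry of a row over a pole can be exchanged with at least `r` others. -/
theorem exists_rot_exchange (i : Fin (t.size r)) (hi : i ∈ t.poles r) :
    ∃ K : Finset (Fin (t.size r)), r ≤ K.card ∧ ∀ k ∈ K, k ≠ i →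
      ∃ Y ∈ t.matrixLieAlgebra r, Y * Y * Y = -Y ∧
        ∀ (M : Matrix (Fin (t.size r)) (Fin (t.size r)) ℂ) (z),
          (M * Y.rot (Real.pi / 2)) z i = -M z k := by
  have key (k) (hk : k ≠ i) (hC : t = C → symplecticForm r (t.size r) i k = 0) :
      ∃ Y ∈ t.matrixLieAlgebra r, Y * Y * Y = -Y ∧
        ∀ (M : Matrix (Fin (t.size r)) (Fin (t.size r)) ℂ) (z),
          (M * Y.rot (Real.pi / 2)) z i = -M z k := by
    have hon : Orthonormal₂ (Pi.single i 1 : Fin (t.size r) → ℂ) (Pi.single k 1) :=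
      ⟨by simp, by simp, by simp [hk]⟩
    have hreal (j) : ((Pi.single i 1 : Fin (t.size r) → ℂ) j).im = 0 ∧
        ((Pi.single k 1 : Fin (t.size r) → ℂ) j).im = 0 := by
      constructor
      · by_cases h : j = i
        · subst h; simp
        · simp [h]
      · by_cases h : j = k
        · subst h; simp
        · simp [h]
    obtain ⟨Y, hY, hY3, -, h1, h2⟩ := exists_generator hon (fun _ => hreal)
      (fun h => by simp [hC h])
    refine ⟨Y, hY, hY3, fun M z => ?_⟩
    -- The generator is known by its action on row vectors, but a column of the rotation is wanted;
    -- it is the conjugate of a row of the adjoint.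
    have hc : (Y.rot (Real.pi / 2))ᴴ = 1 - Y + Y * Y := by
      have : Yᴴ = -Y := hY.1
      simp [rot, this, sub_eq_add_neg]
    have hr : (Pi.single i 1 : Fin (t.size r) → ℂ) ᵥ* (Y.rot (Real.pi / 2))ᴴ = -Pi.single k 1 := by
      rw [hc, vecMul_add, vecMul_sub, vecMul_one, ← vecMul_vecMul, h1, h2]
      abel
    have hcol (j) : Y.rot (Real.pi / 2) j i = if j = k then -1 else 0 := by
      have h := congrArg star (congrFun hr j)
      simp only [single_one_vecMul, Matrix.row_apply, conjTranspose_apply, star_star] at h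
      rw [h]
      by_cases hj : j = k
      · subst hj; simp
      · simp [hj]
    simp [mul_apply, hcol]
  cases t with
  | A => exact ⟨Finset.univ, by rw [Finset.card_fin]; simp only [size]; omega,
      fun k _ hk => key k hk (by simp)⟩
  | B => exact ⟨Finset.univ, by rw [Finset.card_fin]; simp only [size]; omega,
      fun k _ hk => key k hk (by simp)⟩
  | D => exact ⟨Finset.univ, by rw [Finset.card_fin]; simp only [size]; omega,
      fun k _ hk => key k hk (by simp)⟩
  | C =>
    have hr : (i : ℕ) < 2 * r := i.2
    replace hi : (i : ℕ) = 0 ∨ (i : ℕ) = r := (Finset.mem_filter.1 hi).2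
    -- The `r` consecutive indices from `i` on avoid the partner of `i`, the one index whose plane
    -- with `i` is not orthogonal to its quaternionic conjugate.
    let f : Fin r ↪ Fin (2 * r) := ⟨fun a => ⟨i + a, by have := a.2; omega⟩, fun a b h => by
      simpa [Fin.ext_iff] using h⟩
    refine ⟨Finset.univ.map f,
      (Finset.card_map _).trans (Finset.card_fin r) |>.ge, fun k hk hki => key k hki fun _ => ?_⟩
    obtain ⟨a, -, rfl⟩ := Finset.mem_map.1 hk
    have ha := a.2
    have hf : ((f a : Fin (2 * r)) : ℕ) = i + a := rfl
    simp only [symplecticForm, of_apply]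
    rw [if_neg, if_neg]
    · change ¬ ((f a : Fin (2 * r)) : ℕ) = i + r
      omega
    · change ¬ (i : ℕ) = ((f a : Fin (2 * r)) : ℕ) + r
      omega

end ClassicalSeries

namespace ClassicalSeries

open Matrix

/-! ### The hypersurfaces over the concentration loci -/

/-- The real codimension of the submanifold that contains the concentration locus. -/
def codim : ClassicalSeries → ℕ
  | A => 2
  | _ => 1

theorem codim_pos (t : ClassicalSeries) : 0 < t.codim := by cases t <;> simp [codim]

/-- The linear function of the first matrix entry whose zero set contains the concentration
locus: the entry itself for `SU`, its real part in the other cases. -/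
noncomputable def height : ∀ t : ClassicalSeries, ℂ →L[ℝ] EuclideanSpace ℝ (Fin t.codim)
  | A => Complex.orthonormalBasisOneI.repr.toContinuousLinearEquiv.toContinuousLinearMap
  | B => Complex.reCLM.smulRight (EuclideanSpace.single (0 : Fin 1) 1)
  | C => Complex.reCLM.smulRight (EuclideanSpace.single (0 : Fin 1) 1)
  | D => Complex.reCLM.smulRight (EuclideanSpace.single (0 : Fin 1) 1)

theorem norm_height_A (w : ℂ) : ‖height A w‖ = ‖w‖ :=
  LinearIsometryEquiv.norm_map Complex.orthonormalBasisOneI.repr w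

theorem height_A_surjective (w : EuclideanSpace ℝ (Fin (codim A))) : ∃ c, height A c = w :=
  LinearIsometryEquiv.surjective Complex.orthonormalBasisOneI.repr w

theorem exists_height_eq_smul {t : ClassicalSeries} (ht : t ≠ A) :
    ∃ e : EuclideanSpace ℝ (Fin t.codim), ‖e‖ = 1 ∧ (∀ v, ∃ c : ℝ, v = c • e) ∧
      ∀ w, t.height w = w.re • e := by
  have h (v : EuclideanSpace ℝ (Fin 1)) : ∃ c : ℝ, v = c • EuclideanSpace.single (0 : Fin 1) 1 :=
    ⟨v 0, by ext i; fin_cases i; simp⟩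
  have h1 : ‖EuclideanSpace.single (0 : Fin 1) (1 : ℝ)‖ = 1 := by simp
  cases t with
  | A => exact absurd rfl ht
  | B => exact ⟨EuclideanSpace.single (0 : Fin 1) 1, h1, h, fun _ => rfl⟩
  | C => exact ⟨EuclideanSpace.single (0 : Fin 1) 1, h1, h, fun _ => rfl⟩
  | D => exact ⟨EuclideanSpace.single (0 : Fin 1) 1, h1, h, fun _ => rfl⟩

variable {t : ClassicalSeries} {r : ℕ} {M : Matrix (Fin (t.size r)) (Fin (t.size r)) ℂ}

theorem planeRot_mem_of_real {n s : Fin (t.size r) → ℂ} (ht : t = B ∨ t = D)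
    (hn : ∀ i, (n i).im = 0 ∧ (s i).im = 0) : planeRot n s ∈ t.matrixLieAlgebra r := by
  have h1 (i j) : (planeRot n s i j).im = 0 := by simp [planeRot, vecMulVec_apply, hn i, hn j]
  have h2 : (planeRot n s).trace = 0 := by
    have hn' : star n = n := by ext i; exact Complex.conj_eq_iff_im.2 (hn i).1
    have hs' : star s = s := by ext i; exact Complex.conj_eq_iff_im.2 (hn i).2
    rw [trace_planeRot, hn', hs', dotProduct_comm, sub_self]
  rcases ht with rfl | rfl
  · exact ⟨planeRot_conjTranspose n s, h2, h1⟩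
  · exact ⟨planeRot_conjTranspose n s, h2, h1⟩

/-- The height is a submersion off its poles. -/
theorem exists_height_mul_eq (hM : M ∈ t.matrixGroup r) {z : Fin (t.size r)}
    (h : ‖t.height (M z z)‖ < 1) (w : EuclideanSpace ℝ (Fin t.codim)) :
    ∃ X ∈ t.matrixLieAlgebra r, t.height ((M * X) z z) = w := by
  have hrow := row_dotProduct_star hM z
  by_cases htA : t = A
  · subst htA
    rw [norm_height_A] at h
    set u := M z
    obtain ⟨c, rfl⟩ := height_A_surjective w
    have hpos : (1 - ‖u z‖ ^ 2 : ℂ) ≠ 0 := by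
      have : (1 - ‖u z‖ ^ 2 : ℝ) ≠ 0 := by nlinarith [norm_nonneg (u z)]
      exact_mod_cast this
    -- Since `s z = 0`, the planes are orthogonal, which gives trace zero, and the entry `(z, z)` of
    -- the product is `-(1 - ‖u z‖²) (n z)`; this choice of `n` makes it `c`.
    let n : Fin (size A r) → ℂ := Pi.single z (-c / (1 - ‖u z‖ ^ 2))
    let s : Fin (size A r) → ℂ := u - Pi.single z (u z)
    have hs : s z = 0 := by simp [s]
    refine ⟨planeRot n s, ⟨planeRot_conjTranspose n s, ?_, trivial⟩, ?_⟩
    · simp [trace_planeRot, n, hs]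
    · have h1 : u ⬝ᵥ star s = 1 - ‖u z‖ ^ 2 := by
        simp [s, star_sub, dotProduct_sub, hrow, Complex.mul_conj']
      have h2 : (M * planeRot n s) z z = c := by
        rw [mul_apply_eq_vecMul, vecMul_planeRot]
        simp only [Pi.sub_apply, Pi.smul_apply, hs,
          show M z ⬝ᵥ star s = _ from h1, n, Pi.single_eq_same, smul_eq_mul]
        field_simp
        ring
      rw [h2]
  obtain ⟨e, he, hspan, hh⟩ := exists_height_eq_smul htA
  obtain ⟨c, rfl⟩ := hspan w
  rw [hh, norm_smul, he, mul_one, Real.norm_eq_abs] at h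
  suffices H : ∃ X : ℝ → Matrix (Fin (t.size r)) (Fin (t.size r)) ℂ,
      (∀ a, X a ∈ t.matrixLieAlgebra r) ∧ ∃ d : ℝ, d ≠ 0 ∧ ∀ a, ((M * X a) z z).re = a * d by
    obtain ⟨X, hX, d, hd, H⟩ := H
    exact ⟨X (c / d), hX _, by rw [hh, H, div_mul_cancel₀ _ hd]⟩
  -- The real part of the square is `re² - im²`, at most `re²`, which is less than 1; this keeps the
  -- derivative away from zero.
  have hsq : 0 < 1 - ((M z z) ^ 2).re := by
    have : ((M z z) ^ 2).re = (M z z).re ^ 2 - (M z z).im ^ 2 := by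
      rw [sq, Complex.mul_re]; ring
    nlinarith [(sq_lt_one_iff_abs_lt_one _).2 h, sq_nonneg (M z z).im]
  have hX (a : ℝ) : (M z ᵥ* planeRot (Pi.single z (a : ℂ)) (M z)) z = a * ((M z z) ^ 2 - 1) := by
    rw [vecMul_planeRot, hrow]
    simp
    ring
  by_cases htC : t = C
  · subst htC
    change Matrix (Fin (2 * r)) (Fin (2 * r)) ℂ at M
    change Fin (2 * r) at z
    set J := symplecticForm r (2 * r) with hJ
    have hJz : J z z = 0 := by
      have := z.2
      simp only [hJ, symplecticForm, of_apply]
      split_ifs <;> first | omega | rfl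
    -- The symplectic correction contributes the second summand, with the same sign as the first, so
    -- no cancellation can occur.
    refine ⟨fun a => symplecticPart r (planeRot (Pi.single z (a : ℂ)) (M z)),
      fun a => symplecticPart_mem (planeRot_conjTranspose _ _),
      -((1 - ((M z z) ^ 2).re) + ‖(M z ᵥ* J) z‖ ^ 2),
      neg_ne_zero.2 (by positivity), fun a => ?_⟩
    have h1 : (star (Pi.single z (a : ℂ)) ᵥ* J) z = 0 := by
      simp [hJz]
    have h2 : M z ⬝ᵥ star (star (Pi.single z (a : ℂ)) ᵥ* J) = -(a * (M z ᵥ* J) z) := by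
      rw [star_vecMul, star_star, symplecticForm_conjTranspose, neg_mulVec, dotProduct_neg,
        dotProduct_mulVec, dotProduct_single, mul_comm]
    have h3 : (star (M z) ᵥ* J) z = star ((M z ᵥ* J) z) := by
      have : J.map star = J := by
        ext i j
        simp only [hJ, symplecticForm, of_apply, map_apply]
        split_ifs <;> simp
      rw [vecMul, vecMul, ← star_dotProduct_star, dotProduct_comm]
      congr 1
      ext i
      exact (congrFun (congrFun this i) z).symm
    change ((M * symplecticPart r (planeRot (Pi.single z (a : ℂ)) (M z))) z z).re = _
    rw [mul_apply_eq_vecMul, symplecticPart_planeRot, vecMul_add, Pi.add_apply]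
    change ((M z ᵥ* planeRot (Pi.single z (a : ℂ)) (M z)) z + _).re = _
    erw [hX]
    rw [vecMul_planeRot, Pi.sub_apply, Pi.smul_apply, Pi.smul_apply, h1, smul_zero, sub_zero, h2,
      h3, smul_eq_mul, neg_mul, mul_assoc, RCLike.star_def, Complex.mul_conj', Complex.add_re,
      Complex.neg_re, Complex.re_ofReal_mul, Complex.re_ofReal_mul, Complex.sub_re, Complex.one_re]
    norm_cast
    ring
  · have htBD : t = B ∨ t = D := by cases t <;> simp_all
    refine ⟨fun a => planeRot (Pi.single z (a : ℂ)) (M z), fun a => planeRot_mem_of_real htBD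
      fun i => ⟨?_, im_eq_zero_of_mem htBD hM z i⟩, -(1 - ((M z z) ^ 2).re), neg_ne_zero.2 hsq.ne',
      fun a => ?_⟩
    · by_cases hi : i = z
      · subst hi; simp
      · simp [hi]
    · rw [mul_apply_eq_vecMul, hX, Complex.re_ofReal_mul, Complex.sub_re, Complex.one_re]
      ring

/-! ### The center of a classical group -/

theorem symplecticPart_apply (P : Matrix (Fin (2 * r)) (Fin (2 * r)) ℂ) (i j) :
    symplecticPart r P i j = P i j - (if (i : ℕ) < r then -1 else 1) *
      (if (j : ℕ) < r then -1 else 1)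
      * P (partner r j) (partner r i) := by
  rw [symplecticPart, Matrix.add_apply, Matrix.mul_apply, Finset.sum_eq_single (partner r j)]
  · rw [Matrix.mul_apply, Finset.sum_eq_single (partner r i)]
    · rw [symplecticForm_apply, symplecticForm_apply, partner_partner, if_pos rfl, if_pos rfl]
      simp only [partner_lt_iff, transpose_apply]
      split_ifs <;> simp [sub_eq_add_neg]
    · intro k _ hk
      rw [symplecticForm_apply, if_neg hk, zero_mul]
    · simp
  · intro k _ hk
    rw [symplecticForm_apply, if_neg, mul_zero]
    rintro rfl
    exact hk (partner_partner r k).symm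
  · simp

theorem diagonal_conjTranspose_eq_neg {m : Type*} [DecidableEq m] {d : m → ℂ} (h : star d = -d) :
    (diagonal d)ᴴ = -diagonal d := by
  rw [diagonal_conjTranspose, h]
  exact (diagonal_neg d).symm

theorem entry_eq_zero_of_commute_diagonal {m : Type*} [Fintype m] [DecidableEq m]
    {S : Matrix m m ℂ} {d : m → ℂ} (h : S * diagonal d = diagonal d * S) {i j : m}
    (hij : d i ≠ d j) : S i j = 0 := by
  have := congrFun (congrFun h i) j
  rw [mul_diagonal, diagonal_mul, mul_comm, ← sub_eq_zero, ← sub_mul] at this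
  exact (mul_eq_zero.1 this).resolve_left (sub_ne_zero.2 hij.symm)

variable {S : Matrix (Fin (t.size r)) (Fin (t.size r)) ℂ}

/-- The first column of a matrix that commutes with the Lie algebra of a classical group. -/
theorem height_mul_eq_zero (hS : S ∈ t.matrixGroup r)
    (hcomm : ∀ Y ∈ t.matrixLieAlgebra r, S * Y = Y * S)
    (hsize : t = B ∨ t = D → 3 ≤ t.size r) {z : Fin (t.size r)}
    (M : Matrix (Fin (t.size r)) (Fin (t.size r)) ℂ) (h : t.height (M z z) = 0) :
    t.height ((M * S) z z) = 0 := by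
  -- Multiplication by `S` then just scales the entry `(z, z)`; for `SU` any complex scalar
  -- preserves the zero set, while for a real part the scalar has to be real.
  suffices H : (∀ k ≠ z, S k z = 0) ∧ (t ≠ A → (S z z).im = 0) by
    have h1 : (M * S) z z = M z z * S z z := by
      rw [mul_apply, Finset.sum_eq_single z (fun k _ hk => by rw [H.1 k hk, mul_zero]) (by simp)]
    rw [h1]
    by_cases htA : t = A
    · subst htA
      rw [← norm_eq_zero, norm_height_A, norm_eq_zero] at h
      rw [h, zero_mul, map_zero]
    · obtain ⟨e, he, -, hh⟩ := exists_height_eq_smul htA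
      have he0 : e ≠ 0 := by rintro rfl; simp at he
      rw [hh, smul_eq_zero_iff_left he0] at h
      rw [hh, Complex.mul_re, h, H.2 htA]
      simp
  have hBD (ht : t = B ∨ t = D) : (∀ k ≠ z, S k z = 0) ∧ (t ≠ A → (S z z).im = 0) := by
    refine ⟨fun k hk => ?_, fun _ => im_eq_zero_of_mem ht hS z z⟩
    -- A third index is needed: commuting with the rotation of the plane of `z` and `l` forces `S k
    -- z = 0`. With two indices the rotation group is commutative and the claim fails.
    obtain ⟨l, hl⟩ : ∃ l, l ∉ ({z, k} : Finset (Fin (t.size r))) := by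
      by_contra! hl
      have h1 := Finset.card_le_card (fun l _ => hl l : Finset.univ ⊆ ({z, k} : Finset _))
      have h2 := Finset.card_le_two (a := z) (b := k)
      have := hsize ht
      simp at h1
      omega
    simp only [Finset.mem_insert, Finset.mem_singleton, not_or] at hl
    have hY := hcomm (planeRot (Pi.single z 1) (Pi.single l 1)) (planeRot_mem_of_real ht fun i => by
      constructor
      · by_cases h : i = z
        · subst h; simp
        · simp [h]
      · by_cases h : i = l
        · subst h; simp
        · simp [h])
    have hY := congrFun (congrFun hY k) l
    simpa [planeRot, Matrix.mul_sub, Matrix.sub_mul, vecMulVec_apply, mul_apply, hl.1, hl.2, hk,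
      Pi.single_apply, Ne.symm hl.2, ← Pi.single_star] using hY
  cases t with
  | B => exact hBD (.inl rfl)
  | D => exact hBD (.inr rfl)
  | A =>
    refine ⟨fun k hk => ?_, fun h => absurd rfl h⟩
    have := hcomm (diagonal (Pi.single z Complex.I - Pi.single k Complex.I)) ⟨?_, ?_, trivial⟩
    · refine entry_eq_zero_of_commute_diagonal this ?_
      simp [hk, Ne.symm hk]
      intro h
      have := congrArg Complex.im h
      norm_num at this
    · refine diagonal_conjTranspose_eq_neg ?_
      simp [Pi.single_neg]
      abel
    · simp [trace_diagonal]
  | C =>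
    change Fin (2 * r) at z
    change Matrix (Fin (2 * r)) (Fin (2 * r)) ℂ at S
    have hpz : partner r z ≠ z := fun h => by
      have := partner_lt_iff r z
      rw [h] at this
      tauto
    -- A torus element whose eigenvalues at `z` and at its partner differ from each other and from
    -- all others; commuting with it isolates both indices.
    set d : Fin (2 * r) → ℂ := Pi.single z Complex.I - Pi.single (partner r z) Complex.I with hd
    have hdiag : symplecticPart r (diagonal (Pi.single z Complex.I)) = diagonal d := by
      ext i j
      rw [symplecticPart_apply]
      by_cases hij : i = j
      · subst hij
        have : (Pi.single z Complex.I : Fin (2 * r) → ℂ) (partner r i) =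
            (Pi.single (partner r z) Complex.I : Fin (2 * r) → ℂ) i := by
          by_cases h : i = partner r z
          · subst h; simp [partner_partner]
          · rw [Pi.single_eq_of_ne h, Pi.single_eq_of_ne]
            rintro rfl
            exact h (partner_partner r i).symm
        simp [hd, this]
        split_ifs <;> simp
      · have : partner r j ≠ partner r i := fun h => hij (by
          rw [← partner_partner r i, ← h, partner_partner])
        simp [hij, this]
    have hcd : S * diagonal d = diagonal d * S := by
      rw [← hdiag]
      refine hcomm _ (symplecticPart_mem (diagonal_conjTranspose_eq_neg ?_))
      simp [Pi.single_neg]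
    have hdz : d z = Complex.I := by simp [hd, Ne.symm hpz]
    have hdp : d (partner r z) = -Complex.I := by simp [hd, hpz]
    have hII : -Complex.I ≠ Complex.I := fun h => by
      have := congrArg Complex.im h
      norm_num at this
    have hdk (k) (hk : k ≠ z) : d k ≠ d z := by
      rw [hdz]
      by_cases h : k = partner r z
      · rw [h, hdp]; exact hII
      · simp [hd, hk, h, Complex.I_ne_zero.symm]
    have hdk' (k) (hk : k ≠ partner r z) : d k ≠ d (partner r z) := by
      rw [hdp]
      by_cases h : k = z
      · rw [h, hdz]; exact hII.symm
      · simp [hd, hk, h]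
    have hc1 (k) (hk : k ≠ z) : S k z = 0 := entry_eq_zero_of_commute_diagonal hcd (hdk k hk)
    have hr1 (k) (hk : k ≠ z) : S z k = 0 := entry_eq_zero_of_commute_diagonal hcd (hdk k hk).symm
    have hc2 (k) (hk : k ≠ partner r z) : S k (partner r z) = 0 :=
      entry_eq_zero_of_commute_diagonal hcd (hdk' k hk)
    have hr2 (k) (hk : k ≠ partner r z) : S (partner r z) k = 0 :=
      entry_eq_zero_of_commute_diagonal hcd (hdk' k hk).symm
    refine ⟨hc1, fun _ => ?_⟩
    -- A generator joining `z` to its partner equates the two diagonal entries of `S`, and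
    -- preservation of the form makes their product 1; so the entry is `±1`, in particular real.
    set Y := symplecticPart r (planeRot (Pi.single z 1) (Pi.single (partner r z) 1)) with hYd
    have hY : S * Y = Y * S := hcomm _ (symplecticPart_mem (planeRot_conjTranspose _ _))
    have hYz : Y z (partner r z) = 2 := by
      rw [hYd, symplecticPart_apply, partner_partner]
      simp only [partner_lt_iff]
      simp [planeRot, vecMulVec_apply, hpz, Ne.symm hpz]
      split_ifs <;> first | omega | norm_num
    have e1 : S z z = S (partner r z) (partner r z) := by
      have h1 := congrFun (congrFun hY z) (partner r z)
      rw [mul_apply, mul_apply, Finset.sum_eq_single z (fun k _ hk => by rw [hr1 k hk, zero_mul])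
          (fun h => absurd (Finset.mem_univ _) h),
        Finset.sum_eq_single (partner r z) (fun k _ hk => by rw [hc2 k hk, mul_zero])
          (fun h => absurd (Finset.mem_univ _) h),
        hYz, mul_comm] at h1
      exact mul_left_cancel₀ two_ne_zero h1
    have e2 : S z z * S (partner r z) (partner r z) = 1 := by
      have h2 : S * symplecticForm r (2 * r) * Sᵀ = symplecticForm r (2 * r) := hS.2
      have h1 := congrFun (congrFun h2 z) (partner r z)
      rw [mul_apply, Finset.sum_eq_single (partner r z)
        (fun k _ hk => by rw [transpose_apply, hr2 k hk, mul_zero]) (by simp), mul_apply,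
        Finset.sum_eq_single z (fun k _ hk => by rw [hr1 k hk, zero_mul])
          (fun h => absurd (Finset.mem_univ _) h),
        transpose_apply, symplecticForm_apply, if_pos rfl] at h1
      split_ifs at h1 <;> simpa using h1
    rw [← e1] at e2
    change (S z z).im = 0
    rcases mul_self_eq_one_iff.1 e2 with h | h <;> simp [h]

end ClassicalSeries

/-! ### Exclusion of degenerate sizes -/

namespace ClassicalSeries

/-- In these sizes the Lie algebra is at most one-dimensional. The ranks are large only eventually,
whereas the geometry of the locus is needed for every index, so small sizes must be ruled out by
simplicity. -/
theorem exists_eq_smul_of_size {t : ClassicalSeries} {r : ℕ}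
    (h : t.size r = 0 ∨ ((t = B ∨ t = D) ∧ t.size r ≤ 2)) :
    ∃ Y : Matrix (Fin (t.size r)) (Fin (t.size r)) ℂ, ∀ X ∈ t.matrixLieAlgebra r,
      ∃ c : ℝ, X = c • Y := by
  rcases h with h | ⟨ht, h⟩
  · refine ⟨0, fun X _ => ⟨0, ?_⟩⟩
    ext i
    exact absurd i.2 (by omega)
  · refine ⟨Matrix.of fun i j => (((j : ℕ) : ℂ) - ((i : ℕ) : ℂ)), fun X hX => ?_⟩
    have hreal : ∀ i j, (X i j).im = 0 := by
      rcases ht with rfl | rfl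
      · exact hX.2.2
      · exact hX.2.2
    have hanti (i j) : X j i = -X i j := by
      have := congrFun (congrFun hX.1 i) j
      rw [Matrix.conjTranspose_apply, RCLike.star_def, Complex.conj_eq_iff_im.2 (hreal j i)] at this
      exact this
    have hdiag (i) : X i i = 0 := self_eq_neg.1 (hanti i i)
    by_cases h2 : t.size r = 2
    · refine ⟨(X ⟨0, by omega⟩ ⟨1, by omega⟩).re, ?_⟩
      have h01 : X ⟨0, by omega⟩ ⟨1, by omega⟩ =
          ((X ⟨0, by omega⟩ ⟨1, by omega⟩).re : ℂ) :=
        Complex.ext rfl (by rw [hreal, Complex.ofReal_im])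
      ext ⟨i, hi⟩ ⟨j, hj⟩
      have hi' : i = 0 ∨ i = 1 := by omega
      have hj' : j = 0 ∨ j = 1 := by omega
      rcases hi' with rfl | rfl <;> rcases hj' with rfl | rfl
      · rw [hdiag]; simp
      · rw [h01]; simp
      · rw [hanti, h01]; simp
      · rw [hdiag]; simp
    · refine ⟨0, ?_⟩
      ext i j
      have : i = j := Fin.ext (by have := i.2; have := j.2; omega)
      subst this
      rw [hdiag]
      simp

end ClassicalSeries

namespace ClassicalStructure

variable {F : CompactConnectedLieGroup} {t : ClassicalSeries} {r : ℕ} (σ : ClassicalStructure F t r)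

theorem size_of_isSimple (σ : ClassicalStructure F t r) (hF : F.IsSimple) :
    0 < t.size r ∧ (t = .B ∨ t = .D → 3 ≤ t.size r) := by
  by_contra hcon
  obtain ⟨Y, hY⟩ := ClassicalSeries.exists_eq_smul_of_size (t := t) (r := r) (by
    by_contra! h
    exact hcon ⟨by omega, fun ht => by have := h.2 ht; omega⟩)
  refine hF.non_abelian ⟨fun u v => ?_⟩
  have hc (v : GroupLieAlgebra (𝓡 F.dim) F) : ∃ c : ℝ, σ.deriv v = c • Y :=
    hY _ (σ.bijOn_deriv.mapsTo (mem_univ v))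
  obtain ⟨a, ha⟩ := hc u
  obtain ⟨b, hb⟩ := hc v
  have hlin (x y : ℝ) : σ.deriv (x • u + y • v) = x • σ.deriv u + y • σ.deriv v := by
    ext i j
    have h := map_add (mfderiv (𝓡 F.dim) 𝓘(ℝ, ℂ) (fun x => σ.rep x i j) 1) (x • u) (y • v)
    rw [map_smul, map_smul] at h
    exact h
  have hinj (w : GroupLieAlgebra (𝓡 F.dim) F) (hw : σ.deriv w = 0) : w = 0 := by
    refine σ.bijOn_deriv.injOn (mem_univ _) (mem_univ _) (Eq.trans hw ?_)
    ext i j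
    exact (map_zero (mfderiv (𝓡 F.dim) 𝓘(ℝ, ℂ) (fun x => σ.rep x i j) 1)).symm
  have h0 : b • u + -a • v = 0 := hinj _ (by rw [hlin, ha, hb]; module)
  by_cases h : a = 0
  · have : u = 0 := hinj _ (by rw [ha, h, zero_smul])
    rw [this, zero_lie]
  · have hv : v = (a⁻¹ * b) • u := by
      have h1 : a • v = b • u := by
        rw [neg_smul, add_neg_eq_zero] at h0; exact h0.symm
      rw [mul_smul, ← h1, smul_smul, inv_mul_cancel₀ h, one_smul]
    rw [hv, lie_smul, lie_self, smul_zero]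

theorem rep_mem (x : F) : σ.rep x ∈ t.matrixGroup r := σ.range_rep ▸ mem_range_self x

/-- Differentiate `rep (x * y) = rep (y * x)` at `y = 1`; every matrix in the Lie algebra is such a
derivative. -/
theorem rep_commute_of_mem_center {x : F} (hx : x ∈ Subgroup.center F)
    {Y : Matrix (Fin (t.size r)) (Fin (t.size r)) ℂ} (hY : Y ∈ t.matrixLieAlgebra r) :
    σ.rep x * Y = Y * σ.rep x := by
  obtain ⟨v, -, rfl⟩ := σ.bijOn_deriv.surjOn hY
  change σ.rep x * σ.deriv v = σ.deriv v * σ.rep x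
  ext i j
  rw [← σ.mfderiv_rep_mul_left, ← σ.mfderiv_rep_mul_right]
  have h : (fun y => σ.rep (x * y) i j) = fun y => σ.rep (y * x) i j := by
    ext y; rw [Subgroup.mem_center_iff.1 hx]
  exact congrArg (fun f : F → ℂ =>
    (mfderiv (𝓡 F.dim) 𝓘(ℝ, ℂ) f 1 : EuclideanSpace ℝ (Fin F.dim) →L[ℝ] ℂ) v) h

theorem continuous_rep : Continuous σ.rep :=
  continuous_matrix fun i j => (σ.contMDiff i j).continuous

theorem isClosed_locus : IsClosed σ.locus := by
  have h : IsClosed (t.matrixLocus r) := by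
    cases t <;> simp only [ClassicalSeries.matrixLocus, ofPred_forall]
    · exact isClosed_iInter fun i => isClosed_iInter fun _ =>
        isClosed_eq (by fun_prop) (by fun_prop)
    · exact isClosed_iInter fun i => isClosed_iInter fun j => isClosed_iInter fun _ =>
        isClosed_iInter fun _ => isClosed_eq (by fun_prop) (by fun_prop)
    · exact isClosed_iInter fun i => isClosed_iInter fun _ =>
        isClosed_eq (Complex.continuous_re.comp (by fun_prop)) (by fun_prop)
    · exact isClosed_iInter fun i => isClosed_iInter fun j => isClosed_iInter fun _ =>
        isClosed_iInter fun _ => isClosed_eq (by fun_prop) (by fun_prop)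
  exact h.preimage σ.continuous_rep

theorem height_eq_zero_of_mem_locus {z : Fin (t.size r)} (hz : (z : ℕ) = 0) {x : F}
    (hx : x ∈ σ.locus) : t.height (σ.rep x z z) = 0 := by
  have hx : σ.rep x ∈ t.matrixLocus r := hx
  have h : t.height (σ.rep x z z) = t.height 0 := by
    cases t with
    | A => rw [hx z hz]
    | B => rw [hx z z hz (by omega)]
    | D => rw [hx z z hz (by omega)]
    | C =>
      obtain ⟨e, -, -, he⟩ := ClassicalSeries.exists_height_eq_smul (t := .C) (by simp)
      rw [he, he, hx z hz, Complex.zero_re]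
  rw [h, map_zero]

end ClassicalStructure

/-! ### Descent of the height hypersurface to `G` -/

namespace Presentation

variable {G : CompactConnectedLieGroup} (D : Presentation G)

theorem exists_localSection (y₀ : D.Cover) : ∃ (V : Set D.Cover) (W : Set G) (ψ : G → D.Cover),
    IsOpen V ∧ IsOpen W ∧ y₀ ∈ V ∧ ContMDiffOn (𝓡 G.dim) D.coverModel ∞ ψ W ∧
      (∀ y ∈ W, ψ y ∈ V ∧ D.proj (ψ y) = y) ∧ ∀ y ∈ V, D.proj y ∈ W ∧ ψ (D.proj y) = y := by
  obtain ⟨Φ, h0, heq⟩ := D.isLocalDiffeomorph y₀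
  refine ⟨Φ.source, Φ.target, Φ.symm, Φ.open_source, Φ.open_target, h0, Φ.contMDiffOn_invFun,
    fun y hy => ?_, fun y hy => ?_⟩
  · have h1 : Φ.symm y ∈ Φ.source := Φ.map_target' hy
    refine ⟨h1, ?_⟩
    rw [heq h1]
    exact Φ.right_inv' hy
  · rw [heq hy]
    exact ⟨Φ.map_source' hy, Φ.left_inv' hy⟩

variable {D} {i : Fin D.k} {t : ClassicalSeries} {r : ℕ}

/-- The defining function is the height read through a local section of the presentation. Other
sheets over the same points cause no trouble: they differ by kernel elements, whose components are
central and preserve the zero set. -/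
theorem isSubmanifoldOfCodim_height (σ : ClassicalStructure (D.factor i) t r)
    (z : Fin (t.size r)) : IsSubmanifoldOfCodim G t.codim
      (D.proj '' {y | t.height (σ.rep (y.1 i) z z) = 0}) := by
  rintro _ ⟨y₀, hy₀, rfl⟩
  obtain ⟨V, W, ψ, hV, hW, h0, hψ, hsec, hinv⟩ := D.exists_localSection y₀
  let Λ : D.Cover → EuclideanSpace ℝ (Fin t.codim) := fun y => t.height (σ.rep (y.1 i) z z)
  have hh : ContMDiff 𝓘(ℝ, ℂ) (𝓡 t.codim) ∞ t.height := t.height.contMDiff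
  have hΛ : ContMDiff D.coverModel (𝓡 t.codim) ∞ Λ :=
    (hh.comp (σ.contMDiff z z)).comp (D.contMDiff_component i)
  have hf : ContMDiffOn (𝓡 G.dim) (𝓡 t.codim) ∞ (Λ ∘ ψ) W := hΛ.comp_contMDiffOn hψ
  -- The unit ball is exactly where `exists_height_mul_eq` gives surjectivity.
  have hU : IsOpen (W ∩ (Λ ∘ ψ) ⁻¹' Metric.ball 0 1) :=
    hf.continuousOn.isOpen_inter_preimage hW Metric.isOpen_ball
  refine ⟨W ∩ (Λ ∘ ψ) ⁻¹' Metric.ball 0 1, Λ ∘ ψ, hU, ⟨(hinv _ h0).1, ?_⟩,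
    hf.mono inter_subset_left, ?_, ?_⟩
  · have : Λ y₀ = 0 := hy₀
    simp [(hinv _ h0).2, this]
  · rintro y ⟨hy, hy1⟩ w
    have hy1 : ‖t.height (σ.rep ((ψ y).1 i) z z)‖ < 1 := mem_ball_zero_iff.1 hy1
    obtain ⟨X, hX, hXw⟩ := ClassicalSeries.exists_height_mul_eq (σ.rep_mem ((ψ y).1 i)) hy1 w
    obtain ⟨v, -, rfl⟩ := σ.bijOn_deriv.surjOn hX
    change t.height ((σ.rep ((ψ y).1 i) * σ.deriv v) z z) = w at hXw
    -- Moving in the single factor `i` already produces every value of the derivative, because there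
    -- the section amounts to right multiplication by the factor in the cover.
    let q : D.factor i → G := fun h => y * D.incl i h
    have hq : ContMDiff (𝓡 (D.factor i).dim) (𝓡 G.dim) ∞ q :=
      contMDiff_const.mul (D.contMDiff_incl i)
    have hq1 : q 1 = y := by simp [q]
    have hqf : (Λ ∘ ψ) ∘ q =ᶠ[𝓝 1] fun h => t.height (σ.rep ((ψ y).1 i * h) z z) := by
      have hc : Continuous fun h => ψ y * D.single i h := by have := D.continuous_single i; fun_prop
      have : ∀ᶠ h in 𝓝 (1 : D.factor i), ψ y * D.single i h ∈ V :=
        hc.continuousAt.eventually_mem (hV.mem_nhds (by simpa using (hsec y hy).1))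
      filter_upwards [this] with h hh
      have h1 : q h = D.proj (ψ y * D.single i h) := by
        rw [map_mul, (hsec y hy).2]; rfl
      change Λ (ψ (q h)) = _
      rw [h1, (hinv _ hh).2]
      change t.height (σ.rep ((ψ y).1 i * (D.single i h).1 i) z z) = _
      rw [D.single_fst_self]
    have key : ∀ y', y' = y → (∃ u, mfderiv (𝓡 G.dim) (𝓡 t.codim) (Λ ∘ ψ) y' u = w) →
        ∃ u, mfderiv (𝓡 G.dim) (𝓡 t.codim) (Λ ∘ ψ) y u = w := by
      rintro _ rfl h; exact h
    refine key (q 1) hq1 ⟨mfderiv (𝓡 (D.factor i).dim) (𝓡 G.dim) q 1 v, ?_⟩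
    have hfq : HasMFDerivAt (𝓡 G.dim) (𝓡 t.codim) (Λ ∘ ψ) (q 1) _ :=
      (((hf.contMDiffAt (hW.mem_nhds (hq1 ▸ hy))).mdifferentiableAt (by simp))).hasMFDerivAt
    have e1 := (HasMFDerivAt.comp 1 hfq (hq.mdifferentiable (by simp) 1).hasMFDerivAt).mfderiv
    have hr : ContMDiff (𝓡 (D.factor i).dim) 𝓘(ℝ, ℂ) ∞ fun h => σ.rep ((ψ y).1 i * h) z z :=
      (σ.contMDiff z z).comp contMDiff_mul_left
    have e2 := (HasMFDerivAt.comp 1 t.height.hasMFDerivAt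
      (hr.mdifferentiable (by simp) 1).hasMFDerivAt).mfderiv
    have e3 := hqf.mfderiv_eq (I := 𝓡 (D.factor i).dim) (I' := 𝓡 t.codim)
    refine (congrArg (fun L : EuclideanSpace ℝ (Fin (D.factor i).dim) →L[ℝ]
      EuclideanSpace ℝ (Fin t.codim) => L v) (e1.symm.trans (e3.trans e2))).trans ?_
    exact (congrArg t.height (σ.mfderiv_rep_mul_left v _ z z)).trans hXw
  · ext y
    constructor
    · rintro ⟨⟨y', hy', rfl⟩, hy, hy1⟩
      refine ⟨⟨hy, hy1⟩, ?_⟩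
      have hz : D.proj (y'⁻¹ * ψ (D.proj y')) = 1 := by
        rw [map_mul, map_inv, (hsec _ hy).2, inv_mul_cancel]
      have hc := D.fst_mem_center_of_proj_eq_one hz i
      have h1 : σ.rep ((ψ (D.proj y')).1 i) =
          σ.rep (y'.1 i) * σ.rep ((y'⁻¹ * ψ (D.proj y')).1 i) := by
        rw [← map_mul, ← Pi.mul_apply, ← Prod.fst_mul, mul_inv_cancel_left]
      change t.height (σ.rep ((ψ (D.proj y')).1 i) z z) = 0
      rw [h1]
      exact ClassicalSeries.height_mul_eq_zero (σ.rep_mem _)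
        (fun Y hY => σ.rep_commute_of_mem_center hc hY) (σ.size_of_isSimple (D.simple i)).2 _ hy'
    · rintro ⟨hy, h⟩
      exact ⟨⟨ψ y, h, (hsec y hy.1).2⟩, hy⟩

end Presentation

/-! ### Averages over compact groups -/

section Average

variable {P : Type*} [Group P] [TopologicalSpace P] [IsTopologicalGroup P] [CompactSpace P]
  [MeasurableSpace P] [BorelSpace P]

/-- The image of normalized Haar measure under a continuous surjective homomorphism is again Haar,
so uniqueness identifies it; estimates on `G` can be made on the cover. -/
theorem exists_isHaarMeasure_map_eq {B : Type*} [Group B] [TopologicalSpace B]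
    [IsTopologicalGroup B] [T2Space B] [CompactSpace B] [MeasurableSpace B] [BorelSpace B]
    (μ : Measure B) [μ.IsHaarMeasure] [IsProbabilityMeasure μ] {p : P →* B} (hp : Continuous p)
    (hs : Function.Surjective p) :
    ∃ ν : Measure P, ν.IsHaarMeasure ∧ IsProbabilityMeasure ν ∧ ν.map p = μ := by
  let ν : Measure P := Measure.haarMeasure ⊤
  have hν : IsProbabilityMeasure ν := ⟨Measure.haarMeasure_self⟩
  have h1 : (ν.map p).IsHaarMeasure := Measure.isHaarMeasure_map_of_isFiniteMeasure ν p hp hs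
  have h2 : IsProbabilityMeasure (ν.map p) :=
    Measure.isProbabilityMeasure_map hp.measurable.aemeasurable
  exact ⟨ν, inferInstance, hν, Measure.isHaarMeasure_eq_of_isProbabilityMeasure _ _⟩

theorem isMulRightInvariant_of_isProbabilityMeasure (ν : Measure P) [ν.IsHaarMeasure]
    [IsProbabilityMeasure ν] : ν.IsMulRightInvariant := by
  refine ⟨fun h => ?_⟩
  have : IsProbabilityMeasure (ν.map (· * h)) :=
    Measure.isProbabilityMeasure_map (continuous_mul_const h).measurable.aemeasurable
  exact Measure.isHaarMeasure_eq_of_isProbabilityMeasure _ _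

/-- Entries of a random unit vector that can be exchanged with many others are small. -/
theorem measure_sum_norm_sq_ge_le (ν : Measure P) [ν.IsHaarMeasure] [IsProbabilityMeasure ν]
    {m : Type*} [Fintype m] (ρ : P → m → ℂ) (hρ : Continuous ρ)
    (hunit : ∀ y, ∑ i, ‖ρ y i‖ ^ 2 = 1) (I : Finset m) (r : ℕ)
    (hK : ∀ i ∈ I, ∃ K : Finset m, r ≤ K.card ∧
      ∀ k ∈ K, k ≠ i → ∃ h, ∀ y, ‖ρ (y * h) i‖ = ‖ρ y k‖) {c : ℝ} (hc : 0 < c) (hr : 0 < r) :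
    ν {y | c ≤ ∑ i ∈ I, ‖ρ y i‖ ^ 2} ≤ ENNReal.ofReal (I.card / (r * c)) := by
  have := isMulRightInvariant_of_isProbabilityMeasure ν
  have hcont (i : m) : Continuous fun y => ‖ρ y i‖ ^ 2 := by fun_prop
  have hint (i : m) : Integrable (fun y => ‖ρ y i‖ ^ 2) ν :=
    (hcont i).integrable_of_hasCompactSupport (HasCompactSupport.of_compactSpace _)
  have hsum : ∑ i, ∫ y, ‖ρ y i‖ ^ 2 ∂ν = 1 := by
    rw [← integral_finsetSum _ fun i _ => hint i]
    simp [hunit]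
  have hnn (i : m) : 0 ≤ ∫ y, ‖ρ y i‖ ^ 2 ∂ν := integral_nonneg fun _ => by positivity
  -- Right translations make the mean squares of all entries in `K` equal. There are at least `r` of
  -- them and they sum to at most 1.
  have hi (i) (hi : i ∈ I) : ∫ y, ‖ρ y i‖ ^ 2 ∂ν ≤ 1 / r := by
    obtain ⟨K, hKr, hK⟩ := hK i hi
    have h1 : ∀ k ∈ K, ∫ y, ‖ρ y k‖ ^ 2 ∂ν = ∫ y, ‖ρ y i‖ ^ 2 ∂ν := by
      intro k hk
      by_cases hki : k = i
      · rw [hki]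
      obtain ⟨h, hh⟩ := hK k hk hki
      rw [← integral_mul_right_eq_self (fun y => ‖ρ y i‖ ^ 2) h]
      simp only [hh]
    have h2 : (K.card : ℝ) * ∫ y, ‖ρ y i‖ ^ 2 ∂ν ≤ 1 := by
      rw [← nsmul_eq_mul, ← Finset.sum_const, ← Finset.sum_congr rfl h1, ← hsum]
      exact Finset.sum_le_sum_of_subset_of_nonneg (Finset.subset_univ _) fun i _ _ => hnn i
    rw [le_div_iff₀ (by exact_mod_cast hr), mul_comm]
    refine le_trans ?_ h2
    have : (r : ℝ) ≤ K.card := by exact_mod_cast hKr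
    exact mul_le_mul_of_nonneg_right this (hnn i)
  have hI : ∫ y, ∑ i ∈ I, ‖ρ y i‖ ^ 2 ∂ν ≤ I.card / r := by
    rw [integral_finsetSum _ fun i _ => hint i]
    refine (Finset.sum_le_sum hi).trans (le_of_eq ?_)
    rw [Finset.sum_const, nsmul_eq_mul, mul_one_div]
  -- Markov's inequality.
  have hm := mul_meas_ge_le_integral_of_nonneg (μ := ν) (f := fun y => ∑ i ∈ I, ‖ρ y i‖ ^ 2)
    (Eventually.of_forall fun y => Finset.sum_nonneg fun _ _ => by positivity)
    (integrable_finsetSum _ fun i _ => hint i) c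
  rw [← ENNReal.ofReal_toReal (measure_ne_top ν _)]
  refine ENNReal.ofReal_le_ofReal ?_
  change ν.real _ ≤ _
  rw [← div_div, le_div_iff₀ hc, mul_comm]
  exact hm.trans hI

end Average

namespace ClassicalSeries

theorem card_poles_le (t : ClassicalSeries) (r : ℕ) : (t.poles r).card ≤ 2 := by
  have h (a b : ℕ) : (Finset.univ.filter fun i : Fin (t.size r) => (i : ℕ) = a ∨ (i : ℕ) = b).card
      ≤ 2 := by
    rw [← Finset.card_map Fin.valEmbedding]
    refine (Finset.card_le_card (t := {a, b}) fun x hx => ?_).trans Finset.card_le_two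
    simp only [Finset.mem_map, Finset.mem_filter] at hx
    obtain ⟨i, ⟨-, hi⟩, rfl⟩ := hx
    simpa using hi
  obtain ⟨b, hb⟩ : ∃ b : ℕ, ∀ i ∈ t.poles r, (i : ℕ) = 0 ∨ (i : ℕ) = b := by
    cases t with
    | A => exact ⟨0, fun i hi => .inl (Finset.mem_filter.1 hi).2⟩
    | B => exact ⟨1, fun i hi => Nat.le_one_iff_eq_zero_or_eq_one.1 (Finset.mem_filter.1 hi).2⟩
    | C => exact ⟨r, fun i hi => (Finset.mem_filter.1 hi).2⟩
    | D => exact ⟨1, fun i hi => Nat.le_one_iff_eq_zero_or_eq_one.1 (Finset.mem_filter.1 hi).2⟩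
  exact (Finset.card_le_card fun i hi => Finset.mem_filter.2 ⟨Finset.mem_univ _, hb i hi⟩).trans
    (h 0 b)

theorem mem_matrixLocus_of_poles {t : ClassicalSeries} {r : ℕ}
    {M : Matrix (Fin (t.size r)) (Fin (t.size r)) ℂ} {z : Fin (t.size r)} (hz : (z : ℕ) = 0)
    (h : ∀ i ∈ t.poles r, M z i = 0) : M ∈ t.matrixLocus r := by
  have heq : ∀ i : Fin (t.size r), (i : ℕ) = 0 → i = z := fun i hi => Fin.ext (hi.trans hz.symm)
  cases t with
  | A =>
    intro i hi
    rw [heq i hi]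
    exact h z (Finset.mem_filter.2 ⟨Finset.mem_univ _, hz⟩)
  | B =>
    intro i j hi hj
    rw [heq i hi]
    exact h j (Finset.mem_filter.2 ⟨Finset.mem_univ _, hj⟩)
  | C =>
    intro i hi
    rw [heq i hi, h z (Finset.mem_filter.2 ⟨Finset.mem_univ _, .inl hz⟩), Complex.zero_re]
  | D =>
    intro i j hi hj
    rw [heq i hi]
    exact h j (Finset.mem_filter.2 ⟨Finset.mem_univ _, hj⟩)

end ClassicalSeries

/-! ### Tubes around the concentration locus -/

namespace Presentation

variable {G : CompactConnectedLieGroup} (D : Presentation G) {g : G.Metric}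

/-- The angle is at most `π δ / 2` and the generator has norm at most `√2`; the crude bounds `π ≤ 4`
and `√2 ≤ 3 / 2` give the constant 3. -/
theorem exists_mul_mem_locus (hg : g.IsBiInvariant) {i : Fin D.k} {t : ClassicalSeries}
    {r : ℕ} {σ : ClassicalStructure (D.factor i) t r} (hσ : D.IsStandardOn g i σ)
    {z : Fin (t.size r)} (hz : (z : ℕ) = 0) {δ : ℝ} (hδ0 : 0 ≤ δ) (hδ : δ < 1) {y : D.factor i}
    (hy : ∑ k ∈ t.poles r, ‖σ.rep y z k‖ ^ 2 ≤ δ ^ 2) :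
    ∃ h, y * h ∈ σ.locus ∧ ∀ x : G, g.edist x (x * D.incl i h) ≤ ENNReal.ofReal (3 * δ) := by
  obtain ⟨Y, hY, hY3, hYt, θ, hθ0, hθ, h⟩ :=
    ClassicalSeries.exists_rot_poles_eq_zero (σ.rep_mem y) z (hy.trans_lt (by nlinarith))
  obtain ⟨h', hh, hd⟩ := D.exists_rep_eq_rot hg hσ hY hY3 hθ0
  refine ⟨h', ClassicalSeries.mem_matrixLocus_of_poles hz fun k hk => ?_, fun x => ?_⟩
  · rw [map_mul, hh]; exact h k hk
  · refine (hd x).trans (ENNReal.ofReal_le_ofReal ?_)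
    have h1 : √(∑ k ∈ t.poles r, ‖σ.rep y z k‖ ^ 2) ≤ δ := Real.sqrt_le_iff.2 ⟨hδ0, hy⟩
    have h2 : √(-(1 / 2) * (Y * Y).trace.re) ≤ 3 / 2 :=
      Real.sqrt_le_iff.2 ⟨by norm_num, by linarith⟩
    calc θ * √(-(1 / 2) * (Y * Y).trace.re) ≤ (Real.pi / 2 * δ) * (3 / 2) := by
          gcongr; exact hθ.trans (by gcongr)
      _ ≤ (4 / 2 * δ) * (3 / 2) := by gcongr; exact Real.pi_le_four
      _ = 3 * δ := by ring

/-- The selected factors are distinct, so they can be rotated one after the other without disturbing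
each other, and the displacements add. -/
theorem exists_mem_locus_edist_le (hg : g.IsBiInvariant) {ι : Type*} [Fintype ι]
    {j : ι → Fin D.k} (hj : Function.Injective j) {t : ι → ClassicalSeries} {r : ι → ℕ}
    {σ : ∀ a, ClassicalStructure (D.factor (j a)) (t a) (r a)}
    (hσ : ∀ a, D.IsStandardOn g (j a) (σ a)) {z : ∀ a, Fin ((t a).size (r a))}
    (hz : ∀ a, (z a : ℕ) = 0) {δ : ℝ} (hδ0 : 0 ≤ δ) (hδ : δ < 1) {y : D.Cover}
    (hy : ∀ a, ∑ k ∈ (t a).poles (r a), ‖(σ a).rep (y.1 (j a)) (z a) k‖ ^ 2 ≤ δ ^ 2) :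
    ∃ w : D.Cover, (∀ a, w.1 (j a) ∈ (σ a).locus) ∧
      g.edist (D.proj y) (D.proj w) ≤ ENNReal.ofReal (Fintype.card ι * (3 * δ)) := by
  classical
  choose h hloc hd using fun a => D.exists_mul_mem_locus hg (hσ a) (hz a) hδ0 hδ (hy a)
  have key (s : Finset ι) : ∃ w : D.Cover, (∀ a ∈ s, w.1 (j a) = y.1 (j a) * h a) ∧
      (∀ a ∉ s, w.1 (j a) = y.1 (j a)) ∧
      g.edist (D.proj y) (D.proj w) ≤ s.card * ENNReal.ofReal (3 * δ) := by
    induction s using Finset.induction_on with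
    | empty => exact ⟨y, by simp, by simp, by simp [g.edist_self]⟩
    | insert b s hb ih =>
      obtain ⟨w, h1, h2, h3⟩ := ih
      have hne (a) (hab : a ≠ b) : (w * D.single (j b) (h b)).1 (j a) = w.1 (j a) := by
        rw [Prod.fst_mul, Pi.mul_apply, D.single_fst_of_ne (hj.ne hab), mul_one]
      refine ⟨w * D.single (j b) (h b), fun a ha => ?_, fun a ha => ?_, ?_⟩
      · by_cases hab : a = b
        · subst hab
          rw [Prod.fst_mul, Pi.mul_apply, D.single_fst_self, h2 a hb]
        · rw [hne a hab, h1 a ((Finset.mem_insert.1 ha).resolve_left hab)]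
      · rw [Finset.mem_insert, not_or] at ha
        rw [hne a ha.1, h2 a ha.2]
      · refine (g.edist_triangle _ (D.proj w) _).trans ?_
        rw [map_mul, Finset.card_insert_of_notMem hb, Nat.cast_succ, add_mul, one_mul]
        exact add_le_add h3 (hd b _)
  obtain ⟨w, h1, -, h3⟩ := key Finset.univ
  refine ⟨w, fun a => ?_, h3.trans (le_of_eq ?_)⟩
  · rw [h1 a (Finset.mem_univ a)]; exact hloc a
  · rw [ENNReal.ofReal_mul (p := (Fintype.card ι : ℝ)) (by positivity), ENNReal.ofReal_natCast,
      Finset.card_univ]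

theorem measure_compl_tube_le (hg : g.IsBiInvariant) {ι : Type*} [Fintype ι]
    {j : ι → Fin D.k} (hj : Function.Injective j) {t : ι → ClassicalSeries} {r : ι → ℕ}
    {σ : ∀ a, ClassicalStructure (D.factor (j a)) (t a) (r a)}
    (hσ : ∀ a, D.IsStandardOn g (j a) (σ a)) (hr : ∀ a, 0 < r a) (μ : Measure G)
    [μ.IsHaarMeasure] [IsProbabilityMeasure μ] {δ ε : ℝ} (hδ0 : 0 < δ) (hδ : δ < 1)
    (hε : Fintype.card ι * (3 * δ) < ε) :
    μ (g.tube (D.proj '' {x | ∀ a, x.1 (j a) ∈ (σ a).locus}) ε)ᶜ ≤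
      ∑ a, ENNReal.ofReal (2 / (r a * δ ^ 2)) := by
  let : MeasurableSpace D.Cover := borel _
  have : BorelSpace D.Cover := ⟨rfl⟩
  obtain ⟨ν, hν1, hν2, hν⟩ := exists_isHaarMeasure_map_eq μ D.continuous_proj D.surjective
  let z (a : ι) : Fin ((t a).size (r a)) := ⟨0, ((σ a).size_of_isSimple (D.simple (j a))).1⟩
  let β (a : ι) (y : D.Cover) : ℝ := ∑ k ∈ (t a).poles (r a), ‖(σ a).rep (y.1 (j a)) (z a) k‖ ^ 2
  have hrow (a : ι) : Continuous fun y : D.Cover => (σ a).rep (y.1 (j a)) (z a) :=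
    (continuous_apply (z a)).comp ((σ a).continuous_rep.comp
      ((continuous_apply (j a)).comp continuous_fst))
  have hβ (a : ι) : Continuous (β a) := by
    have := hrow a
    exact continuous_finsetSum _ fun k _ => ((continuous_apply k).comp this).norm.pow 2
  -- An open subset of the tube, used in its place so that measurability of the tube never enters;
  -- `proj` is open as a local diffeomorphism.
  let O : Set G := D.proj '' {y | ∀ a, β a y < δ ^ 2}
  have hO : IsOpen O := by
    refine D.isLocalDiffeomorph.isOpenMap _ ?_
    rw [ofPred_forall]
    exact isOpen_iInter_of_finite fun a => isOpen_lt (hβ a) continuous_const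
  have hsub : O ⊆ g.tube (D.proj '' {x | ∀ a, x.1 (j a) ∈ (σ a).locus}) ε := by
    rintro _ ⟨y, hy, rfl⟩
    obtain ⟨w, hw, hd⟩ := D.exists_mem_locus_edist_le hg hj hσ (z := z) (fun _ => rfl) hδ0.le hδ
      (fun a => (hy a).le)
    exact ⟨_, ⟨w, hw, rfl⟩, hd.trans_lt ((ENNReal.ofReal_lt_ofReal_iff
      (lt_of_le_of_lt (by positivity) hε)).2 hε)⟩
  refine (measure_mono (compl_subset_compl.2 hsub)).trans ?_
  rw [← hν, Measure.map_apply D.continuous_proj.measurable hO.measurableSet.compl]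
  have hpre : D.proj ⁻¹' Oᶜ ⊆ ⋃ a, {y | δ ^ 2 ≤ β a y} := by
    intro y hy
    by_contra hcon
    simp only [mem_iUnion, mem_ofPred_eq, not_exists, not_le] at hcon
    exact hy ⟨y, hcon, rfl⟩
  refine (measure_mono hpre).trans ((measure_iUnion_fintype_le ν _).trans
    (Finset.sum_le_sum fun a _ => ?_))
  refine (measure_sum_norm_sq_ge_le ν (fun y => (σ a).rep (y.1 (j a)) (z a)) (hrow a)
    (fun y => ClassicalSeries.sum_norm_sq_row ((σ a).rep_mem _) _) ((t a).poles (r a)) (r a)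
    (fun i hi => ?_) (by positivity) (hr a)).trans (ENNReal.ofReal_le_ofReal ?_)
  · obtain ⟨K, hK, hex⟩ := ClassicalSeries.exists_rot_exchange i hi
    refine ⟨K, hK, fun k hk hki => ?_⟩
    obtain ⟨Y, hY, hY3, h⟩ := hex k hk hki
    obtain ⟨h', hh, -⟩ := D.exists_rep_eq_rot hg (hσ a) hY hY3 (θ := Real.pi / 2) (by positivity)
    refine ⟨D.single (j a) h', fun y => ?_⟩
    rw [Prod.fst_mul, Pi.mul_apply, D.single_fst_self, map_mul, hh, h, norm_neg]
  · have : 0 < (r a : ℝ) := by exact_mod_cast hr a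
    gcongr
    exact_mod_cast ClassicalSeries.card_poles_le _ _

end Presentation

/-! ### The concentration loci -/

/-- Otherwise a defining function would vanish near the identity, and its derivative there would be
zero and not surjective. -/
theorem IsSubmanifoldOfCodim.ne_univ {G : CompactConnectedLieGroup} {c : ℕ} {N : Set G}
    (hc : 0 < c) (hN : IsSubmanifoldOfCodim G c N) : N ≠ univ := by
  intro h
  obtain ⟨U, f, hU, h1, -, hsurj, hNU⟩ := hN 1 (h ▸ mem_univ _)
  rw [h, univ_inter] at hNU
  have hf : f =ᶠ[𝓝 1] fun _ => 0 := by
    filter_upwards [hU.mem_nhds h1] with y hy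
    rw [hNU] at hy
    exact hy.2
  have h0 := hf.mfderiv_eq (I := 𝓡 G.dim) (I' := 𝓡 c)
  obtain ⟨v, hv⟩ := hsurj 1 h1 (EuclideanSpace.single (⟨0, hc⟩ : Fin c) (1 : ℝ))
  have hz : (0 : EuclideanSpace ℝ (Fin c)) = EuclideanSpace.single (⟨0, hc⟩ : Fin c) (1 : ℝ) := by
    refine Eq.trans ?_ hv
    have h2 : (mfderiv (𝓡 G.dim) (𝓡 c) f 1 : EuclideanSpace ℝ (Fin G.dim) →L[ℝ]
        EuclideanSpace ℝ (Fin c)) = 0 := h0.trans mfderiv_const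
    exact (congrArg (fun L : EuclideanSpace ℝ (Fin G.dim) →L[ℝ] EuclideanSpace ℝ (Fin c) => L v)
      h2).symm
  have := congrArg norm hz
  simp at this

theorem tendsto_sum_inv_mul_sqrt {ι : Type*} [Fintype ι] [Nonempty ι] {r : ι → ℕ → ℕ}
    (hr : ∀ a, Tendsto (r a) atTop atTop) : ∃ δ : ℕ → ℝ, (∀ n, 0 < δ n) ∧
      Tendsto δ atTop (𝓝 0) ∧
      Tendsto (fun n => ∑ a, 2 / ((r a n : ℝ) * δ n ^ 2)) atTop (𝓝 0) := by
  -- The radius `δ = ρ^(1/4)` tends to zero, yet slowly enough: for `r ≥ 1` one has `2 / r ≤ 4 / (r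
  -- + 1) ≤ 4 ρ`, so each term is at most `4 √ρ`. The `+ 1` keeps `ρ` positive for all `n`, also
  -- where a rank is zero.
  let ρ (n : ℕ) : ℝ := ∑ a, 1 / ((r a n : ℝ) + 1)
  have hρ0 (n) : 0 < ρ n := Finset.sum_pos (fun a _ => by positivity) Finset.univ_nonempty
  have hρ : Tendsto ρ atTop (𝓝 0) := by
    have := tendsto_finsetSum (Finset.univ : Finset ι) fun a _ =>
      tendsto_one_div_add_atTop_nhds_zero_nat (𝕜 := ℝ).comp (hr a)
    simpa [ρ, Function.comp_def] using this
  have hsqrt : Tendsto (fun n => √(ρ n)) atTop (𝓝 0) := by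
    simpa [Function.comp_def] using (Real.continuous_sqrt.tendsto 0).comp hρ
  refine ⟨fun n => √√(ρ n), fun n => Real.sqrt_pos.2 (Real.sqrt_pos.2 (hρ0 n)), ?_, ?_⟩
  · simpa [Function.comp_def] using (Real.continuous_sqrt.tendsto 0).comp hsqrt
  · have hlim : Tendsto (fun n => Fintype.card ι * (4 * √(ρ n))) atTop (𝓝 0) := by
      simpa using (hsqrt.const_mul 4).const_mul (Fintype.card ι : ℝ)
    refine squeeze_zero' (Eventually.of_forall fun n => Finset.sum_nonneg fun a _ => by positivity)
      ?_ hlim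
    have hpos : ∀ᶠ n in atTop, ∀ a, 0 < r a n :=
      eventually_all.2 fun a => (hr a).eventually (eventually_gt_atTop 0)
    filter_upwards [hpos] with n hn
    rw [← nsmul_eq_mul, ← Finset.card_univ]
    refine Finset.sum_le_card_nsmul _ _ _ fun a _ => ?_
    have hs := Real.sqrt_pos.2 (hρ0 n)
    have h1 : (1 : ℝ) ≤ r a n := by exact_mod_cast hn a
    have h2 : 1 / ((r a n : ℝ) + 1) ≤ √(ρ n) * √(ρ n) := by
      rw [Real.mul_self_sqrt (hρ0 n).le]
      exact Finset.single_le_sum (f := fun a => 1 / ((r a n : ℝ) + 1)) (fun a _ => by positivity)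
        (Finset.mem_univ a)
    rw [Real.sq_sqrt hs.le, div_le_iff₀ (by positivity)]
    rw [div_le_iff₀ (by positivity)] at h2
    nlinarith [mul_pos hs hs]

theorem isConcentrationLocus_of_classical {G : ℕ → CompactConnectedLieGroup}
    (D : ∀ n, Presentation (G n)) {ι : Type} [Finite ι] [Nonempty ι] (j : ι → ∀ n, Fin (D n).k)
    {t : ι → ClassicalSeries} {r : ι → ℕ → ℕ}
    (σ : ∀ a n, ClassicalStructure ((D n).factor (j a n)) (t a) (r a n))
    (g : ∀ n, (G n).Metric) (μ : ∀ n, Measure (G n))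
    [∀ n, (μ n).IsHaarMeasure] [∀ n, IsProbabilityMeasure (μ n)]
    (hj : ∀ n, Function.Injective fun a => j a n) (hr : ∀ a, Tendsto (r a) atTop atTop)
    (hg : ∀ n, (g n).IsBiInvariant) (hσ : ∀ a n, (D n).IsStandardOn (g n) (j a n) (σ a n)) :
    IsConcentrationLocus G g μ
      (fun n => (D n).proj '' {x | ∀ a, x.1 (j a n) ∈ (σ a n).locus}) := by
  have hsub (n : ℕ) : ∃ c : ℕ, 0 < c ∧ ∃ N, IsSubmanifoldOfCodim (G n) c N ∧
      (D n).proj '' {x | ∀ a, x.1 (j a n) ∈ (σ a n).locus} ⊆ N := by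
    obtain ⟨a⟩ := ‹Nonempty ι›
    let z : Fin ((t a).size (r a n)) := ⟨0, ((σ a n).size_of_isSimple ((D n).simple (j a n))).1⟩
    exact ⟨(t a).codim, (t a).codim_pos, _, Presentation.isSubmanifoldOfCodim_height (σ a n) z,
      image_mono fun x hx => (σ a n).height_eq_zero_of_mem_locus (z := z) rfl (hx a)⟩
  refine ⟨fun n => ?_, fun n => ?_, hsub, ?_⟩
  · refine (IsClosed.isCompact ?_ |>.image (D n).continuous_proj).isClosed
    rw [ofPred_forall]
    exact isClosed_iInter fun a => (σ a n).isClosed_locus.preimage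
      ((continuous_apply (j a n)).comp continuous_fst)
  · obtain ⟨c, hc, N, hN, hS⟩ := hsub n
    intro h
    rw [h, univ_subset_iff] at hS
    exact hN.ne_univ hc hS
  · have := Fintype.ofFinite ι
    obtain ⟨δ, hδ0, hδ, hsum⟩ := tendsto_sum_inv_mul_sqrt hr
    have hcard : 0 < (Fintype.card ι : ℝ) := by exact_mod_cast Fintype.card_pos
    -- The factor 4 instead of 3 leaves room for the strict inequality in the definition of the
    -- tube.
    refine ⟨fun n => Fintype.card ι * (4 * δ n), fun n => ?_, ?_, ?_⟩
    · have := hδ0 n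
      positivity
    · simpa using (hδ.const_mul 4).const_mul (Fintype.card ι : ℝ)
    · have hlim : Tendsto (fun n => ∑ a, ENNReal.ofReal (2 / ((r a n : ℝ) * δ n ^ 2))) atTop
          (𝓝 0) := by
        have := (ENNReal.continuous_ofReal.tendsto 0).comp hsum
        rw [ENNReal.ofReal_zero] at this
        refine this.congr fun n => ?_
        exact ENNReal.ofReal_sum_of_nonneg fun a _ => by positivity
      refine tendsto_of_tendsto_of_tendsto_of_le_of_le' tendsto_const_nhds hlim
        (Eventually.of_forall fun _ => zero_le) ?_
      have hpos : ∀ᶠ n in atTop, ∀ a, 0 < r a n :=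
        eventually_all.2 fun a => (hr a).eventually (eventually_gt_atTop 0)
      filter_upwards [hpos, hδ.eventually (eventually_lt_nhds one_pos)] with n hn hδ1
      refine (D n).measure_compl_tube_le (hg n) (hj n) (fun a => hσ a n) hn (μ n) (hδ0 n) hδ1 ?_
      have := hδ0 n
      gcongr
      norm_num

theorem mainTheorem6 (G : ℕ → CompactConnectedLieGroup) (D : ∀ n, Presentation (G n)) :
    -- an increasing sequence with a common simple factor `G₀`
    (∀ (C : LieGroupChain G) (G₀ : CompactConnectedLieGroup) (i₀ : ∀ n, Fin (D n).k)
        (e : ∀ n, G₀ ≃* (D n).factor (i₀ n)),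
      (∀ n, ContMDiff (𝓡 G₀.dim) (𝓡 ((D n).factor (i₀ n)).dim) ∞ (e n)) →
      (∀ n, ContMDiff (𝓡 ((D n).factor (i₀ n)).dim) (𝓡 G₀.dim) ∞ (e n).symm) →
      (∀ m n (h : m ≤ n) (x : G₀),
        C.map m n h ((D m).incl (i₀ m) (e m x)) = (D n).incl (i₀ n) (e n x)) →
      ∃ (K : CompactConnectedLieGroup) (q : G₀ →* K), Function.Surjective q ∧
        IsLocalDiffeomorph (𝓡 G₀.dim) (𝓡 K.dim) ∞ q ∧ Finite q.ker ∧
        (∀ x, q x = 1 ↔ ∃ n, ∃ z ∈ (D n).proj.ker, z.1 (i₀ n) = e n x) ∧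
        HasEquicontinuousActionWithoutFixedPoint C.Limit K) ∧
    -- an increasing sequence with nontrivial tori
    (∀ (C : LieGroupChain G) (n₀ : ℕ), (∀ n > n₀, (D n).s ≠ 0) →
      (∀ m n (h : m ≤ n), n₀ < m →
        (D n).semisimplePart.comap (C.map m n h) = (D m).semisimplePart) →
      HasEquicontinuousActionWithoutFixedPoint C.Limit Circle) ∧
    -- finitely many factors that run through classical series
    (∀ (ι : Type) [Finite ι] [Nonempty ι] (j : ι → ∀ n, Fin (D n).k)
        (t : ι → ClassicalSeries) (r : ι → ℕ → ℕ)
        (σ : ∀ a n, ClassicalStructure ((D n).factor (j a n)) (t a) (r a n))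
        (g : ∀ n, (G n).Metric) (μ : ∀ n, Measure (G n))
        [∀ n, (μ n).IsHaarMeasure] [∀ n, IsProbabilityMeasure (μ n)],
      (∀ n, Function.Injective fun a => j a n) →
      (∀ a, Tendsto (r a) atTop atTop) →
      (∀ n, (g n).IsBiInvariant) →
      (∀ a n, (D n).IsStandardOn (g n) (j a n) (σ a n)) →
      IsConcentrationLocus G g μ
        (fun n => (D n).proj '' {x | ∀ a, x.1 (j a n) ∈ (σ a n).locus})) := by
  refine ⟨fun C G₀ i₀ e _ he' hC => exists_quotient_action_of_common_factor D C G₀ i₀ e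
    (fun n => (he' n).continuous) hC, fun C n₀ hs hS => hasAction_circle_of_tori D C n₀ hs hS,
    fun ι _ _ j t r σ g μ _ _ hj hr hg hσ => ?_⟩
  exact isConcentrationLocus_of_classical D j σ g μ hj hr hg hσ
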